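/- Let $k$ be a field, $A$ a unital associative $k$-algebra, $V$ a $k$-vector space with a distinguished element $1\in V$, and let $\chi\colon V\otimes_k A\to A\otimes_k V$ and $\mathcal F\colon V\otimes_k V\to A\otimes_k V$ be $k$-linear maps such that * $\chi$ is a twisting map: $\chi(v\otimes 1)=1\otimes v$, $\chi(1\otimes a)=a\otimes 1$ and $\chi\circ(V\otimes\mu_A)=(\mu_A\otimes V)\circ(A\otimes\chi)\circ(\chi\otimes A)$; * $\mathcal F$ is normal: $\mathcal F(1\otimes v)=\mathcal F(v\otimes 1)=1\otimes v$; * $\mathcal F$ is a cocycle: $(\mu_A\otimes V)(A\otimes\mathcal F)(\chi\otimes V)(V\otimes\mathcal F)=(\mu_A\otimes V)(A\otimes\mathcal F)(\mathcal F\otimes V)$ on $V^{\otimes_k 3}$; * $\mathcal F$ satisfies the twisted module condition: $(\mu_A\otimes V)(A\otimes\mathcal F)(\chi\otimes V)(V\otimes\chi)=(\mu_A\otimes V)(A\otimes\chi)(\mathcal F\otimes A)$ on $V\otimes_k V\otimes_k A$. Let $E=A\#V$ be Brzeziński's crossed product: the space $A\otimes_k V$ with the multiplication $(\mu_A\otimes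 V)(\mu_A\otimes\mathcal F)(A\otimes\chi\otimes V)$, which is associative with unit $1\#1$. Let $A\to E$ be the map $a\mapsto a\#1$, and write $\gamma(v)=1\#v$, so that $a\#v=a\gamma(v)$. Let $K\subseteq A$ be a subalgebra stable under $\chi$, that is, $\chi(V\otimes_k K)\subseteq K\otimes_k V$. Write $\otimes=\otimes_K$, $\overline A=A/K$ and $E/A$ for the quotient of $E$ by the image of $A$. Let $\Upsilon$ be the class of the epimorphisms of $E$-bimodules that split as maps of $(E,K)$-bimodules. For $r,s\ge 0$ put $$Y_s=E\otimes_A(E/A)^{\otimes_A s}\otimes_A E,\qquad X_{rs}=E\otimes_A(E/A)^{\otimes_A s}\otimes\overline A^{\otimes r}\otimes E .$$ Let $\partial\colon Y_{s+1}\to Y_s$ be the differential of the normalized bar resolution of the $A$-algebra $E$, let $d^0\colon X_{r+1,s}\to X_{rs}$ be $(-1)^s$ times the differential of the normalized bar resolution of the $K$-algebra $A$, tensored over $A$ on the left with $E\otimes_A(E/A)^{\otimes_A s}$ and on the right with $E$, and let $\nu_s\colon X_{0s}\to Y_s$ be the canonical surjection. Consider the maps of $(E,K)$-bimodules $$\sigma^0_{0s}\colon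 Y_s\to X_{0s},\quad y\otimes_A\gamma(v)\mapsto y\otimes\gamma(v),$$ $$\sigma^0_{r+1,s}\colon X_{rs}\to X_{r+1,s},\quad y\otimes a_1\otimes\cdots\otimes a_r\otimes a_{r+1}\gamma(v)\mapsto(-1)^{r+s+1}\,y\otimes a_1\otimes\cdots\otimes a_{r+1}\otimes\gamma(v),$$ $$\sigma^{-1}_0\colon E\to Y_0,\ x\mapsto -x\otimes_A 1,\qquad \sigma^{-1}_{s+1}\colon Y_s\to Y_{s+1},\ y\mapsto(-1)^s y\otimes_A 1 ,$$ where in the last map the last factor $E$ of $Y_s$ is projected to $E/A$. Define $E$-bimodule maps $d^l_{rs}\colon X_{rs}\to X_{r+l-1,s-l}$, for $r\ge 0$ and $1\le l\le s$, recursively on $l$ and $r$, by $$d^l(z)=\begin{cases}\sigma^0\partial\nu(z)&\text{if }l=1,\ r=0,\\ -\sigma^0 d^1d^0(z)&\text{if }l=1,\ r>0,\\ -\sum_{j=1}^{l-1}\sigma^0d^{l-j}d^j(z)&\text{if }l>1,\ r=0,\\ -\sum_{j=0}^{l-1}\sigma^0d^{l-j}d^j(z)&\text{if }l>1,\ r>0,\end{cases}$$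 for the elements $z$ of the form $y\otimes a_1\otimes\cdots\otimes a_r\otimes 1$ with $y\in E\otimes_A(E/A)^{\otimes_A s}$ and $a_i\in A$. Define also, recursively on $l$, maps $\sigma^l_{l,s-l}\colon Y_s\to X_{l,s-l}$ and $\sigma^l_{r+l+1,s-l}\colon X_{rs}\to X_{r+l+1,s-l}$ by $\sigma^l=-\sum_{i=0}^{l-1}\sigma^0d^{l-i}\sigma^i$ for $0<l\le s$. Put $$X_n=\bigoplus_{r+s=n}X_{rs},\qquad d_n=\sum_{l=1}^n d^l_{0n}+\sum_{r=1}^n\sum_{l=0}^{n-r}d^l_{r,n-r}\colon X_n\to X_{n-1}\quad(n\ge 1),$$ and let $\mu\colon X_0=E\otimes E\to E$ be the multiplication map. Then $$E\xleftarrow{-\mu}X_0\xleftarrow{d_1}X_1\xleftarrow{d_2}X_2\leftarrow\cdots$$ is an $\Upsilon$-projective resolution of the $E$-bimodule $E$: every $X_n$ has the lifting property with respect to the maps in $\Upsilon$, the compositions vanish, and $-\mu$ and the maps $X_1\to\ker\mu$ and $X_{n+1}\to\ker d_n$ ($n\ge 1$) belong to $\Upsilon$. Moreover, the $(E,K)$-bimodule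 maps $\overline\sigma_0=\sigma^0_{00}\sigma^{-1}_0\colon E\to X_0$ and $$\overline\sigma_{n+1}=-\sum_{l=0}^{n+1}\sigma^l_{l,n-l+1}\,\sigma^{-1}_{n+1}\,\nu_n+\sum_{r=0}^n\sum_{l=0}^{n-r}\sigma^l_{r+l+1,n-r-l}\colon X_n\to X_{n+1}\qquad(n\ge 0)$$ form a contracting homotopy of this complex. -/

import Mathlib

open TensorProduct MulOpposite

universe u v w

namespace BrzCross

/-! ## Bimodules, bimodule maps and tensor products over noncommutative rings -/

/-- An `(S, R)`-bimodule: commuting left `S`-action and right `R`-action (a left `Rᵐᵒᵖ`-action). -/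
structure Bimodule (S R : Type*) [Ring S] [Ring R] where
  carrier : Type w
  [grp : AddCommGroup carrier]
  [left : Module S carrier]
  [right : Module Rᵐᵒᵖ carrier]
  [comm : SMulCommClass S Rᵐᵒᵖ carrier]

instance (S R : Type*) [Ring S] [Ring R] : CoeSort (Bimodule.{w} S R) (Type w) :=
  ⟨Bimodule.carrier⟩

attribute [instance] Bimodule.grp Bimodule.left Bimodule.right Bimodule.comm

section bimodules
variable {S R T C : Type*} [Ring S] [Ring R] [Ring T] [Ring C]

/-- The additive group of maps of `(S, R)`-bimodules `M → N`. -/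
def BHom (M N : Bimodule S R) : AddSubgroup (M →ₗ[S] N) where
  carrier := {f | ∀ (r : R) (m : M), f (op r • m) = op r • f m}
  zero_mem' := fun r m => by simp
  add_mem' := fun {f g} hf hg r m => by
    rw [LinearMap.add_apply, LinearMap.add_apply, hf r m, hg r m, smul_add]
  neg_mem' := fun {f} hf r m => by
    rw [LinearMap.neg_apply, LinearMap.neg_apply, hf r m, smul_neg]

namespace BHom

/-- The identity. -/
def id (M : Bimodule S R) : BHom M M := ⟨LinearMap.id, fun _ _ => rfl⟩

/-- Composition of bimodule maps. -/
def comp {M N P : Bimodule S R} (g : BHom N P) (f : BHom M N) : BHom M P :=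
  ⟨g.1 ∘ₗ f.1, fun r m => by
    rw [LinearMap.comp_apply, LinearMap.comp_apply, f.2 r m, g.2 r _]⟩

end BHom

/-- A ring as a bimodule over itself. -/
@[reducible] def Bimodule.self (C : Type w) [Ring C] : Bimodule.{w} C C where
  carrier := C

/-- Restriction of the right action along a ring homomorphism. -/
def Bimodule.resR (φ : R →+* C) (M : Bimodule.{w} S C) : Bimodule.{w} S R :=
  letI : Module Rᵐᵒᵖ M := Module.compHom M φ.op
  { carrier := M
    grp := M.grp
    left := M.left
    right := Module.compHom M φ.op
    comm := ⟨fun s r m => smul_comm s (φ.op r) m⟩ }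

/-- An element of `M` as an element of `M` with restricted right action. -/
def toR (φ : R →+* C) {M : Bimodule.{w} S C} : M ≃ₗ[S] M.resR φ := LinearEquiv.refl S M

lemma op_smul_toR (φ : R →+* C) {M : Bimodule.{w} S C} (r : R) (m : M) :
    op r • toR φ m = toR φ (op (φ r) • m) := rfl

/-- For `(S, C)`-bimodules, the additive group of left `S`-linear and right `R`-linear maps, where
`R` acts on the right through `φ : R → C`: the maps of `(S, R)`-bimodules. -/
def BHomOver (φ : R →+* C) (M N : Bimodule S C) : AddSubgroup (M →ₗ[S] N) where
  carrier := {f | ∀ (r : R) (m : M), f (op (φ r) • m) = op (φ r) • f m}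
  zero_mem' := fun r m => by simp
  add_mem' := fun {f g} hf hg r m => by
    rw [LinearMap.add_apply, LinearMap.add_apply, hf r m, hg r m, smul_add]
  neg_mem' := fun {f} hf r m => by
    rw [LinearMap.neg_apply, LinearMap.neg_apply, hf r m, smul_neg]

/-- Composition of `(S, R)`-bimodule maps between `(S, C)`-bimodules. -/
def BHomOver.comp {φ : R →+* C} {M N P : Bimodule S C} (g : BHomOver φ N P)
    (f : BHomOver φ M N) : BHomOver φ M P :=
  ⟨g.1 ∘ₗ f.1, fun r m => by
    rw [LinearMap.comp_apply, LinearMap.comp_apply, f.2 r m, g.2 r _]⟩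

/-- An `(S, C)`-bimodule map is an `(S, R)`-bimodule map. -/
def BHom.over (φ : R →+* C) {M N : Bimodule S C} (f : BHom M N) : BHomOver φ M N :=
  ⟨f.1, fun r m => f.2 (φ r) m⟩

/-- The quotient of a bimodule by a subbimodule. -/
def Bimodule.quo (M : Bimodule.{w} S R) (p : Submodule S M)
    (hp : ∀ (r : Rᵐᵒᵖ), ∀ x ∈ p, r • x ∈ p) : Bimodule.{w} S R :=
  letI act : Rᵐᵒᵖ → Module.End S (M ⧸ p) := fun r => p.mapQ p
    { toFun := fun x => r • x
      map_add' := smul_add r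
      map_smul' := fun s x => (smul_comm s r x).symm } (hp r)
  letI : Module Rᵐᵒᵖ (M ⧸ p) :=
    { smul := fun r x => act r x
      one_smul := fun x => by
        obtain ⟨x, rfl⟩ := Submodule.Quotient.mk_surjective _ x
        exact congrArg (Submodule.Quotient.mk (p := p)) (one_smul _ x)
      mul_smul := fun a b x => by
        obtain ⟨x, rfl⟩ := Submodule.Quotient.mk_surjective _ x
        exact congrArg (Submodule.Quotient.mk (p := p)) (mul_smul a b x)
      smul_zero := fun a => (act a).map_zero
      smul_add := fun a x y => (act a).map_add x y
      add_smul := fun a b x => by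
        obtain ⟨x, rfl⟩ := Submodule.Quotient.mk_surjective _ x
        exact congrArg (Submodule.Quotient.mk (p := p)) (add_smul a b x)
      zero_smul := fun x => by
        obtain ⟨x, rfl⟩ := Submodule.Quotient.mk_surjective _ x
        exact congrArg (Submodule.Quotient.mk (p := p)) (zero_smul _ x) }
  haveI : SMulCommClass S Rᵐᵒᵖ (M ⧸ p) := ⟨fun s r x => ((act r).map_smul s x).symm⟩
  ⟨M ⧸ p⟩

/-- A ring `C` as an `R`-bimodule, along a ring homomorphism `R → C`. -/
def Bimodule.ofHom {C : Type w} [Ring C] (φ : R →+* C) : Bimodule.{w} R R :=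
  letI : Module R C := Module.compHom C φ
  letI : Module Rᵐᵒᵖ C := Module.compHom C φ.op
  haveI : SMulCommClass R Rᵐᵒᵖ C := ⟨fun r s c => (mul_assoc (φ r) c (φ s.unop)).symm⟩
  ⟨C⟩

/-- The image of a ring homomorphism `φ : R → C`, as a left `R`-submodule of `C`. -/
def Bimodule.imageSubmodule {C : Type w} [Ring C] (φ : R →+* C) :
    Submodule R (Bimodule.ofHom φ) where
  carrier := Set.range φ
  zero_mem' := ⟨0, map_zero φ⟩
  add_mem' := by
    rintro _ _ ⟨a, rfl⟩ ⟨b, rfl⟩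
    exact ⟨a + b, map_add φ a b⟩
  smul_mem' := by
    rintro r _ ⟨a, rfl⟩
    exact ⟨r * a, map_mul φ r a⟩

/-- The quotient `C/R` of a ring by the image of a ring homomorphism `φ : R → C`,
as an `R`-bimodule. -/
def Bimodule.quot {C : Type w} [Ring C] (φ : R →+* C) : Bimodule.{w} R R :=
  Bimodule.quo (Bimodule.ofHom φ) (Bimodule.imageSubmodule φ) (by
    rintro r _ ⟨a, rfl⟩
    exact ⟨a * r.unop, map_mul φ a r.unop⟩)

section quot
variable {C : Type w} [Ring C] (φ : R →+* C)

/-- The class in `C/R` of an element of `C`. -/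
def quotMk : C →+ Bimodule.quot φ :=
  (Bimodule.imageSubmodule φ).mkQ.toAddMonoidHom

lemma quotMk_map (r : R) : quotMk φ (φ r) = 0 :=
  (Submodule.Quotient.mk_eq_zero (Bimodule.imageSubmodule φ)).2 ⟨r, rfl⟩

lemma quotMk_one : quotMk φ 1 = 0 := by
  have := quotMk_map φ 1
  rwa [map_one] at this

lemma smul_quotMk (r : R) (c : C) : r • quotMk φ c = quotMk φ (φ r * c) := rfl

lemma op_smul_quotMk (r : R) (c : C) : op r • quotMk φ c = quotMk φ (c * φ r) := rfl

lemma quotMk_surjective : Function.Surjective (quotMk φ) :=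
  (Bimodule.imageSubmodule φ).mkQ_surjective

/-- Additive maps out of `C/R`. -/
def quotLift {P : Type*} [AddCommGroup P] (f : C →+ P) (hf : ∀ r, f (φ r) = 0) :
    Bimodule.quot φ →+ P :=
  QuotientAddGroup.lift (Bimodule.imageSubmodule φ).toAddSubgroup f (by
    rintro _ ⟨r, rfl⟩
    exact hf r)

@[simp] lemma quotLift_mk {P : Type*} [AddCommGroup P] (f : C →+ P) (hf : ∀ r, f (φ r) = 0)
    (c : C) : quotLift φ f hf (quotMk φ c) = f c := rfl

end quot

/-- The right action of an element of `T` on `M ⊗_ℤ N`. -/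
def tensAct (M : Bimodule S R) (N : Bimodule C T) (t : Tᵐᵒᵖ) :
    (M ⊗[ℤ] N) →ₗ[S] (M ⊗[ℤ] N) :=
  { toFun := TensorProduct.map LinearMap.id (DistribSMul.toAddMonoidHom N t).toIntLinearMap
    map_add' := map_add _
    map_smul' := fun s x => by
      induction x with
      | zero => simp
      | tmul m n => simp [TensorProduct.smul_tmul']
      | add x y hx hy => simp only [smul_add, map_add, hx, hy] }

@[simp] lemma tensAct_tmul (M : Bimodule S R) (N : Bimodule C T) (t : Tᵐᵒᵖ) (m : M) (n : N) :
    tensAct M N t (m ⊗ₜ n) = m ⊗ₜ (t • n) := rfl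

/-- The `(S, T)`-bimodule `M ⊗_ℤ N`. -/
def tensZ (M : Bimodule.{w} S R) (N : Bimodule.{w} C T) : Bimodule.{w} S T :=
  letI : Module Tᵐᵒᵖ (M ⊗[ℤ] N) :=
    have key : ∀ f g : (M ⊗[ℤ] N) →+ (M ⊗[ℤ] N),
        (∀ (m : M) (n : N), f (m ⊗ₜ n) = g (m ⊗ₜ n)) → ∀ x, f x = g x := fun f g h x => by
      induction x with
      | zero => rw [map_zero, map_zero]
      | tmul m n => exact h m n
      | add x y hx hy => rw [map_add, map_add, hx, hy]
    { smul := fun t x => tensAct M N t x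
      one_smul := key (tensAct M N 1).toAddMonoidHom (AddMonoidHom.id _) fun m n =>
        congrArg (fun y : N => m ⊗ₜ[ℤ] y) (one_smul _ n)
      mul_smul := fun a b => key (tensAct M N (a * b)).toAddMonoidHom
        ((tensAct M N a).toAddMonoidHom.comp (tensAct M N b).toAddMonoidHom) fun m n =>
        congrArg (fun y : N => m ⊗ₜ[ℤ] y) (mul_smul a b n)
      smul_zero := fun a => (tensAct M N a).map_zero
      smul_add := fun a => (tensAct M N a).map_add
      add_smul := fun a b => key (tensAct M N (a + b)).toAddMonoidHom
        ((tensAct M N a).toAddMonoidHom + (tensAct M N b).toAddMonoidHom) fun m n =>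
        (congrArg (fun y : N => m ⊗ₜ[ℤ] y) (add_smul a b n)).trans (TensorProduct.tmul_add _ _ _)
      zero_smul := key (tensAct M N 0).toAddMonoidHom 0 fun m n =>
        (congrArg (fun y : N => m ⊗ₜ[ℤ] y) (zero_smul _ n)).trans (TensorProduct.tmul_zero _ _) }
  haveI : SMulCommClass S Tᵐᵒᵖ (M ⊗[ℤ] N) := ⟨fun s t x => ((tensAct M N t).map_smul s x).symm⟩
  ⟨M ⊗[ℤ] N⟩

/-- The `S`-submodule of `M ⊗_ℤ N` generated by the elements `m r ⊗ n - m ⊗ φ(r) n`. -/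
def tensRel (M : Bimodule.{w} S R) (φ : R →+* C) (N : Bimodule.{w} C T) : Submodule S (tensZ M N) :=
  Submodule.span S
    {x | ∃ (m : M) (r : R) (n : N), x = (op r • m) ⊗ₜ[ℤ] n - m ⊗ₜ[ℤ] (φ r • n)}

/-- The tensor product `M ⊗_R N` of an `(S, R)`-bimodule `M` and a `(C, T)`-bimodule `N`, the ring
`R` acting on the left on `N` through `φ : R → C`. -/
def tens (M : Bimodule.{w} S R) (φ : R →+* C) (N : Bimodule.{w} C T) : Bimodule.{w} S T :=
  Bimodule.quo (tensZ M N) (tensRel M φ N) (by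
    intro t
    refine fun x hx => (Submodule.span_le (p := (tensRel M φ N).comap (tensAct M N t))).2 ?_ hx
    rintro _ ⟨m, r, n, rfl⟩
    refine Submodule.subset_span ⟨m, r, t • n, ?_⟩
    rw [map_sub, tensAct_tmul, tensAct_tmul, smul_comm (φ r) t n])

/-- The simple tensor `m ⊗_R n`. -/
def tmk {M : Bimodule.{w} S R} (φ : R →+* C) {N : Bimodule.{w} C T} (m : M) (n : N) : tens M φ N :=
  Submodule.Quotient.mk (m ⊗ₜ[ℤ] n)

section tmk
variable {M : Bimodule.{w} S R} {φ : R →+* C} {N : Bimodule.{w} C T}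

lemma add_tmk (m m' : M) (n : N) : tmk φ (m + m') n = tmk φ m n + tmk φ m' n :=
  congrArg (Submodule.Quotient.mk (p := tensRel M φ N)) (TensorProduct.add_tmul m m' n)

lemma tmk_plus (m : M) (n n' : N) : tmk φ m (n + n') = tmk φ m n + tmk φ m n' :=
  congrArg (Submodule.Quotient.mk (p := tensRel M φ N)) (TensorProduct.tmul_add m n n')

lemma zero_tmk (n : N) : tmk φ (0 : M) n = 0 :=
  congrArg (Submodule.Quotient.mk (p := tensRel M φ N)) (TensorProduct.zero_tmul _ n)

lemma tmk_zero (m : M) : tmk φ m (0 : N) = 0 :=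
  congrArg (Submodule.Quotient.mk (p := tensRel M φ N)) (TensorProduct.tmul_zero _ m)

lemma tmk_bal (m : M) (r : R) (n : N) : tmk φ (op r • m) n = tmk φ m (φ r • n) :=
  (Submodule.Quotient.eq _).2 (Submodule.subset_span ⟨m, r, n, rfl⟩)

lemma smul_tmk (s : S) (m : M) (n : N) : s • tmk φ m n = tmk φ (s • m) n := rfl

lemma op_smul_tmk (t : T) (m : M) (n : N) : op t • tmk φ m n = tmk φ m (op t • n) := rfl

lemma tens_induction {p : tens M φ N → Prop} (h0 : p 0) (h1 : ∀ m n, p (tmk φ m n))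
    (h2 : ∀ x y, p x → p y → p (x + y)) (x : tens M φ N) : p x := by
  obtain ⟨x, rfl⟩ := Submodule.Quotient.mk_surjective _ x
  change M ⊗[ℤ] N at x
  induction x with
  | zero => exact h0
  | tmul m n => exact h1 m n
  | add x y hx hy => exact h2 _ _ hx hy

/-- The left linear map on `M ⊗_ℤ N` given by a biadditive map. -/
def tensLiftZ (M : Bimodule.{w} S R) (N : Bimodule.{w} C T) {P : Type*} [AddCommGroup P]
    [Module S P] (f : M →+ N →+ P)
    (hs : ∀ (s : S) (m : M) (n : N), f (s • m) n = s • f m n) : (M ⊗[ℤ] N) →ₗ[S] P where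
  toFun := TensorProduct.liftAddHom (R := ℤ) f (fun r m n => by simp)
  map_add' := map_add _
  map_smul' := fun s x => by
    induction x with
    | zero => simp
    | tmul m n => exact hs s m n
    | add x y hx hy => simp only [smul_add, map_add, hx, hy]

/-- Balanced biadditive maps that are linear in the first variable induce maps on `M ⊗_R N`. -/
def tensLift {P : Type*} [AddCommGroup P] [Module S P] (f : M →+ N →+ P)
    (hb : ∀ (m : M) (r : R) (n : N), f (op r • m) n = f m (φ r • n))
    (hs : ∀ (s : S) (m : M) (n : N), f (s • m) n = s • f m n) : tens M φ N →ₗ[S] P :=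
  (tensRel M φ N).liftQ (tensLiftZ M N f hs) (by
    refine Submodule.span_le.2 ?_
    rintro _ ⟨m, r, n, rfl⟩
    refine (map_sub (tensLiftZ M N f hs) _ _).trans ?_
    exact sub_eq_zero.2 (hb m r n))

@[simp] lemma tensLift_tmk {P : Type*} [AddCommGroup P] [Module S P] (f : M →+ N →+ P) (hb hs)
    (m : M) (n : N) : tensLift (S := S) f hb hs (tmk φ m n) = f m n := rfl

end tmk

/-- The biadditive map `(m, n) ↦ m ⊗_R n`. -/
def tmkHom (M : Bimodule.{w} S R) (φ : R →+* C) (N : Bimodule.{w} C T) : M →+ N →+ tens M φ N :=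
  AddMonoidHom.mk' (fun m => AddMonoidHom.mk' (fun n => tmk φ m n) (tmk_plus m))
    (fun m m' => AddMonoidHom.ext fun n => add_tmk m m' n)

@[simp] lemma tmkHom_apply (M : Bimodule.{w} S R) (φ : R →+* C) (N : Bimodule.{w} C T) (m : M) (n : N) :
    tmkHom M φ N m n = tmk φ m n := rfl

lemma BHom.ext_tens {M : Bimodule.{w} S R} {φ : R →+* C} {N : Bimodule.{w} C T} {P : Bimodule S T}
    {f g : BHom (tens M φ N) P} (h : ∀ m n, f.1 (tmk φ m n) = g.1 (tmk φ m n)) : f = g := by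
  refine Subtype.ext (LinearMap.ext fun x => ?_)
  refine tens_induction (p := fun x => f.1 x = g.1 x) (by rw [map_zero, map_zero]) h
    (fun x y hx hy => ?_) x
  rw [map_add, map_add, hx, hy]

/-- The direct sum of a family of bimodules. -/
@[reducible] def dsum {ι : Type} (M : ι → Bimodule.{w} S R) : Bimodule.{w} S R where
  carrier := DirectSum ι fun i => M i

/-- The inclusion of a summand. -/
def dincl {ι : Type} [DecidableEq ι] (M : ι → Bimodule.{w} S R) (i : ι) : BHom (M i) (dsum M) :=
  ⟨DirectSum.lof S ι (fun i => M i) i,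
    fun r m => (DirectSum.lof Rᵐᵒᵖ ι (fun i => M i) i).map_smul (op r) m⟩

lemma toModule_op_smul {ι : Type} [DecidableEq ι] {M : ι → Bimodule.{w} S C}
    {N : Bimodule S C} (f : ∀ i, M i →ₗ[S] N) (c : C)
    (h : ∀ i (m : M i), f i (op c • m) = op c • f i m) (x : DirectSum ι fun i => M i) :
    DirectSum.toModule S ι N f (op c • x) = op c • DirectSum.toModule S ι N f x := by
  induction x using DirectSum.induction_on with
  | zero => rw [smul_zero, map_zero, smul_zero]
  | of i x =>
    have h' : op c • (DirectSum.lof S ι (fun i => M i) i x) =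
        DirectSum.lof S ι (fun i => M i) i (op c • x) :=
      ((DirectSum.lof Cᵐᵒᵖ ι (fun i => M i) i).map_smul (op c) x).symm
    change DirectSum.toModule S ι N _ (op c • (DirectSum.lof S ι (fun i => M i) i _)) =
      op c • DirectSum.toModule S ι N _ (DirectSum.lof S ι (fun i => M i) i _)
    rw [h', DirectSum.toModule_lof, DirectSum.toModule_lof]
    exact h i x
  | add x y hx hy => rw [smul_add, map_add, hx, hy, map_add, smul_add]

/-- The bimodule map on a direct sum with given components. -/
def dsumLift {ι : Type} [DecidableEq ι] {M : ι → Bimodule.{w} S R}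
    {N : Bimodule S R} (f : ∀ i, BHom (M i) N) : BHom (dsum M) N :=
  ⟨DirectSum.toModule S ι N (fun i => (f i).1),
    fun r => toModule_op_smul _ r (fun i => (f i).2 r)⟩

/-- The `(S, R)`-bimodule map with given components on a direct sum of `(S, C)`-bimodules. -/
def dsumLiftOver {ι : Type} [DecidableEq ι] (φ : R →+* C) {M : ι → Bimodule.{w} S C}
    {N : Bimodule S C} (f : ∀ i, BHomOver φ (M i) N) : BHomOver φ (dsum M) N :=
  ⟨DirectSum.toModule S ι N (fun i => (f i).1),
    fun r => toModule_op_smul _ (φ r) (fun i => (f i).2 r)⟩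

/-- The kernel of a bimodule map. -/
def BHom.ker {M N : Bimodule S R} (f : BHom M N) : Bimodule S R :=
  letI : Module Rᵐᵒᵖ (LinearMap.ker f.1) :=
    { smul := fun r x => ⟨r • x.1, by
        have h := f.2 r.unop x.1
        rw [LinearMap.mem_ker.1 x.2, smul_zero, op_unop] at h
        exact h⟩
      one_smul := fun x => Subtype.ext (one_smul _ x.1)
      mul_smul := fun a b x => Subtype.ext (mul_smul a b x.1)
      smul_zero := fun a => Subtype.ext (smul_zero a)
      smul_add := fun a x y => Subtype.ext (smul_add a x.1 y.1)
      add_smul := fun a b x => Subtype.ext (add_smul a b x.1)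
      zero_smul := fun x => Subtype.ext (zero_smul _ x.1) }
  haveI : SMulCommClass S Rᵐᵒᵖ (LinearMap.ker f.1) :=
    ⟨fun s r x => Subtype.ext (smul_comm s r x.1)⟩
  ⟨LinearMap.ker f.1⟩

/-- The corestriction of `g` to the kernel of `f`, when `f ∘ g = 0`. -/
def BHom.toKer {L M N : Bimodule S R} (f : BHom M N) (g : BHom L M) (h : BHom.comp f g = 0) :
    BHom L (BHom.ker f) :=
  ⟨LinearMap.codRestrict (LinearMap.ker f.1) g.1 fun x =>
      LinearMap.mem_ker.2 (LinearMap.congr_fun (congrArg Subtype.val h) x),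
    fun r x => Subtype.ext (g.2 r x)⟩

end bimodules

/-! ## Brzezinski's crossed products -/

section crossed
variable {k : Type u} {A V : Type w} [Field k] [Ring A] [Algebra k A] [AddCommGroup V] [Module k V]

/-- For `f : V ⊗ W → A ⊗ V`, the map `(μ_A ⊗ V) ∘ (A ⊗ f) : A ⊗ V ⊗ W → A ⊗ V`, that is
`a ⊗ v ⊗ w ↦ a f(v ⊗ w)`. -/
noncomputable def actL {W : Type w} [AddCommGroup W] [Module k W]
    (f : V ⊗[k] W →ₗ[k] A ⊗[k] V) : (A ⊗[k] V) ⊗[k] W →ₗ[k] A ⊗[k] V :=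
  LinearMap.rTensor V (LinearMap.mul' k A) ∘ₗ (TensorProduct.assoc k A A V).symm.toLinearMap ∘ₗ
    LinearMap.lTensor A f ∘ₗ (TensorProduct.assoc k A V W).toLinearMap

/-- `χ` is a twisting map: it is compatible with the algebra structure of `A` and
`χ(1 ⊗ a) = a ⊗ 1`. -/
structure IsTwistingMap (one : V) (χ : V ⊗[k] A →ₗ[k] A ⊗[k] V) : Prop where
  map_unit : ∀ v : V, χ (v ⊗ₜ 1) = 1 ⊗ₜ v
  map_mult : ∀ (v : V) (a b : A), χ (v ⊗ₜ (a * b)) = actL χ (χ (v ⊗ₜ a) ⊗ₜ b)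
  map_one_left : ∀ a : A, χ (one ⊗ₜ a) = a ⊗ₜ one

/-- `F` is normal: `F(1 ⊗ v) = F(v ⊗ 1) = 1 ⊗ v`. -/
structure IsNormal (one : V) (F : V ⊗[k] V →ₗ[k] A ⊗[k] V) : Prop where
  one_left : ∀ v : V, F (one ⊗ₜ v) = 1 ⊗ₜ v
  one_right : ∀ v : V, F (v ⊗ₜ one) = 1 ⊗ₜ v

/-- `(μ_A ⊗ V) ∘ (A ⊗ F) ∘ (χ ⊗ V) : V ⊗ A ⊗ V → A ⊗ V`. -/
noncomputable def mulV (χ : V ⊗[k] A →ₗ[k] A ⊗[k] V) (F : V ⊗[k] V →ₗ[k] A ⊗[k] V) :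
    V ⊗[k] (A ⊗[k] V) →ₗ[k] A ⊗[k] V :=
  actL F ∘ₗ LinearMap.rTensor V χ ∘ₗ (TensorProduct.assoc k V A V).symm.toLinearMap

/-- `F` is a cocycle:
`(μ_A ⊗ V)(A ⊗ F)(χ ⊗ V)(V ⊗ F) = (μ_A ⊗ V)(A ⊗ F)(F ⊗ V)` on `V ⊗ V ⊗ V`. -/
def IsCocycle (χ : V ⊗[k] A →ₗ[k] A ⊗[k] V) (F : V ⊗[k] V →ₗ[k] A ⊗[k] V) : Prop :=
  ∀ u v w : V, mulV χ F (u ⊗ₜ F (v ⊗ₜ w)) = actL F (F (u ⊗ₜ v) ⊗ₜ w)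

/-- `F` satisfies the twisted module condition:
`(μ_A ⊗ V)(A ⊗ F)(χ ⊗ V)(V ⊗ χ) = (μ_A ⊗ V)(A ⊗ χ)(F ⊗ A)` on `V ⊗ V ⊗ A`. -/
def IsTwistedModule (χ : V ⊗[k] A →ₗ[k] A ⊗[k] V) (F : V ⊗[k] V →ₗ[k] A ⊗[k] V) : Prop :=
  ∀ (v w : V) (a : A), mulV χ F (v ⊗ₜ χ (w ⊗ₜ a)) = actL χ (F (v ⊗ₜ w) ⊗ₜ a)

/-- The multiplication `(μ_A ⊗ V) ∘ (μ_A ⊗ F) ∘ (A ⊗ χ ⊗ V)` of `A # V`, that is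
`((μ_A ⊗ V)(A ⊗ F)) ∘ ((μ_A ⊗ V)(A ⊗ χ) ⊗ V)`. -/
noncomputable def crossMul (χ : V ⊗[k] A →ₗ[k] A ⊗[k] V) (F : V ⊗[k] V →ₗ[k] A ⊗[k] V) :
    (A ⊗[k] V) ⊗[k] (A ⊗[k] V) →ₗ[k] A ⊗[k] V :=
  actL F ∘ₗ LinearMap.rTensor V (actL χ) ∘ₗ
    (TensorProduct.assoc k (A ⊗[k] V) A V).symm.toLinearMap

variable (k A V) in
/-- The data defining a crossed product `A # V`: a distinguished element `1 ∈ V`, a twisting map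
`χ` and a normal cocycle `F` that satisfies the twisted module condition. -/
structure CrossedSystem where
  one : V
  χ : V ⊗[k] A →ₗ[k] A ⊗[k] V
  F : V ⊗[k] V →ₗ[k] A ⊗[k] V
  twisting : IsTwistingMap one χ
  normal : IsNormal one F
  cocycle : IsCocycle χ F
  twistedModule : IsTwistedModule χ F

section aux
variable (χ : V ⊗[k] A →ₗ[k] A ⊗[k] V) (F : V ⊗[k] V →ₗ[k] A ⊗[k] V)

lemma actL_tmul {W : Type w} [AddCommGroup W] [Module k W] (f : V ⊗[k] W →ₗ[k] A ⊗[k] V)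
    (a : A) (v : V) (x : W) : actL f ((a ⊗ₜ v) ⊗ₜ x) = a • f (v ⊗ₜ x) := by
  simp only [actL, LinearMap.comp_apply, LinearEquiv.coe_coe, TensorProduct.assoc_tmul,
    LinearMap.lTensor_tmul]
  induction f (v ⊗ₜ x) with
  | zero => simp
  | tmul b y => simp [TensorProduct.smul_tmul']
  | add y z hy hz => rw [TensorProduct.tmul_add, map_add, map_add, hy, hz, smul_add]

lemma actL_smul {W : Type w} [AddCommGroup W] [Module k W] (f : V ⊗[k] W →ₗ[k] A ⊗[k] V)
    (a : A) (y : A ⊗[k] V) (x : W) : actL f ((a • y) ⊗ₜ x) = a • actL f (y ⊗ₜ x) := by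
  induction y with
  | zero => simp
  | tmul b v => rw [TensorProduct.smul_tmul', actL_tmul, actL_tmul, smul_eq_mul, mul_smul]
  | add y z hy hz => rw [smul_add, TensorProduct.add_tmul, map_add, hy, hz, TensorProduct.add_tmul,
      map_add, smul_add]

lemma crossMul_tmul (x : A ⊗[k] V) (b : A) (v : V) :
    crossMul χ F (x ⊗ₜ (b ⊗ₜ v)) = actL F (actL χ (x ⊗ₜ b) ⊗ₜ v) := by
  simp [crossMul]

lemma crossMul_smul (a : A) (x y : A ⊗[k] V) :
    crossMul χ F ((a • x) ⊗ₜ y) = a • crossMul χ F (x ⊗ₜ y) := by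
  induction y with
  | zero => simp
  | tmul b v => rw [crossMul_tmul, crossMul_tmul, actL_smul, actL_smul]
  | add y z hy hz => rw [TensorProduct.tmul_add, map_add, hy, hz, TensorProduct.tmul_add, map_add,
      smul_add]

lemma crossMul_left (a : A) (v : V) (y : A ⊗[k] V) :
    crossMul χ F ((a ⊗ₜ v) ⊗ₜ y) = a • mulV χ F (v ⊗ₜ y) := by
  induction y with
  | zero => simp
  | tmul b u =>
    rw [crossMul_tmul, actL_tmul, actL_smul]
    simp [mulV]
  | add y z hy hz => rw [TensorProduct.tmul_add, map_add, hy, hz, TensorProduct.tmul_add, map_add,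
      smul_add]
end aux

namespace CrossedSystem

/-- The underlying space `A ⊗ V` of the crossed product `E = A # V`. -/
def E (_ : CrossedSystem k A V) : Type w := A ⊗[k] V

variable (D : CrossedSystem k A V)

noncomputable instance : AddCommGroup D.E := inferInstanceAs (AddCommGroup (A ⊗[k] V))

lemma actL_actL (x : A ⊗[k] V) (a b : A) :
    actL D.χ (actL D.χ (x ⊗ₜ a) ⊗ₜ b) = actL D.χ (x ⊗ₜ (a * b)) := by
  induction x with
  | zero => simp
  | tmul c v => rw [actL_tmul, actL_tmul, actL_smul, D.twisting.map_mult]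
  | add y z hy hz => simp only [TensorProduct.add_tmul, map_add, hy, hz]

lemma crossMul_actL (x y : A ⊗[k] V) (b : A) :
    crossMul D.χ D.F (actL D.χ (x ⊗ₜ b) ⊗ₜ y) = crossMul D.χ D.F (x ⊗ₜ (b • y)) := by
  induction y with
  | zero => simp
  | tmul c v => rw [TensorProduct.smul_tmul', crossMul_tmul, crossMul_tmul, actL_actL, smul_eq_mul]
  | add y z hy hz => simp only [TensorProduct.tmul_add, map_add, hy, hz, smul_add]

lemma crossMul_F (x : A ⊗[k] V) (v u : V) :
    crossMul D.χ D.F (x ⊗ₜ D.F (v ⊗ₜ u)) = actL D.F (actL D.F (x ⊗ₜ v) ⊗ₜ u) := by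
  induction x with
  | zero => simp
  | tmul a w => rw [crossMul_left, D.cocycle, actL_tmul, actL_smul]
  | add y z hy hz => simp only [TensorProduct.add_tmul, map_add, hy, hz]

lemma crossMul_actF (x y : A ⊗[k] V) (u : V) :
    crossMul D.χ D.F (x ⊗ₜ actL D.F (y ⊗ₜ u)) = actL D.F (crossMul D.χ D.F (x ⊗ₜ y) ⊗ₜ u) := by
  induction y with
  | zero => simp
  | tmul c v => rw [actL_tmul, ← crossMul_actL, crossMul_F, crossMul_tmul]
  | add y z hy hz => simp only [TensorProduct.add_tmul, TensorProduct.tmul_add, map_add, hy, hz]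

lemma crossMul_χ (x : A ⊗[k] V) (v : V) (a : A) :
    crossMul D.χ D.F (x ⊗ₜ D.χ (v ⊗ₜ a)) = actL D.χ (actL D.F (x ⊗ₜ v) ⊗ₜ a) := by
  induction x with
  | zero => simp
  | tmul b w => rw [crossMul_left, D.twistedModule, actL_tmul, actL_smul]
  | add y z hy hz => simp only [TensorProduct.add_tmul, map_add, hy, hz]

lemma crossMul_assoc (x y z : A ⊗[k] V) :
    crossMul D.χ D.F (crossMul D.χ D.F (x ⊗ₜ y) ⊗ₜ z) =
      crossMul D.χ D.F (x ⊗ₜ crossMul D.χ D.F (y ⊗ₜ z)) := by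
  induction y with
  | zero => simp
  | tmul b v =>
    rw [crossMul_left D.χ D.F b v z, ← crossMul_actL, crossMul_tmul]
    generalize actL D.χ (x ⊗ₜ b) = X
    induction z with
    | zero => simp
    | tmul c u =>
      have h : mulV D.χ D.F (v ⊗ₜ (c ⊗ₜ u)) = actL D.F (D.χ (v ⊗ₜ c) ⊗ₜ u) := by simp [mulV]
      rw [h, crossMul_actF, crossMul_χ, crossMul_tmul]
    | add y z hy hz => simp only [TensorProduct.tmul_add, map_add, hy, hz]
  | add y z hy hz => simp only [TensorProduct.add_tmul, TensorProduct.tmul_add, map_add, hy, hz]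

lemma one_crossMul (x : A ⊗[k] V) : crossMul D.χ D.F ((1 ⊗ₜ D.one) ⊗ₜ x) = x := by
  induction x with
  | zero => simp
  | tmul b v =>
    rw [crossMul_tmul, actL_tmul, one_smul, D.twisting.map_one_left, actL_tmul,
      D.normal.one_left, TensorProduct.smul_tmul', smul_eq_mul, mul_one]
  | add y z hy hz => rw [TensorProduct.tmul_add, map_add, hy, hz]

lemma crossMul_one (x : A ⊗[k] V) : crossMul D.χ D.F (x ⊗ₜ (1 ⊗ₜ D.one)) = x := by
  induction x with
  | zero => simp
  | tmul b v =>
    rw [crossMul_tmul, actL_tmul, D.twisting.map_unit, actL_smul, actL_tmul,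
      D.normal.one_right, one_smul, TensorProduct.smul_tmul', smul_eq_mul, mul_one]
  | add y z hy hz => rw [TensorProduct.add_tmul, map_add, hy, hz]

/-- The crossed product `E = A # V` is an associative ring with unit `1 # 1`. -/
noncomputable instance : Ring D.E :=
  { (inferInstance : AddCommGroup D.E) with
    mul := fun x y => crossMul D.χ D.F (x ⊗ₜ[k] y)
    one := (1 : A) ⊗ₜ[k] D.one
    mul_assoc := D.crossMul_assoc
    one_mul := D.one_crossMul
    mul_one := D.crossMul_one
    left_distrib := fun x y z =>
      (congrArg (crossMul D.χ D.F) (TensorProduct.tmul_add (R := k) (M := A ⊗[k] V)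
        (N := A ⊗[k] V) x y z)).trans (map_add _ _ _)
    right_distrib := fun x y z =>
      (congrArg (crossMul D.χ D.F) (TensorProduct.add_tmul (R := k) (M := A ⊗[k] V)
        (N := A ⊗[k] V) x y z)).trans (map_add _ _ _)
    zero_mul := fun x =>
      (congrArg (crossMul D.χ D.F) (TensorProduct.zero_tmul (R := k) (A ⊗[k] V)
        (N := A ⊗[k] V) x)).trans (map_zero _)
    mul_zero := fun x =>
      (congrArg (crossMul D.χ D.F) (TensorProduct.tmul_zero (R := k) (M := A ⊗[k] V)
        (A ⊗[k] V) x)).trans (map_zero _) }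

/-- The element `a # v`, also written `a γ(v)`. -/
noncomputable def el (a : A) (v : V) : D.E := a ⊗ₜ[k] v

lemma el_mul (a b : A) (v : V) : D.el a D.one * D.el b v = D.el (a * b) v := by
  change crossMul D.χ D.F ((a ⊗ₜ[k] D.one) ⊗ₜ (b ⊗ₜ[k] v)) = _
  rw [crossMul_left]
  have h := D.one_crossMul (b ⊗ₜ v)
  rw [crossMul_left, one_smul] at h
  rw [h]
  rfl

/-- The map `i_A : A → E`, `a ↦ a # 1`. -/
noncomputable def iA : A →+* D.E where
  toFun a := D.el a D.one
  map_one' := rfl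
  map_mul' a b := (D.el_mul a b D.one).symm
  map_zero' := TensorProduct.zero_tmul A D.one
  map_add' a b := TensorProduct.add_tmul a b D.one

/-- Additive maps out of `E`: give the values on the elements `a γ(v)`. -/
noncomputable def liftE {P : Type*} [AddCommGroup P] (f : A →+ V →+ P)
    (hf : ∀ (c : k) (a : A) (v : V), f (c • a) v = f a (c • v)) : D.E →+ P :=
  TensorProduct.liftAddHom f hf

@[simp] lemma liftE_el {P : Type*} [AddCommGroup P] (f : A →+ V →+ P) (hf) (a : A) (v : V) :
    D.liftE f hf (D.el a v) = f a v := rfl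

lemma E_induction {p : D.E → Prop} (h1 : ∀ a v, p (D.el a v))
    (h2 : ∀ x y, p x → p y → p (x + y)) (x : D.E) : p x := by
  change A ⊗[k] V at x
  induction x with
  | zero => exact (TensorProduct.zero_tmul A (0 : V) : (0 : A) ⊗ₜ[k] (0 : V) = 0) ▸ h1 0 0
  | tmul a v => exact h1 a v
  | add x y hx hy => exact h2 x y hx hy

lemma el_mul_iA (a b : A) (v : V) :
    D.el a v * D.iA b = actL (k := k) D.χ ((a ⊗ₜ[k] v) ⊗ₜ[k] b) := by
  change crossMul D.χ D.F ((a ⊗ₜ[k] v) ⊗ₜ (b ⊗ₜ[k] D.one)) = _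
  rw [crossMul_tmul]
  generalize actL D.χ ((a ⊗ₜ[k] v) ⊗ₜ[k] b) = x
  induction x with
  | zero => simp
  | tmul c u => rw [actL_tmul, D.normal.one_right, TensorProduct.smul_tmul', smul_eq_mul, mul_one]
  | add y z hy hz => simp only [TensorProduct.add_tmul, map_add, hy, hz]

/-- A subalgebra `K` of `A` is stable under `χ` if `χ(V ⊗ K) ⊆ K ⊗ V` (as subspaces of
`A ⊗ V`). -/
def IsStable (K : Subalgebra k A) : Prop :=
  ∀ (v : V) (a : A), a ∈ K →
    D.χ (v ⊗ₜ a) ∈ LinearMap.range (LinearMap.rTensor V K.val.toLinearMap)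

end CrossedSystem
end crossed

/-! ## Normalized bar complexes -/

section bar
variable {S R : Type*} [Ring S] [Ring R] {C G : Type w} [Ring C] [Ring G]

/-- `M ⊗_R (C/R) ⊗_R ⋯ ⊗_R (C/R)`, with `n` factors `C/R`. -/
def barL (φ : R →+* C) (M : Bimodule.{w} S C) : ℕ → Bimodule.{w} S R
  | 0 => M.resR φ
  | n + 1 => tens (barL φ M n) (RingHom.id R) (Bimodule.quot φ)

/-- The simple tensor `m ⊗ c_1 ⊗ ⋯ ⊗ c_n`. -/
def barTmul (φ : R →+* C) {M : Bimodule.{w} S C} (m : M) : ∀ {n : ℕ}, (Fin n → C) → barL φ M n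
  | 0, _ => toR φ m
  | n + 1, c => tmk (RingHom.id R) (barTmul φ m (n := n) (Fin.init c)) (quotMk φ (c (Fin.last n)))

/-- `M ⊗_R (C/R) ⊗_R ⋯ ⊗_R (C/R) ⊗_R G`, with `n` factors `C/R`: the term of degree `n` of the
normalized bar resolution of the `R`-algebra `C`, tensored over `C` on the left with `M` and on
the right with a ring `G`, on which `C` acts through `ψ : C → G`. -/
@[reducible] def bar (φ : R →+* C) (ψ : C →+* G) (M : Bimodule.{w} S C) (n : ℕ) : Bimodule.{w} S G :=
  tens (barL φ M n) (ψ.comp φ) (Bimodule.self G)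

/-- A map `B × C → B`, used to record the part
`m c_1 ⊗ c_2 ⊗ ⋯ ⊗ c - m ⊗ c_1 c_2 ⊗ ⋯ ⊗ c + ⋯ + (-1)^n m ⊗ c_1 ⊗ ⋯ ⊗ c_n c`
of the bar differential, with `B = M ⊗ (C/R)^{⊗ n}`. -/
structure PartialFace (φ : R →+* C) (B : Bimodule.{w} S R) (n : ℕ) where
  f : B →ₗ[S] (C →+ B)
  bal : ∀ (b : B) (r : R) (c : C), f (op r • b) c = f b (φ r * c)
  right : ∀ (b : B) (c : C) (r : R), f b (c * φ r) = op r • f b c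
  unit : ∀ b : B, f b 1 = (-1 : ℤ) ^ n • b

namespace PartialFace
variable {φ : R →+* C} {B : Bimodule.{w} S R} {n : ℕ} (a : PartialFace φ B n) (ψ : C →+* G)

/-- `(b, c, x) ↦ f(b, c) ⊗ x + (-1)^{n+1} b ⊗ c x`. -/
def pre (b : B) (c : C) : G →+ tens B (ψ.comp φ) (Bimodule.self G) :=
  AddMonoidHom.mk' (fun x => tmk (ψ.comp φ) (N := Bimodule.self G) (a.f b c) x +
      (-1 : ℤ) ^ (n + 1) • tmk (ψ.comp φ) (N := Bimodule.self G) b (ψ c * x)) fun x y => by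
    rw [mul_add, tmk_plus, tmk_plus, smul_add]
    abel

lemma pre_apply (b : B) (c : C) (x : G) : a.pre ψ b c x =
    tmk (ψ.comp φ) (N := Bimodule.self G) (a.f b c) x +
      (-1 : ℤ) ^ (n + 1) • tmk (ψ.comp φ) (N := Bimodule.self G) b (ψ c * x) :=
  rfl

/-- `pre` on `B × C/R`. -/
def pre₂ (b : B) : Bimodule.quot φ →+ G →+ tens B (ψ.comp φ) (Bimodule.self G) :=
  quotLift φ (AddMonoidHom.mk' (a.pre ψ b) fun c c' => by
      ext x
      rw [AddMonoidHom.add_apply, a.pre_apply, a.pre_apply, a.pre_apply, map_add, add_tmk,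
        map_add, add_mul, tmk_plus, smul_add]
      abel)
    (fun r => by
      ext x
      change a.pre ψ b (φ r) x = 0
      have h1 : a.f b (φ r) = (-1 : ℤ) ^ n • (op r • b) := by
        rw [← a.unit, a.bal, mul_one]
      have h2 : tmk (ψ.comp φ) (N := Bimodule.self G) ((-1 : ℤ) ^ n • (op r • b)) x =
          (-1 : ℤ) ^ n • tmk (ψ.comp φ) (N := Bimodule.self G) b (ψ (φ r) * x) :=
        (map_zsmul ((tmkHom B (ψ.comp φ) (Bimodule.self G)).flip x) _ _).trans
          (congrArg _ (tmk_bal (φ := ψ.comp φ) (N := Bimodule.self G) b r x))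
      rw [a.pre_apply, h1, h2, ← add_smul, pow_succ]
      simp)

lemma pre₂_mk (b : B) (c : C) (x : G) :
    a.pre₂ ψ b (quotMk φ c) x = tmk (ψ.comp φ) (N := Bimodule.self G) (a.f b c) x +
      (-1 : ℤ) ^ (n + 1) • tmk (ψ.comp φ) (N := Bimodule.self G) b (ψ c * x) :=
  rfl

/-- The map `B ⊗_R (C/R) → Hom(G, B ⊗_R G)` induced by `pre`. -/
def pre₃ : tens B (RingHom.id R) (Bimodule.quot φ) →ₗ[S]
    (G →+ tens B (ψ.comp φ) (Bimodule.self G)) :=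
  tensLift (AddMonoidHom.mk' (a.pre₂ ψ) fun b b' => by
      ext q x
      obtain ⟨c, rfl⟩ := quotMk_surjective φ q
      rw [AddMonoidHom.add_apply, AddMonoidHom.add_apply, a.pre₂_mk, a.pre₂_mk, a.pre₂_mk,
        map_add, AddMonoidHom.add_apply, add_tmk, add_tmk, smul_add]
      abel)
    (fun b r q => by
      ext x
      obtain ⟨c, rfl⟩ := quotMk_surjective φ q
      change a.pre₂ ψ (op r • b) _ x = a.pre₂ ψ b (r • quotMk φ c) x
      rw [smul_quotMk, a.pre₂_mk, a.pre₂_mk, a.bal, tmk_bal, map_mul ψ, mul_assoc]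
      rfl)
    (fun s b q => by
      ext x
      obtain ⟨c, rfl⟩ := quotMk_surjective φ q
      change a.pre₂ ψ (s • b) _ x = s • a.pre₂ ψ b _ x
      rw [a.pre₂_mk, a.pre₂_mk, map_smul, smul_add, smul_comm s ((-1 : ℤ) ^ (n + 1)), smul_tmk,
        smul_tmk]
      rfl)

lemma pre₃_tmk (b : B) (c : C) (x : G) :
    a.pre₃ ψ (tmk (RingHom.id R) b (quotMk φ c)) x =
      tmk (ψ.comp φ) (N := Bimodule.self G) (a.f b c) x +
        (-1 : ℤ) ^ (n + 1) • tmk (ψ.comp φ) (N := Bimodule.self G) b (ψ c * x) :=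
  rfl

lemma pre₃_bal (t : tens B (RingHom.id R) (Bimodule.quot φ)) (r : R) (x : G) :
    a.pre₃ ψ (op r • t) x = a.pre₃ ψ t (ψ.comp φ r * x) := by
  induction t using tens_induction with
  | h0 => rw [smul_zero, map_zero]; rfl
  | h1 b q =>
    obtain ⟨c, rfl⟩ := quotMk_surjective φ q
    rw [op_smul_tmk, op_smul_quotMk, pre₃_tmk, pre₃_tmk, a.right, tmk_bal, map_mul, mul_assoc]
    rfl
  | h2 t t' h h' =>
    rw [smul_add, map_add, AddMonoidHom.add_apply, h, h', map_add, AddMonoidHom.add_apply]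

lemma pre₃_right (t : tens B (RingHom.id R) (Bimodule.quot φ)) (g x : G) :
    a.pre₃ ψ t (x * g) = op g • a.pre₃ ψ t x := by
  induction t using tens_induction with
  | h0 => rw [map_zero]; exact (smul_zero _).symm
  | h1 b q =>
    obtain ⟨c, rfl⟩ := quotMk_surjective φ q
    rw [pre₃_tmk, pre₃_tmk, smul_add, smul_comm (op g) ((-1 : ℤ) ^ (n + 1)), op_smul_tmk,
      op_smul_tmk, ← mul_assoc]
    rfl
  | h2 t t' h h' =>
    rw [map_add, AddMonoidHom.add_apply, h, h', AddMonoidHom.add_apply, smul_add]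

/-- The bimodule map `b ⊗ c ⊗ x ↦ f(b, c) ⊗ x + (-1)^{n+1} b ⊗ c x`. -/
def step : BHom (tens (tens B (RingHom.id R) (Bimodule.quot φ)) (ψ.comp φ) (Bimodule.self G))
    (tens B (ψ.comp φ) (Bimodule.self G)) :=
  ⟨tensLift (a.pre₃ ψ).toAddMonoidHom (a.pre₃_bal ψ)
    (fun s t x => DFunLike.congr_fun ((a.pre₃ ψ).map_smul s t) x),
  fun r y => by
    induction y using tens_induction with
    | h0 => simp only [smul_zero, map_zero]
    | h1 t x => exact a.pre₃_right ψ t r x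
    | h2 y y' h h' => rw [smul_add, map_add, h, h', map_add, smul_add]⟩

lemma step_tmk (b : B) (c : C) (x : G) :
    (a.step ψ).1 (tmk (ψ.comp φ) (N := Bimodule.self G)
        (tmk (RingHom.id R) b (quotMk φ c)) x) =
      tmk (ψ.comp φ) (N := Bimodule.self G) (a.f b c) x +
        (-1 : ℤ) ^ (n + 1) • tmk (ψ.comp φ) (N := Bimodule.self G) b (ψ c * x) :=
  rfl

end PartialFace

/-- The canonical surjection `B ⊗_R C → B ⊗_R (C/R)`. -/
def projQuot (φ : R →+* C) (B : Bimodule.{w} S R) :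
    tens B ((RingHom.id C).comp φ) (Bimodule.self C) →ₗ[S]
      tens B (RingHom.id R) (Bimodule.quot φ) :=
  tensLift
    (AddMonoidHom.mk' (fun b => (tmkHom B (RingHom.id R) (Bimodule.quot φ) b).comp (quotMk φ))
      fun b b' => by
        ext c
        exact add_tmk _ _ _)
    (fun b r c => tmk_bal b r _) (fun s b c => rfl)

lemma projQuot_tmk (φ : R →+* C) {B : Bimodule.{w} S R} (b : B) (c : C) :
    projQuot φ B (tmk _ (N := Bimodule.self C) b c) = tmk (RingHom.id R) b (quotMk φ c) :=
  rfl

/-- The next `PartialFace`. -/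
def PartialFace.next {φ : R →+* C} {B : Bimodule.{w} S R} {n : ℕ} (a : PartialFace φ B n) :
    PartialFace φ (tens B (RingHom.id R) (Bimodule.quot φ)) (n + 1) where
  f :=
    { toFun := fun t => AddMonoidHom.mk' (fun c => projQuot φ B
        ((a.step (RingHom.id C)).1 (tmk _ (N := Bimodule.self C) t c))) fun c c' => by
          rw [tmk_plus, map_add, map_add]
      map_add' := fun t t' => by
        ext c
        change projQuot φ B ((a.step (RingHom.id C)).1 _) = projQuot φ B _ + projQuot φ B _
        rw [add_tmk, map_add, map_add]
      map_smul' := fun s t => by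
        ext c
        change projQuot φ B ((a.step (RingHom.id C)).1 (s • tmk _ _ _)) = s • projQuot φ B _
        rw [map_smul, map_smul] }
  bal := fun t r c => congrArg (fun y => projQuot φ B ((a.step (RingHom.id C)).1 y))
    (tmk_bal (N := Bimodule.self C) t r c)
  right := fun t c r => by
    change projQuot φ B ((a.step (RingHom.id C)).1 (op (φ r) • tmk _ _ _)) =
      op r • projQuot φ B _
    rw [(a.step (RingHom.id C)).2 (φ r)]
    generalize (a.step (RingHom.id C)).1 _ = y
    induction y using tens_induction with
    | h0 => simp only [smul_zero, map_zero]
    | h1 b c => rfl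
    | h2 y y' h h' => rw [smul_add, map_add, h, h', map_add, smul_add]
  unit := fun t => by
    change projQuot φ B ((a.step (RingHom.id C)).1 (tmk _ _ (1 : C))) = _
    induction t using tens_induction with
    | h0 => rw [zero_tmk, map_zero, map_zero, smul_zero]
    | h1 b q =>
      obtain ⟨c, rfl⟩ := quotMk_surjective φ q
      rw [a.step_tmk, map_add, map_zsmul, projQuot_tmk, projQuot_tmk, quotMk_one, tmk_zero,
        zero_add, RingHom.id_apply, mul_one]
    | h2 t t' h h' => rw [add_tmk, map_add, map_add, h, h', smul_add]

/-- The right action of `C` on an `(S, C)`-bimodule. -/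
def PartialFace.base (φ : R →+* C) (M : Bimodule.{w} S C) : PartialFace φ (M.resR φ) 0 where
  f :=
    { toFun := fun m => (toR φ (M := M)).toLinearMap.toAddMonoidHom.comp
        (AddMonoidHom.mk' (fun c : C => op c • (toR φ).symm m) fun c c' => by
          rw [op_add, add_smul])
      map_add' := fun m m' => by
        ext c; exact smul_add (op c) ((toR φ).symm m) ((toR φ).symm m')
      map_smul' := fun s m => by
        ext c; exact (smul_comm s (op c) ((toR φ).symm m)).symm }
  bal := fun m r c => (mul_smul (op c) (op (φ r)) ((toR φ).symm m)).symm
  right := fun m c r => mul_smul (op (φ r)) (op c) ((toR φ).symm m)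
  unit := fun m => (one_smul Cᵐᵒᵖ ((toR φ).symm m)).trans (by
    rw [pow_zero]; exact (one_smul ℤ ((toR φ).symm m)).symm)

/-- The first `n + 1` terms of the alternating sum defining the bar differential. -/
def barFace (φ : R →+* C) (M : Bimodule.{w} S C) : ∀ n, PartialFace φ (barL φ M n) n
  | 0 => PartialFace.base φ M
  | n + 1 => (barFace φ M n).next

/-- The differential of the normalized bar complex; see `barD_barTmul` for the formula. -/
def barD (φ : R →+* C) (ψ : C →+* G) (M : Bimodule.{w} S C) (n : ℕ) :
    BHom (bar φ ψ M (n + 1)) (bar φ ψ M n) :=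
  (barFace φ M n).step ψ

lemma init_contractNth (n : ℕ) (i : Fin n) (c : Fin (n + 2) → C) :
    Fin.init (Fin.contractNth i.castSucc.castSucc (· * ·) c) =
      Fin.contractNth i.castSucc (· * ·) (Fin.init c) := by
  funext j
  simp only [Fin.init, Fin.contractNth, Fin.val_castSucc]
  rfl

lemma contractNth_last (n : ℕ) (i : Fin n) (c : Fin (n + 2) → C) :
    Fin.contractNth i.castSucc.castSucc (· * ·) c (Fin.last n) = c (Fin.last (n + 1)) := by
  have h := i.2
  have h1 : ¬ (n < i.1) := by omega
  have h2 : ¬ (n = i.1) := by omega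
  simp [Fin.contractNth, h1, h2]

lemma barFace_barTmul (φ : R →+* C) {M : Bimodule.{w} S C} (m : M) (n : ℕ) (c : Fin (n + 1) → C) :
    (barFace φ M n).f (barTmul φ m (Fin.init c)) (c (Fin.last n)) =
      barTmul φ (op (c 0) • m) (Fin.tail c) + ∑ i : Fin n, (-1 : ℤ) ^ (i.1 + 1) •
        barTmul φ m (Fin.contractNth i.castSucc (· * ·) c) := by
  induction n with
  | zero => rw [Fin.sum_univ_zero, add_zero]; rfl
  | succ n ih =>
    have ih' := ih (Fin.init c)
    have hz : ∀ (l : ℤ) (b : barL φ M n) (q : Bimodule.quot φ),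
        tmk (RingHom.id R) (l • b) q = l • tmk (RingHom.id R) b q := fun l b q =>
      map_zsmul ((tmkHom (barL φ M n) (RingHom.id R) (Bimodule.quot φ)).flip q) _ _
    have hs : ∀ (g : Fin n → barL φ M n) (q : Bimodule.quot φ),
        tmk (RingHom.id R) (∑ i, g i) q = ∑ i, tmk (RingHom.id R) (g i) q := fun g q =>
      map_sum ((tmkHom (barL φ M n) (RingHom.id R) (Bimodule.quot φ)).flip q) _ _
    have key : (barFace φ M (n + 1)).f (barTmul φ m (Fin.init c)) (c (Fin.last (n + 1))) =
        projQuot φ (barL φ M n) (((barFace φ M n).step (RingHom.id C)).1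
          (tmk _ (N := Bimodule.self C) (tmk (RingHom.id R) (barTmul φ m (Fin.init (Fin.init c)))
            (quotMk φ (Fin.init c (Fin.last n)))) (c (Fin.last (n + 1))))) := rfl
    rw [key, PartialFace.step_tmk, map_add, map_zsmul, projQuot_tmk, projQuot_tmk, ih', add_tmk,
      hs, Fin.sum_univ_castSucc, ← add_assoc]
    refine congrArg₂ (· + ·) (congrArg₂ (· + ·) rfl ?_) ?_
    · refine Finset.sum_congr rfl fun i _ => ?_
      rw [hz]
      refine congrArg₂ (· • ·) rfl ?_
      change _ = tmk (RingHom.id R) (barTmul φ m (Fin.init (α := fun _ => C) _)) (quotMk φ _)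
      rw [init_contractNth, contractNth_last]
    · refine congrArg₂ (· • ·) rfl ?_
      change _ = tmk (RingHom.id R) (barTmul φ m (Fin.init (α := fun _ => C) _)) (quotMk φ _)
      have h1 : Fin.init (Fin.contractNth (Fin.last n).castSucc (· * ·) c) =
          Fin.init (Fin.init c) := by
        funext j
        have h := j.2
        simp [Fin.init, Fin.contractNth, h]
      have h2 : Fin.contractNth (Fin.last n).castSucc (· * ·) c (Fin.last n) =
          Fin.init c (Fin.last n) * c (Fin.last (n + 1)) := by
        simp [Fin.init, Fin.contractNth]
      rw [h1, h2]
      rfl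

/-- The usual formula for the differential of the normalized bar complex:
`b'(m ⊗ c_0 ⊗ ⋯ ⊗ c_n ⊗ x) = m c_0 ⊗ c_1 ⊗ ⋯ ⊗ x + ∑_{i<n} (-1)^{i+1} m ⊗ ⋯ ⊗ c_i c_{i+1} ⊗ ⋯ ⊗ x
+ (-1)^{n+1} m ⊗ c_0 ⊗ ⋯ ⊗ c_{n-1} ⊗ c_n x`. -/
lemma barD_barTmul (φ : R →+* C) (ψ : C →+* G) {M : Bimodule.{w} S C} (m : M) (n : ℕ)
    (c : Fin (n + 1) → C) (x : G) :
    (barD φ ψ M n).1 (tmk (ψ.comp φ) (N := Bimodule.self G) (barTmul φ m c) x) =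
      tmk (ψ.comp φ) (N := Bimodule.self G) (barTmul φ (op (c 0) • m) (Fin.tail c)) x +
      ∑ i : Fin n, (-1 : ℤ) ^ (i.1 + 1) • tmk (ψ.comp φ) (N := Bimodule.self G)
        (barTmul φ m (Fin.contractNth i.castSucc (· * ·) c)) x +
      (-1 : ℤ) ^ (n + 1) • tmk (ψ.comp φ) (N := Bimodule.self G) (barTmul φ m (Fin.init c))
        (ψ (c (Fin.last n)) * x) := by
  refine ((barFace φ M n).step_tmk ψ _ _ _).trans ?_
  rw [barFace_barTmul, add_tmk]
  refine congrArg₂ (· + ·) (congrArg₂ (· + ·) rfl ?_) rfl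
  refine (map_sum ((tmkHom (barL φ M n) (ψ.comp φ) (Bimodule.self G)).flip x) _ _).trans ?_
  exact Finset.sum_congr rfl fun i _ =>
    map_zsmul ((tmkHom (barL φ M n) (ψ.comp φ) (Bimodule.self G)).flip x) _ _

/-- The map `b ⊗ c ↦ b ⊗ c ⊗ 1` of `(S, R)`-bimodules, `B ⊗_R C → B ⊗_R (C/R) ⊗_R C`. -/
def insertOne (φ : R →+* C) (B : Bimodule.{w} S R) :
    BHomOver φ (tens B ((RingHom.id C).comp φ) (Bimodule.self C))
      (tens (tens B (RingHom.id R) (Bimodule.quot φ)) ((RingHom.id C).comp φ)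
        (Bimodule.self C)) :=
  ⟨tensLift
    (AddMonoidHom.mk' (fun t => AddMonoidHom.mk'
        (fun c => tmk _ (N := Bimodule.self C) (tmk (RingHom.id R) t (quotMk φ c)) (1 : C))
        fun c c' => by rw [map_add, tmk_plus, add_tmk]) fun t t' => by
        ext c
        change tmk _ (tmk _ _ _) _ = tmk _ _ _ + tmk _ _ _
        rw [add_tmk, add_tmk])
    (fun t r c => congrArg (fun y => tmk _ (N := Bimodule.self C) y (1 : C))
      (tmk_bal t r (quotMk φ c)))
    (fun s t c => rfl),
  fun r y => by
    induction y using tens_induction with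
    | h0 => simp only [smul_zero, map_zero]
    | h1 t c =>
      refine (tmk_bal (φ := (RingHom.id C).comp φ) (N := Bimodule.self C)
        (tmk (RingHom.id R) t (quotMk φ c)) r (1 : C)).trans ?_
      exact congrArg (fun z : C => tmk ((RingHom.id C).comp φ) (N := Bimodule.self C)
        (tmk (RingHom.id R) t (quotMk φ c)) z) ((mul_one (φ r)).trans (one_mul (φ r)).symm)
    | h2 y y' h h' => rw [smul_add, map_add, h, h', map_add, smul_add]⟩

/-- The map `m ⊗ c_1 ⊗ ⋯ ⊗ c_n ⊗ c ↦ m ⊗ c_1 ⊗ ⋯ ⊗ c_n ⊗ c ⊗ 1` of `(S, R)`-bimodules. -/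
def barH (φ : R →+* C) (M : Bimodule.{w} S C) (n : ℕ) :
    BHomOver φ (bar φ (RingHom.id C) M n) (bar φ (RingHom.id C) M (n + 1)) :=
  insertOne φ (barL φ M n)

lemma barH_tmk (φ : R →+* C) (M : Bimodule.{w} S C) (n : ℕ) (t : barL φ M n) (c : C) :
    (barH φ M n).1 (tmk ((RingHom.id C).comp φ) (N := Bimodule.self C) t c) =
      tmk ((RingHom.id C).comp φ) (N := Bimodule.self C)
        (tmk (RingHom.id R) t (quotMk φ c)) (1 : C) := rfl

end bar

/-- Composition of `E`-bimodule maps. -/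
infixr:80 " ∘ₑ " => BHom.comp

/-- Composition of `(E, K)`-bimodule maps. -/
infixr:80 " ∘ₖ " => BHomOver.comp

/-! ## Relative projective resolutions -/

section relative
variable {S R : Type*} [Ring S] [Ring R] {C : Type*} [Ring C]

/-- The class `Υ` of the epimorphisms of `(S, C)`-bimodules that split as maps of
`(S, R)`-bimodules, where `R` acts on the right through `φ : R → C`. -/
def IsUpsilon (φ : R →+* C) {M N : Bimodule S C} (f : BHom M N) : Prop :=
  Function.Surjective f.1 ∧ ∃ g : BHomOver φ N M, ∀ x, f.1 (g.1 x) = x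

/-- `P` is `Υ`-projective: it has the lifting property with respect to the maps in `Υ`. -/
def IsUpsilonProjective (φ : R →+* C) (P : Bimodule S C) : Prop :=
  ∀ (M N : Bimodule.{w} S C) (f : BHom M N), IsUpsilon φ f →
    ∀ g : BHom P N, ∃ h : BHom P M, BHom.comp f h = g

/-- `⋯ → P 1 → P 0 → Q` is an `Υ`-projective resolution of `Q`: each `P n` is `Υ`-projective, the
compositions vanish, and `P 0 → Q`, `P 1 → ker ε` and all the `P (n + 2) → ker (d n)` belong
to `Υ`. -/
structure IsUpsilonProjectiveResolution (φ : R →+* C) (P : ℕ → Bimodule S C) {Q : Bimodule S C}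
    (d : ∀ n, BHom (P (n + 1)) (P n)) (ε : BHom (P 0) Q) : Prop where
  projective : ∀ n, IsUpsilonProjective.{w} φ (P n)
  augmentation : IsUpsilon φ ε
  exact_zero : ∃ h : BHom.comp ε (d 0) = 0, IsUpsilon φ (BHom.toKer ε (d 0) h)
  exact_succ : ∀ n, ∃ h : BHom.comp (d n) (d (n + 1)) = 0,
    IsUpsilon φ (BHom.toKer (d n) (d (n + 1)) h)

/-- The maps `h₀ : Q → P 0` and `h n : P n → P (n + 1)` of `(S, R)`-bimodules are a contracting
homotopy of `Q ← P 0 ← P 1 ← ⋯`. -/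
structure IsContractingHomotopy (φ : R →+* C) (P : ℕ → Bimodule S C) {Q : Bimodule S C}
    (d : ∀ n, BHom (P (n + 1)) (P n)) (ε : BHom (P 0) Q)
    (h₀ : BHomOver φ Q (P 0)) (h : ∀ n, BHomOver φ (P n) (P (n + 1))) : Prop where
  aug : ∀ x, ε.1 (h₀.1 x) = x
  zero : ∀ x, (d 0).1 ((h 0).1 x) + h₀.1 (ε.1 x) = x
  succ : ∀ n x, (d (n + 1)).1 ((h (n + 1)).1 x) + (h n).1 ((d n).1 x) = x

end relative

/-! ## The resolution of a crossed product -/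

section maps
variable {S R R' : Type*} [Ring S] [Ring R] [Ring R'] {C G : Type w} [Ring C] [Ring G]

/-- Restriction of the ring that acts on the right. -/
def BHomOver.res {φ : R →+* C} (j : R' →+* R) {M N : Bimodule S C} (f : BHomOver φ M N) :
    BHomOver (φ.comp j) M N :=
  ⟨f.1, fun r m => f.2 (j r) m⟩

/-- The left linear map underlying `extendRight`. -/
def extendLin {φ : R →+* G} {B : Bimodule.{w} S R} {N : Bimodule.{w} S G}
    (f : BHomOver φ (tens B φ (Bimodule.self G)) N) :
    tens B φ (Bimodule.self G) →ₗ[S] N :=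
  tensLift
    (AddMonoidHom.mk' (fun b => AddMonoidHom.mk'
        (fun x : G => op x • f.1 (tmk φ (N := Bimodule.self G) b (1 : G)))
        fun x y => by rw [op_add, add_smul]) fun b b' => by
      ext x
      change op x • f.1 (tmk φ _ _) = op x • f.1 _ + op x • f.1 _
      rw [add_tmk, map_add, smul_add])
    (fun b r (x : G) => by
      change op x • f.1 (tmk φ _ _) = op (φ r * x) • f.1 (tmk φ _ _)
      have h : tmk φ (N := Bimodule.self G) (op r • b) (1 : G) =
          op (φ r) • tmk φ (N := Bimodule.self G) b (1 : G) :=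
        (tmk_bal b r _).trans (congrArg (fun z : G => tmk φ (N := Bimodule.self G) b z)
          ((mul_one (φ r)).trans (one_mul (φ r)).symm))
      rw [h, f.2, op_mul, mul_smul])
    (fun s b (x : G) => by
      change op x • f.1 (s • tmk φ _ _) = s • op x • f.1 (tmk φ _ _)
      rw [map_smul]
      exact (smul_comm s (op x) _).symm)

lemma extendLin_tmk {φ : R →+* G} {B : Bimodule.{w} S R} {N : Bimodule.{w} S G}
    (f : BHomOver φ (tens B φ (Bimodule.self G)) N) (b : B) (x : G) :
    extendLin f (tmk φ (N := Bimodule.self G) b x) =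
      op x • f.1 (tmk φ (N := Bimodule.self G) b (1 : G)) := rfl

/-- For a map `f : B ⊗_R G → N` of `(S, R)`-bimodules, the map `B ⊗_R G → N` of
`(S, G)`-bimodules that coincides with `f` on the elements `b ⊗ 1`, that is
`b ⊗ x ↦ f(b ⊗ 1) x`. -/
def extendRight {φ : R →+* G} {B : Bimodule.{w} S R} {N : Bimodule.{w} S G}
    (f : BHomOver φ (tens B φ (Bimodule.self G)) N) :
    BHom (tens B φ (Bimodule.self G)) N :=
  ⟨extendLin f, fun g y => by
    induction y using tens_induction with
    | h0 => rw [smul_zero, map_zero, smul_zero]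
    | h1 b x =>
      rw [op_smul_tmk, extendLin_tmk, extendLin_tmk]
      exact mul_smul (op g) (op x) (f.1 (tmk φ (N := Bimodule.self G) b (1 : G)))
    | h2 y y' h h' => rw [smul_add, map_add, h, h', map_add, smul_add]⟩

lemma extendRight_tmk {φ : R →+* G} {B : Bimodule.{w} S R} {N : Bimodule.{w} S G}
    (f : BHomOver φ (tens B φ (Bimodule.self G)) N) (b : B) (x : G) :
    (extendRight f).1 (tmk φ (N := Bimodule.self G) b x) =
      op x • f.1 (tmk φ (N := Bimodule.self G) b (1 : G)) := rfl

/-- The canonical surjection `B ⊗_R G → B ⊗_C G`. -/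
def canSurj (φ : R →+* C) (ψ : C →+* G) (B : Bimodule.{w} S C) :
    BHom (tens (B.resR φ) (ψ.comp φ) (Bimodule.self G))
      (tens B ((RingHom.id G).comp ψ) (Bimodule.self G)) :=
  ⟨tensLift ((tmkHom B ((RingHom.id G).comp ψ) (Bimodule.self G)).comp
      (toR φ (M := B)).symm.toLinearMap.toAddMonoidHom)
    (fun b r x => tmk_bal (φ := (RingHom.id G).comp ψ) ((toR φ).symm b) (φ r) x)
    (fun _ _ _ => rfl),
  fun r y => by
    induction y using tens_induction with
    | h0 => simp only [smul_zero, map_zero]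
    | h1 m x => rfl
    | h2 y y' h h' => rw [smul_add, map_add, h, h', map_add, smul_add]⟩

lemma canSurj_tmk (φ : R →+* C) (ψ : C →+* G) (B : Bimodule.{w} S C) (b : B) (x : G) :
    (canSurj φ ψ B).1 (tmk (ψ.comp φ) (N := Bimodule.self G) (toR φ b) x) =
      tmk ((RingHom.id G).comp ψ) (N := Bimodule.self G) b x := rfl

/-- The map `m ↦ m ⊗ 1` of `(S, R)`-bimodules, `M → M ⊗_R C`. -/
def tensOne (φ : R →+* C) (M : Bimodule.{w} S C) :
    BHomOver φ M (tens (M.resR φ) ((RingHom.id C).comp φ) (Bimodule.self C)) :=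
  ⟨{ toFun := fun m => tmk _ (N := Bimodule.self C) (toR φ m) (1 : C)
     map_add' := fun m m' => by rw [map_add, add_tmk]
     map_smul' := fun s m => rfl },
  fun r m => (tmk_bal (φ := (RingHom.id C).comp φ) (N := Bimodule.self C) (toR φ m) r
    (1 : C)).trans (congrArg (fun z : C => tmk ((RingHom.id C).comp φ) (N := Bimodule.self C)
      (toR φ m) z) ((mul_one (φ r)).trans (one_mul (φ r)).symm))⟩

/-- The multiplication map `G ⊗_R G → G`, for `R → C → G`. -/
def mulMap (φ : R →+* C) (ψ : C →+* G) :
    BHom (tens (((Bimodule.self G).resR ψ).resR φ) (ψ.comp φ) (Bimodule.self G))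
      (Bimodule.self G) :=
  ⟨tensLift ((AddMonoidHom.mul (R := G)).comp
      ((toR ψ (M := Bimodule.self G)).symm.toLinearMap.toAddMonoidHom.comp
        (toR φ (M := (Bimodule.self G).resR ψ)).symm.toLinearMap.toAddMonoidHom))
    (fun b r x => mul_assoc _ _ _) (fun s b x => mul_assoc _ _ _),
  fun r y => by
    induction y using tens_induction with
    | h0 => simp only [smul_zero, map_zero]
    | h1 m x => exact (mul_assoc _ _ _).symm
    | h2 y y' h h' => rw [smul_add, map_add, h, h', map_add, smul_add]⟩

lemma mulMap_tmk (φ : R →+* C) (ψ : C →+* G) (y x : G) :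
    (mulMap φ ψ).1 (tmk (ψ.comp φ) (N := Bimodule.self G)
      (toR φ (toR ψ (M := Bimodule.self G) y)) x) = y * x := rfl

end maps

namespace CrossedSystem
variable {k : Type u} {A V : Type w} [Field k] [Ring A] [Algebra k A] [AddCommGroup V] [Module k V]
  (D : CrossedSystem k A V) (K : Subalgebra k A)

/-- The inclusion of `K` in `A`. -/
def jK : K →+* A := K.val.toRingHom

/-- The map `K → A → E`. -/
noncomputable def rho : K →+* D.E := D.iA.comp (jK K)

/-- `E ⊗_A (E/A)^{⊗_A s}`, an `(E, A)`-bimodule. -/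
noncomputable def M (s : ℕ) : Bimodule.{w} D.E A := barL D.iA (Bimodule.self D.E) s

/-- `Y_s = E ⊗_A (E/A)^{⊗_A s} ⊗_A E`, the term of degree `s` of the normalized bar resolution of
the `A`-algebra `E`. -/
@[reducible] noncomputable def Y (s : ℕ) : Bimodule.{w} D.E D.E :=
  bar D.iA (RingHom.id D.E) (Bimodule.self D.E) s

/-- `X_{rs} = E ⊗_A (E/A)^{⊗_A s} ⊗_K (A/K)^{⊗_K r} ⊗_K E`. -/
@[reducible] noncomputable def X (r s : ℕ) : Bimodule.{w} D.E D.E :=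
  bar (jK K) D.iA (D.M s) r

/-- The differential `∂ : Y_{s+1} → Y_s` of the normalized bar resolution. -/
noncomputable def bd (s : ℕ) : BHom (D.Y (s + 1)) (D.Y s) :=
  barD D.iA (RingHom.id D.E) (Bimodule.self D.E) s

/-- The map `d⁰ : X_{r+1,s} → X_{rs}`: it is `(-1)^s` times the differential of the normalized bar
resolution of the `K`-algebra `A`, tensored on the left with `E ⊗_A (E/A)^{⊗_A s}` and on the
right with `E`. -/
noncomputable def d0 (r s : ℕ) : BHom (D.X K (r + 1) s) (D.X K r s) :=
  (-1 : ℤ) ^ s • barD (jK K) D.iA (D.M s) r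

/-- The canonical surjection `ν_s : X_{0s} → Y_s`. -/
noncomputable def nu (s : ℕ) : BHom (D.X K 0 s) (D.Y s) :=
  canSurj (jK K) D.iA (D.M s)

/-- The map `σ⁻¹_{s+1} : Y_s → Y_{s+1}`, `x ↦ (-1)^s x ⊗ 1`. -/
noncomputable def sigm1 (s : ℕ) : BHomOver (D.rho K) (D.Y s) (D.Y (s + 1)) :=
  (-1 : ℤ) ^ s • BHomOver.res (jK K) (barH D.iA (Bimodule.self D.E) s)

/-- The map `σ⁻¹_0 : E → Y_0`, `x ↦ - x ⊗ 1`. -/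
noncomputable def sigm1Zero : BHomOver (D.rho K) (Bimodule.self D.E) (D.Y 0) :=
  -BHomOver.res (jK K) (tensOne D.iA (Bimodule.self D.E))

section split
variable {R : Type*} [Ring R] {K} {B : Bimodule.{w} D.E R} {B' : Bimodule.{w} D.E K}

/-- For `h : A → B'` right `K`-linear, the map `E → B' ⊗_K E`, `a γ(v) ↦ h(a) ⊗ γ(v)`. -/
noncomputable def split₁ (h : A →+ B') (hh : ∀ (a : A) (x : K), h (a * x) = op x • h a) :
    D.E →+ tens B' (D.rho K) (Bimodule.self D.E) :=
  D.liftE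
    (AddMonoidHom.mk' (fun a => AddMonoidHom.mk'
        (fun v => tmk (D.rho K) (N := Bimodule.self D.E) (h a) (D.el 1 v)) fun v w => by
          rw [← tmk_plus]
          exact congrArg _ (TensorProduct.tmul_add (1 : A) v w)) fun a b => by
        ext v
        change tmk _ _ _ = tmk _ _ _ + tmk _ _ _
        rw [map_add, add_tmk])
    (fun c a v => by
      change tmk (D.rho K) (N := Bimodule.self D.E) (h (c • a)) (D.el 1 v) =
        tmk (D.rho K) (N := Bimodule.self D.E) (h a) (D.el 1 (c • v))
      have h1 : c • a = a * (algebraMap k K c : K) := by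
        exact (Algebra.smul_def c a).trans (Algebra.commutes c a)
      have h2 : D.rho K (algebraMap k K c) * D.el 1 v = D.el 1 (c • v) := by
        refine (D.el_mul (algebraMap k A c) 1 v).trans ?_
        rw [mul_one, Algebra.algebraMap_eq_smul_one]
        exact TensorProduct.smul_tmul c (1 : A) v
      rw [h1, hh, tmk_bal, ← h2]
      rfl)

lemma split₁_el (h : A →+ B') (hh : ∀ (a : A) (x : K), h (a * x) = op x • h a) (a : A) (v : V) :
    D.split₁ h hh (D.el a v) = tmk (D.rho K) (N := Bimodule.self D.E) (h a) (D.el 1 v) := rfl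

lemma split₁_mul (hK : D.IsStable K) (h : A →+ B')
    (hh : ∀ (a : A) (x : K), h (a * x) = op x • h a) (x : D.E) (r : K) :
    D.split₁ h hh (x * D.rho K r) = op (D.rho K r) • D.split₁ h hh x := by
  induction x using E_induction with
  | h1 a v =>
    obtain ⟨y, hy⟩ := hK v r r.2
    have e1 : D.el a v * D.rho K r =
        (a • LinearMap.rTensor V K.val.toLinearMap y : A ⊗[k] V) := by
      rw [hy]
      exact (D.el_mul_iA a r v).trans (actL_tmul D.χ a v (r : A))
    have e2 : D.el 1 v * D.rho K r = LinearMap.rTensor V K.val.toLinearMap y := by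
      rw [hy]
      exact ((D.el_mul_iA 1 r v).trans (actL_tmul D.χ 1 v (r : A))).trans (one_smul A (D.χ (v ⊗ₜ[k] (r : A)) : A ⊗[k] V))
    have e3 : ∀ y : K ⊗[k] V,
        D.split₁ h hh (a • LinearMap.rTensor V K.val.toLinearMap y : A ⊗[k] V) =
        tmk (D.rho K) (N := Bimodule.self D.E) (h a)
          (LinearMap.rTensor V K.val.toLinearMap y : A ⊗[k] V) := fun y => by
      induction y with
      | zero =>
        rw [map_zero, smul_zero]
        exact (map_zero (D.split₁ h hh)).trans (tmk_zero (N := Bimodule.self D.E) (h a)).symm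
      | tmul c w =>
        change tmk (D.rho K) (N := Bimodule.self D.E) (h (a * c)) (D.el 1 w) =
          tmk (D.rho K) (N := Bimodule.self D.E) (h a) (D.el c w)
        rw [hh, tmk_bal]
        refine congrArg _ ((D.el_mul (c : A) 1 w).trans ?_)
        rw [mul_one]
      | add y z hy hz =>
        rw [map_add, smul_add]
        exact (map_add (D.split₁ h hh) _ _).trans ((congrArg₂ (· + ·) hy hz).trans
          (tmk_plus (N := Bimodule.self D.E) (h a) _ _).symm)
    rw [e1, e3, split₁_el, op_smul_tmk]
    exact congrArg _ e2.symm
  | h2 x y hx hy => rw [add_mul, map_add, hx, hy, map_add, smul_add]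

/-- The left linear map underlying `split₂`. -/
noncomputable def splitLin (ψ : R →+* A) (ρ : R →+* D.E)
    (hρ : ∀ r, ρ r = D.iA (ψ r)) (H : B →ₗ[D.E] (A →+ B'))
    (hl : ∀ b r a, H (op r • b) a = H b (ψ r * a))
    (hr : ∀ b a (x : K), H b (a * x) = op x • H b a) :
    tens B ρ (Bimodule.self D.E) →ₗ[D.E] tens B' (D.rho K) (Bimodule.self D.E) :=
  tensLift (AddMonoidHom.mk' (fun b => D.split₁ (H b) (hr b)) fun b b' => by
      ext x
      rw [AddMonoidHom.add_apply]
      induction x using E_induction with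
      | h1 a v => rw [split₁_el, split₁_el, split₁_el, map_add, AddMonoidHom.add_apply, add_tmk]
      | h2 x y hx hy => rw [map_add, hx, hy, map_add, map_add]; abel)
    (fun b r (x : D.E) => by
      change D.split₁ (H (op r • b)) (hr _) x = D.split₁ (H b) (hr b) (ρ r * x)
      induction x using E_induction with
      | h1 a v =>
        have h1 : ρ r * D.el a v = D.el (ψ r * a) v := by
          rw [hρ]
          exact D.el_mul (ψ r) a v
        rw [h1, split₁_el, split₁_el, hl]
      | h2 x y hx hy => rw [map_add, hx, hy, mul_add, map_add])
    (fun s b (x : D.E) => by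
      change D.split₁ (H (s • b)) (hr _) x = s • D.split₁ (H b) (hr b) x
      induction x using E_induction with
      | h1 a v =>
        rw [split₁_el, split₁_el, map_smul, smul_tmk]
        rfl
      | h2 x y hx hy => rw [map_add, hx, hy, map_add, smul_add])

/-- The map `B ⊗_R E → B' ⊗_K E`, `b ⊗ a γ(v) ↦ H(b, a) ⊗ γ(v)`. -/
noncomputable def split₂ (hK : D.IsStable K) (ψ : R →+* A) (ρ : R →+* D.E)
    (hρ : ∀ r, ρ r = D.iA (ψ r)) (H : B →ₗ[D.E] (A →+ B'))
    (hl : ∀ b r a, H (op r • b) a = H b (ψ r * a))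
    (hr : ∀ b a (x : K), H b (a * x) = op x • H b a) :
    BHomOver (D.rho K) (tens B ρ (Bimodule.self D.E))
      (tens B' (D.rho K) (Bimodule.self D.E)) :=
  ⟨D.splitLin ψ ρ hρ H hl hr, fun r y => by
    induction y using tens_induction with
    | h0 => rw [smul_zero, map_zero, smul_zero]
    | h1 b x => exact D.split₁_mul hK (H b) (hr b) x r
    | h2 y y' h h' => rw [smul_add, map_add, h, h', map_add, smul_add]⟩

lemma split₂_tmk (hK : D.IsStable K) (ψ : R →+* A) (ρ : R →+* D.E)
    (hρ : ∀ r, ρ r = D.iA (ψ r)) (H : B →ₗ[D.E] (A →+ B')) (hl) (hr) (b : B) (a : A) (v : V) :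
    (D.split₂ hK ψ ρ hρ H hl hr).1 (tmk ρ (N := Bimodule.self D.E) b (D.el a v)) =
      tmk (D.rho K) (N := Bimodule.self D.E) (H b a) (D.el 1 v) := rfl

end split

/-- The map `b ⊗ a γ(v) ↦ b a ⊗ γ(v)`, `B ⊗_A E → B ⊗_K E`. -/
noncomputable def splitAug {K} (hK : D.IsStable K) (B : Bimodule.{w} D.E A) :
    BHomOver (D.rho K) (tens B ((RingHom.id D.E).comp D.iA) (Bimodule.self D.E))
      (tens (B.resR (jK K)) (D.rho K) (Bimodule.self D.E)) :=
  D.split₂ hK (RingHom.id A) ((RingHom.id D.E).comp D.iA) (fun _ => rfl)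
    { toFun := fun b => (toR (jK K) (M := B)).toLinearMap.toAddMonoidHom.comp
        (AddMonoidHom.mk' (fun a : A => op a • b) fun a a' => by rw [op_add, add_smul])
      map_add' := fun b b' => by ext a; exact smul_add (op a) b b'
      map_smul' := fun s b => by ext a; exact (smul_comm s (op a) b).symm }
    (fun b r a => (mul_smul (op a) (op r) b).symm)
    (fun b a x => mul_smul (op (x : A)) (op a) b)

lemma splitAug_tmk {K} (hK : D.IsStable K) (B : Bimodule.{w} D.E A) (b : B) (a : A) (v : V) :
    (D.splitAug hK B).1 (tmk ((RingHom.id D.E).comp D.iA) (N := Bimodule.self D.E) b (D.el a v)) =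
      tmk (D.rho K) (N := Bimodule.self D.E) (toR (jK K) (op a • b)) (D.el 1 v) := rfl

/-- The map `b ⊗ a γ(v) ↦ b ⊗ a ⊗ γ(v)`, `B ⊗_K E → B ⊗_K (A/K) ⊗_K E`. -/
noncomputable def splitBar {K} (hK : D.IsStable K) (B : Bimodule.{w} D.E K) :
    BHomOver (D.rho K) (tens B (D.rho K) (Bimodule.self D.E))
      (tens (tens B (RingHom.id K) (Bimodule.quot (jK K))) (D.rho K) (Bimodule.self D.E)) :=
  D.split₂ hK (jK K) (D.rho K) (fun _ => rfl)
    { toFun := fun b => (tmkHom B (RingHom.id K) (Bimodule.quot (jK K)) b).comp (quotMk (jK K))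
      map_add' := fun b b' => by ext a; exact add_tmk _ _ _
      map_smul' := fun s b => by ext a; rfl }
    (fun b r a => tmk_bal b r (quotMk (jK K) a))
    (fun b a x => rfl)

lemma splitBar_tmk {K} (hK : D.IsStable K) (B : Bimodule.{w} D.E K) (b : B) (a : A) (v : V) :
    (D.splitBar hK B).1 (tmk (D.rho K) (N := Bimodule.self D.E) b (D.el a v)) =
      tmk (D.rho K) (N := Bimodule.self D.E) (tmk (RingHom.id K) b (quotMk (jK K) a))
        (D.el 1 v) := rfl

/-- The map `σ⁰_{0s} : Y_s → X_{0s}`, given by `y ⊗_A γ(v) ↦ y ⊗ γ(v)`. -/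
noncomputable def sig0Aug {K} (hK : D.IsStable K) (s : ℕ) :
    BHomOver (D.rho K) (D.Y s) (D.X K 0 s) :=
  D.splitAug hK (D.M s)

/-- The map `σ⁰_{r+1,s} : X_{rs} → X_{r+1,s}`, given by
`y ⊗ a_1 ⊗ ⋯ ⊗ a_r ⊗ a_{r+1} γ(v) ↦ (-1)^{r+s+1} y ⊗ a_1 ⊗ ⋯ ⊗ a_{r+1} ⊗ γ(v)`. -/
noncomputable def sig0 {K} (hK : D.IsStable K) (r s : ℕ) :
    BHomOver (D.rho K) (D.X K r s) (D.X K (r + 1) s) :=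
  (-1 : ℤ) ^ (r + s + 1) • D.splitBar hK (barL (jK K) (D.M s) r)

/-- The direct sum of all the `X_{rs}`. -/
noncomputable def XX : Bimodule.{w} D.E D.E := dsum fun p : ℕ × ℕ => D.X K p.1 p.2

/-- The inclusion of `X_{rs}` in the direct sum. -/
noncomputable def inc (r s : ℕ) : BHom (D.X K r s) (D.XX K) :=
  dincl (fun p : ℕ × ℕ => D.X K p.1 p.2) (r, s)

/-- The bimodule map on the direct sum of the `X_{rs}` with given restrictions. -/
noncomputable def glue {N : Bimodule.{w} D.E D.E} (f : ∀ r s, BHom (D.X K r s) N) :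
    BHom (D.XX K) N :=
  dsumLift fun p => f p.1 p.2

/-- The `(E, K)`-bimodule map on the direct sum of the `X_{rs}` with given restrictions. -/
noncomputable def glueOver {N : Bimodule.{w} D.E D.E}
    (f : ∀ r s, BHomOver (D.rho K) (D.X K r s) N) : BHomOver (D.rho K) (D.XX K) N :=
  dsumLiftOver (D.rho K) fun p => f p.1 p.2

/-- The maps `σ⁰ : X_{rs} → X_{r+1,s}` together, on the direct sum of the `X_{rs}`. -/
noncomputable def sig0Tot {K} (hK : D.IsStable K) : BHomOver (D.rho K) (D.XX K) (D.XX K) :=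
  D.glueOver K fun r s => BHom.over _ (D.inc K (r + 1) s) ∘ₖ D.sig0 hK r s

/-- The maps `d^l_{rs} : X_{rs} → X_{r+l-1,s-l}`, followed by the inclusion in the direct sum. They
are the `E`-bimodule maps defined recursively by, on the elements `z = y ⊗ 1`,
* `d¹(z) = σ⁰ ∂ ν (z)` for `r = 0`;
* `d^l(z) = - ∑_{j=1}^{l-1} σ⁰ d^{l-j} d^j (z)` for `l > 1` and `r = 0`;
* `d^l(z) = - σ⁰ d^l d⁰ (z) - ∑_{j=1}^{l-1} σ⁰ d^{l-j} d^j (z)` for `l ≥ 1` and `r > 0`.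
By convention `d⁰_{0s} = 0`, and `d^l_{rs} = 0` if `l > s` and `l > 0`. -/
noncomputable def d {K} (hK : D.IsStable K) : ℕ → ∀ r s : ℕ, BHom (D.X K r s) (D.XX K)
  | 0, 0, _ => 0
  | 0, r + 1, s => D.inc K r s ∘ₑ D.d0 K r s
  | l + 1, r + 1, s =>
    if l + 1 ≤ s then extendRight (φ := D.rho K)
      (-(D.sig0Tot hK ∘ₖ BHom.over _ (d hK (l + 1) r s ∘ₑ D.d0 K r s)) -
        ∑ j : Fin l, D.sig0Tot hK ∘ₖ
          BHom.over _ ((D.glue K fun r' s' => d hK (l - j) r' s') ∘ₑ d hK (j + 1) (r + 1) s))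
    else 0
  | 1, 0, 0 => 0
  | 1, 0, s + 1 => extendRight (φ := D.rho K) (BHom.over _ (D.inc K 0 s) ∘ₖ
      D.sig0Aug hK s ∘ₖ BHom.over _ (D.bd s ∘ₑ D.nu K (s + 1)))
  | l + 2, 0, s =>
    if l + 2 ≤ s then extendRight (φ := D.rho K) (-∑ j : Fin (l + 1), D.sig0Tot hK ∘ₖ
      BHom.over _ ((D.glue K fun r' s' => d hK (l + 1 - j) r' s') ∘ₑ d hK (j + 1) 0 s))
    else 0
  termination_by l r => (l, r)

/-- All the maps `d^l_{rs}` together, for a fixed `l`. -/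
noncomputable def dTot {K} (hK : D.IsStable K) (l : ℕ) : BHom (D.XX K) (D.XX K) :=
  D.glue K fun r s => D.d hK l r s

/-- For `f : Z → ⊕ X_{rs}`, the maps recursively defined by `σ^0 = f` and
`σ^l = - ∑_{i=0}^{l-1} σ⁰ d^{l-i} σ^i`. -/
noncomputable def sig {K} (hK : D.IsStable K) {Z : Bimodule.{w} D.E D.E}
    (f : BHomOver (D.rho K) Z (D.XX K)) : ℕ → BHomOver (D.rho K) Z (D.XX K)
  | 0 => f
  | l + 1 => -∑ i : Fin (l + 1), D.sig0Tot hK ∘ₖ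
      BHom.over _ (D.dTot hK (l + 1 - i)) ∘ₖ sig hK f i

/-- The map `σ^l_{r+l+1,s-l} : X_{rs} → X_{r+l+1,s-l}`, followed by the inclusion. -/
noncomputable def sigX {K} (hK : D.IsStable K) (l r s : ℕ) :
    BHomOver (D.rho K) (D.X K r s) (D.XX K) :=
  D.sig hK (BHom.over _ (D.inc K (r + 1) s) ∘ₖ D.sig0 hK r s) l

/-- The map `σ^l_{l,s-l} : Y_s → X_{l,s-l}`, followed by the inclusion. -/
noncomputable def sigY {K} (hK : D.IsStable K) (l s : ℕ) :
    BHomOver (D.rho K) (D.Y s) (D.XX K) :=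
  D.sig hK (BHom.over _ (D.inc K 0 s) ∘ₖ D.sig0Aug hK s) l

/-- `X_n`, the direct sum of the `X_{rs}` with `r + s = n`. -/
noncomputable def Xn (n : ℕ) : Bimodule.{w} D.E D.E :=
  dsum fun p : {p : ℕ × ℕ // p.1 + p.2 = n} => D.X K p.1.1 p.1.2

/-- The inclusion of `X_n` in the direct sum of all the `X_{rs}`. -/
noncomputable def incl (n : ℕ) : BHom (D.Xn K n) (D.XX K) :=
  dsumLift fun p : {p : ℕ × ℕ // p.1 + p.2 = n} => D.inc K p.1.1 p.1.2

/-- The projection on `X_n` of the direct sum of all the `X_{rs}`. -/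
noncomputable def proj (n : ℕ) : BHom (D.XX K) (D.Xn K n) :=
  D.glue K fun r s => if h : r + s = n then
    dincl (fun p : {p : ℕ × ℕ // p.1 + p.2 = n} => D.X K p.1.1 p.1.2) ⟨(r, s), h⟩ else 0

/-- The map on the direct sum of the `X_{rs}` whose restriction to `X_{rs}` is the sum of the
`d^l_{rs}` with `0 ≤ l ≤ s` (where `d⁰_{0s} = 0`). -/
noncomputable def dSum {K} (hK : D.IsStable K) : BHom (D.XX K) (D.XX K) :=
  D.glue K fun r s => ∑ l ∈ Finset.range (s + 1), D.d hK l r s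

/-- The differential `d_{n+1} : X_{n+1} → X_n`. -/
noncomputable def diff {K} (hK : D.IsStable K) (n : ℕ) : BHom (D.Xn K (n + 1)) (D.Xn K n) :=
  D.proj K n ∘ₑ D.dSum hK ∘ₑ D.incl K (n + 1)

/-- The multiplication map `μ : X_0 → E`, where `X_0 = X_{00} = E ⊗_K E`. -/
noncomputable def mu : BHom (D.Xn K 0) (Bimodule.self D.E) :=
  (D.glue K fun r s => match r, s with
    | 0, 0 => mulMap (jK K) D.iA
    | _, _ => 0) ∘ₑ D.incl K 0

/-- The map `σ̄_0 = σ⁰_{00} σ⁻¹_0 : E → X_0`. -/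
noncomputable def sigBarZero {K} (hK : D.IsStable K) :
    BHomOver (D.rho K) (Bimodule.self D.E) (D.Xn K 0) :=
  BHom.over _ (D.proj K 0 ∘ₑ D.inc K 0 0) ∘ₖ D.sig0Aug hK 0 ∘ₖ D.sigm1Zero K

/-- The map on the direct sum of the `X_{rs}` whose restriction to `X_{rs}`, with `n = r + s`, is
`∑_{l=0}^{s} σ^l_{r+l+1,s-l}`, minus `∑_{l=0}^{n+1} σ^l_{l,n-l+1} σ⁻¹_{n+1} ν_n` if `r = 0`. -/
noncomputable def sigBarSum {K} (hK : D.IsStable K) : BHomOver (D.rho K) (D.XX K) (D.XX K) :=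
  D.glueOver K fun r s => match r with
    | 0 => -(∑ l ∈ Finset.range (s + 2), D.sigY hK l (s + 1) ∘ₖ
          D.sigm1 K s ∘ₖ BHom.over _ (D.nu K s)) +
        ∑ l ∈ Finset.range (s + 1), D.sigX hK l 0 s
    | r + 1 => ∑ l ∈ Finset.range (s + 1), D.sigX hK l (r + 1) s

/-- The map `σ̄_{n+1} : X_n → X_{n+1}`. -/
noncomputable def sigBar {K} (hK : D.IsStable K) (n : ℕ) :
    BHomOver (D.rho K) (D.Xn K n) (D.Xn K (n + 1)) :=
  BHom.over _ (D.proj K (n + 1)) ∘ₖ D.sigBarSum hK ∘ₖ BHom.over _ (D.incl K n)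

end CrossedSystem

end BrzCross

namespace BrzCross

/-! ### Tensor products over noncommutative rings: additivity and extensionality -/

section general
variable {S R T C : Type*} [Ring S] [Ring R] [Ring T] [Ring C]

/-! The theorem is a perturbation argument. For each s, the row Y_s ← X_{0s} ← X_{1s} ← ⋯, with
augmentation ν and differential d⁰, is contracted by the maps σ⁰ (`d0_sig0_zero`, `d0_sig0_succ`,
`nu_sig0Aug`): they move the A-part of a γ(v) into a new tensor slot, and the last face of the bar
differential multiplies it back. The stability of K under χ serves to make σ⁰ right K-linear. The
complex Y, augmented to E by multiplication, is contracted by -σ⁻¹ (`bd_sigm1_succ`,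
`bd_sigm1_zero`). These two contractions have to be combined along the rows.

All maps are assembled on the direct sum of all the X_{rs}. Write α for `augT` (the maps σ⁰ : Y_s →
X_{0s}), σ⁰ for `sig0Tot`, d⁺ for `dPos` (the sum of the d^l with l ≥ 1), D = d⁰ + d⁺ for `dSum`,
and Φ = 1 + σ⁰ d⁺. Since d⁺ strictly lowers s and σ⁰ preserves it, σ⁰ d⁺ is locally nilpotent and Φ
is injective (`eq_of_add_sig0Tot_dPos`). Hence identities may be checked after applying Φ.

Summed over l, the recursion for the d^l reads d⁺z = α∂ν z - σ⁰ d⁺ D z on the generators z = b ⊗ 1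
(`dPos_gen`). Applying d⁰ and the row contraction gives D²z = σ⁰ d⁰ D²z, so that Φ D²z = σ⁰ D³z = σ⁰
D²(d⁰z + d⁺z). This vanishes by induction on s and r, whence D² = 0 (`dSum_dSum`). It follows that Φ
D = (d⁰ + α∂ν) Φ (`add_sig0Tot_dPos_dSum_of_eq`): Φ carries D to the unperturbed differential.

The recursion for the σ^l says exactly that Φ ∑ σ^l is the starting map, σ⁰ or α (`sum_sig`). So Φ
σ̄ = σ⁰ - α σ⁻¹ ν, and the homotopy formula for D and σ̄ becomes, after Φ, the elementary one for d⁰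
+ α∂ν. The only defect is α(ν + ∂σ⁻¹ν + σ⁻¹∂ν) (`homotopy_aux`); it is zero in positive degrees, and
in degree 0 it is the contribution of σ̄_0 and μ.

Each X_{rs} is induced, of the form B ⊗_K E, hence relatively projective, and the homotopy
restricted to kernels provides the required splittings. The bidegree lemmas `d_mem_gr` and
`sig_mem_gr` show that nothing is lost when the maps on the big direct sum are cut down to the X_n.
-/

lemma zsmul_tmk {M : Bimodule.{w} S R} {φ : R →+* C} {N : Bimodule.{w} C T} (l : ℤ) (m : M)
    (n : N) : tmk φ (l • m) n = l • tmk φ m n :=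
  map_zsmul ((tmkHom M φ N).flip n) l m

lemma tens_hom_ext {M : Bimodule.{w} S R} {φ : R →+* C} {N : Bimodule.{w} C T} {P : Type*}
    [AddCommGroup P] {f g : tens M φ N →+ P} (h : ∀ m n, f (tmk φ m n) = g (tmk φ m n))
    (x : tens M φ N) : f x = g x := by
  induction x using tens_induction with
  | h0 => rw [map_zero, map_zero]
  | h1 m n => exact h m n
  | h2 x y hx hy => rw [map_add, map_add, hx, hy]

end general

/-! ### Normalized bar complex: square zero and contraction -/

section bar
variable {S R : Type*} [Ring S] [Ring R] {C G : Type w} [Ring C] [Ring G]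

/-- Compatibility of a partial face with the multiplication of `C`. -/
def PartialFace.IsAssoc {φ : R →+* C} {B : Bimodule.{w} S R} {n : ℕ} (a : PartialFace φ B n) :
    Prop :=
  ∀ (b : B) (c c' : C), a.f (a.f b c) c' = (-1 : ℤ) ^ n • a.f b (c * c')

namespace PartialFace
variable {φ : R →+* C} {B : Bimodule.{w} S R} {n : ℕ} (a : PartialFace φ B n) (ψ : C →+* G)

lemma next_f (t : tens B (RingHom.id R) (Bimodule.quot φ)) (c : C) : a.next.f t c =
    projQuot φ B ((a.step (RingHom.id C)).1 (tmk _ (N := Bimodule.self C) t c)) := rfl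

lemma next_f_tmk (b : B) (e c : C) : a.next.f (tmk (RingHom.id R) b (quotMk φ e)) c =
    tmk (RingHom.id R) (a.f b e) (quotMk φ c) +
      (-1 : ℤ) ^ (n + 1) • tmk (RingHom.id R) b (quotMk φ (e * c)) := by
  rw [next_f, step_tmk, map_add, map_zsmul, projQuot_tmk, projQuot_tmk]
  rfl

lemma f_zsmul (l : ℤ) (b : B) (c : C) : a.f (l • b) c = l • a.f b c := by
  rw [map_zsmul]
  rfl

lemma f_add (b b' : B) (c : C) : a.f (b + b') c = a.f b c + a.f b' c := by
  rw [map_add]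
  rfl

variable {a} in
-- On t = b ⊗ e the terms ± f(b, ec) ⊗ c' cancel: one comes from f(f(b, e), c) by the hypothesis,
-- the other from the face that multiplies e and c. What remains is f(b, e) ⊗ cc' and b ⊗ ecc' up to
-- sign.
lemma IsAssoc.next (h : a.IsAssoc) : a.next.IsAssoc := by
  intro t c c'
  induction t using tens_induction with
  | h0 => simp only [map_zero, AddMonoidHom.zero_apply, smul_zero]
  | h1 b q =>
    obtain ⟨e, rfl⟩ := quotMk_surjective φ q
    rw [next_f_tmk, f_add, f_zsmul, next_f_tmk, next_f_tmk, next_f_tmk, h b e c, zsmul_tmk,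
      mul_assoc]
    rcases neg_one_pow_eq_or ℤ n with hn | hn <;> simp only [pow_succ, hn] <;> simp <;> abel
  | h2 t t' ht ht' => rw [f_add, f_add, f_add, ht, ht', smul_add]

variable {a} in
-- The pairwise cancellation of faces in the bar differential. Associativity of the partial faces
-- handles all pairs not involving the last factor; the pairs involving it cancel by associativity
-- of the product in G.
lemma IsAssoc.step_step (h : a.IsAssoc)
    (y : tens (tens (tens B (RingHom.id R) (Bimodule.quot φ)) (RingHom.id R) (Bimodule.quot φ))
      (ψ.comp φ) (Bimodule.self G)) : (a.step ψ).1 ((a.next.step ψ).1 y) = 0 := by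
  refine tens_hom_ext (f := ((a.step ψ).1 ∘ₗ (a.next.step ψ).1).toAddMonoidHom) (g := 0)
    (fun t x => ?_) y
  change (a.step ψ).1 ((a.next.step ψ).1 (tmk _ t x)) = 0
  induction t using tens_induction with
  | h0 => rw [zero_tmk, map_zero, map_zero]
  | h1 t q =>
    obtain ⟨c, rfl⟩ := quotMk_surjective φ q
    induction t using tens_induction with
    | h0 => rw [zero_tmk, zero_tmk, map_zero, map_zero]
    | h1 b q =>
      obtain ⟨e, rfl⟩ := quotMk_surjective φ q
      rw [step_tmk, next_f_tmk, add_tmk, zsmul_tmk, map_add, map_add, map_zsmul, map_zsmul,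
        step_tmk, step_tmk, step_tmk, h b e c, zsmul_tmk, map_mul ψ, mul_assoc (ψ e)]
      rcases neg_one_pow_eq_or ℤ n with hn | hn <;> simp only [pow_succ, hn] <;> simp <;> abel
    | h2 t t' ht ht' => rw [add_tmk, add_tmk, map_add, map_add, ht, ht', add_zero]
  | h2 t t' ht ht' => rw [add_tmk, map_add, map_add, ht, ht', add_zero]

end PartialFace

lemma barFace_isAssoc (φ : R →+* C) (M : Bimodule.{w} S C) :
    ∀ n, (barFace φ M n).IsAssoc
  | 0 => fun b c c' => by
    rw [pow_zero, one_smul]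
    exact (mul_smul (op c') (op c) ((toR φ).symm b)).symm
  | n + 1 => (barFace_isAssoc φ M n).next

lemma barD_barD (φ : R →+* C) (ψ : C →+* G) (M : Bimodule.{w} S C) (n : ℕ)
    (y : bar φ ψ M (n + 2)) : (barD φ ψ M n).1 ((barD φ ψ M (n + 1)).1 y) = 0 :=
  (barFace_isAssoc φ M n).step_step ψ y

lemma barD_barH_zero (φ : R →+* C) (M : Bimodule.{w} S C) (m : M) (c : C) :
    (barD φ (RingHom.id C) M 0).1 ((barH φ M 0).1
        (tmk ((RingHom.id C).comp φ) (N := Bimodule.self C) (toR φ m) c)) =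
      tmk ((RingHom.id C).comp φ) (N := Bimodule.self C) (toR φ (op c • m)) (1 : C) -
      tmk ((RingHom.id C).comp φ) (N := Bimodule.self C) (toR φ m) c := by
  refine ((barFace φ M 0).step_tmk (RingHom.id C) _ _ _).trans ?_
  rw [zero_add, pow_one, neg_one_smul, sub_eq_add_neg, mul_one]
  rfl

/-- All faces but the last ignore the inserted 1, and together they are the lower differential with
its last factor projected to C/R. The last face multiplies by the inserted 1 and returns y, with
sign (-1)^(n+2). -/
lemma barD_barH_succ (φ : R →+* C) (M : Bimodule.{w} S C) (n : ℕ)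
    (y : bar φ (RingHom.id C) M (n + 1)) :
    (barD φ (RingHom.id C) M (n + 1)).1 ((barH φ M (n + 1)).1 y) =
      (barH φ M n).1 ((barD φ (RingHom.id C) M n).1 y) + (-1 : ℤ) ^ n • y := by
  have hH : ∀ (n : ℕ) (y : bar φ (RingHom.id C) M n), (barH φ M n).1 y =
      tmk ((RingHom.id C).comp φ) (N := Bimodule.self C) (projQuot φ (barL φ M n) y) (1 : C) :=
    fun n y => tens_hom_ext (f := (barH φ M n).1.toAddMonoidHom)
      (g := ((tmkHom _ ((RingHom.id C).comp φ) (Bimodule.self C)).flip (1 : C)).comp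
        (projQuot φ (barL φ M n)).toAddMonoidHom) (fun t c => rfl) y
  refine tens_hom_ext (f := ((barD φ (RingHom.id C) M (n + 1)).1 ∘ₗ
      (barH φ M (n + 1)).1).toAddMonoidHom)
    (g := ((barH φ M n).1 ∘ₗ (barD φ (RingHom.id C) M n).1).toAddMonoidHom +
      (-1 : ℤ) ^ n • AddMonoidHom.id _) (fun t c => ?_) y
  change (barD φ (RingHom.id C) M (n + 1)).1 ((barH φ M (n + 1)).1 (tmk _ t c)) =
      (barH φ M n).1 ((barD φ (RingHom.id C) M n).1 (tmk _ t c)) + (-1 : ℤ) ^ n • (tmk _ t c)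
  rw [hH n, barH_tmk]
  refine ((barFace φ M (n + 1)).step_tmk (RingHom.id C) _ _ _).trans ?_
  refine congrArg₂ (· + ·) rfl (congrArg₂ (· • ·) ?_ ?_)
  · rw [pow_succ, pow_succ]; simp
  · rw [RingHom.id_apply, mul_one]

end bar

/-! ### The unsigned row contraction given by splitting a γ(v) -/

namespace CrossedSystem
variable {k : Type u} {A V : Type w} [Field k] [Ring A] [Algebra k A] [AddCommGroup V] [Module k V]
  (D : CrossedSystem k A V) {K : Subalgebra k A}

lemma tensE_hom_ext {R : Type*} [Ring R] {φ : R →+* D.E} {B : Bimodule.{w} D.E R} {P : Type*}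
    [AddCommGroup P] {f g : tens B φ (Bimodule.self D.E) →+ P}
    (h : ∀ b a v, f (tmk φ (N := Bimodule.self D.E) b (D.el a v)) =
      g (tmk φ (N := Bimodule.self D.E) b (D.el a v)))
    (x : tens B φ (Bimodule.self D.E)) : f x = g x := by
  refine tens_hom_ext (fun b (x : D.E) => ?_) x
  induction x using E_induction with
  | h1 a v => exact h b a v
  | h2 x y hx hy => rw [tmk_plus, map_add, map_add, hx, hy]

lemma iA_mul_el (a b : A) (v : V) : D.iA a * D.el b v = D.el (a * b) v := D.el_mul a b v

/-- The bimodule map `b ⊗ a ⊗ x ↦ f(b, a) ⊗ x + (-1)^{n+1} b ⊗ a x`, over `K → E`. -/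
noncomputable def stepE {B : Bimodule.{w} D.E K} {n : ℕ} (F : PartialFace (jK K) B n) :
    BHom (tens (tens B (RingHom.id K) (Bimodule.quot (jK K))) (D.rho K) (Bimodule.self D.E))
      (tens B (D.rho K) (Bimodule.self D.E)) :=
  F.step D.iA

lemma stepE_tmk {B : Bimodule.{w} D.E K} {n : ℕ} (F : PartialFace (jK K) B n) (b : B) (a : A)
    (x : D.E) :
    (D.stepE F).1 (tmk (D.rho K) (N := Bimodule.self D.E)
        (tmk (RingHom.id K) b (quotMk (jK K) a)) x) =
      tmk (D.rho K) (N := Bimodule.self D.E) (F.f b a) x +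
        (-1 : ℤ) ^ (n + 1) • tmk (D.rho K) (N := Bimodule.self D.E) b (D.iA a * x) :=
  F.step_tmk D.iA b a x

/-- The canonical surjection `B ⊗_K E → B ⊗_A E`. -/
noncomputable def canE (B : Bimodule.{w} D.E A) :
    BHom (tens (B.resR (jK K)) (D.rho K) (Bimodule.self D.E))
      (tens B ((RingHom.id D.E).comp D.iA) (Bimodule.self D.E)) :=
  canSurj (jK K) D.iA B

lemma canE_tmk (B : Bimodule.{w} D.E A) (b : B) (x : D.E) :
    (D.canE B).1 (tmk (D.rho K) (N := Bimodule.self D.E) (toR (jK K) b) x) =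
      tmk ((RingHom.id D.E).comp D.iA) (N := Bimodule.self D.E) b x := rfl

lemma op_smul_tmk_el (B : Bimodule.{w} D.E A) (b : B) (a : A) (x : D.E) :
    tmk ((RingHom.id D.E).comp D.iA) (N := Bimodule.self D.E) (op a • b) x =
      tmk ((RingHom.id D.E).comp D.iA) (N := Bimodule.self D.E) b (D.iA a * x) :=
  tmk_bal (φ := (RingHom.id D.E).comp D.iA) (N := Bimodule.self D.E) b a x

/-- The last face multiplies the split-off a back onto γ(v), which restores the original element up
to sign. -/
lemma stepE_splitBar (hK : D.IsStable K) {B : Bimodule.{w} D.E K} {n : ℕ}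
    (F : PartialFace (jK K) B n) (b : B) (a : A) (v : V) :
    (D.stepE F).1 ((D.splitBar hK B).1
        (tmk (D.rho K) (N := Bimodule.self D.E) b (D.el a v))) =
      tmk (D.rho K) (N := Bimodule.self D.E) (F.f b a) (D.el 1 v) +
      (-1 : ℤ) ^ (n + 1) • tmk (D.rho K) (N := Bimodule.self D.E) b (D.el a v) := by
  rw [splitBar_tmk, stepE_tmk, D.iA_mul_el, mul_one]

/-- At the bottom of a row the first face produces b a ⊗ γ(v), which is the section of the
augmentation applied to the image of b ⊗ a γ(v) in B ⊗_A E. -/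
lemma stepE_splitBar_base (hK : D.IsStable K) (B : Bimodule.{w} D.E A)
    (y : tens (B.resR (jK K)) (D.rho K) (Bimodule.self D.E)) :
    (D.stepE (PartialFace.base (jK K) B)).1 ((D.splitBar hK (B.resR (jK K))).1 y) =
      (D.splitAug hK B).1 ((D.canE B).1 y) - y := by
  refine D.tensE_hom_ext (f := ((D.stepE (PartialFace.base (jK K) B)).1 ∘ₗ
      (D.splitBar hK (B.resR (jK K))).1).toAddMonoidHom)
    (g := ((D.splitAug hK B).1 ∘ₗ (D.canE B).1).toAddMonoidHom - AddMonoidHom.id _)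
    (fun b a v => ?_) y
  refine (D.stepE_splitBar hK (PartialFace.base (jK K) B) b a v).trans ?_
  rw [zero_add, pow_one, neg_one_smul, AddMonoidHom.sub_apply, sub_eq_add_neg]
  rfl

/-- The same mechanism as for the bar homotopy, with a split off from a γ(v) in place of an inserted
1: the first faces commute with the splitting, and the last face gives back y. -/
lemma stepE_splitBar_next (hK : D.IsStable K) {B : Bimodule.{w} D.E K} {n : ℕ}
    (F : PartialFace (jK K) B n)
    (y : tens (tens B (RingHom.id K) (Bimodule.quot (jK K))) (D.rho K) (Bimodule.self D.E)) :
    (D.stepE F.next).1 ((D.splitBar hK _).1 y) =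
      (D.splitBar hK B).1 ((D.stepE F).1 y) + (-1 : ℤ) ^ n • y := by
  refine D.tensE_hom_ext (f := ((D.stepE F.next).1 ∘ₗ (D.splitBar hK _).1).toAddMonoidHom)
    (g := ((D.splitBar hK B).1 ∘ₗ (D.stepE F).1).toAddMonoidHom +
      (-1 : ℤ) ^ n • AddMonoidHom.id _) (fun t a v => ?_) y
  refine (D.stepE_splitBar hK F.next t a v).trans ?_
  refine congrArg₂ (· + ·) ?_ (congrArg₂ (· • ·) ?_ rfl)
  · change _ = (D.splitBar hK B).1 ((D.stepE F).1 _)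
    induction t using tens_induction with
    | h0 => rw [map_zero, AddMonoidHom.zero_apply, zero_tmk, zero_tmk, map_zero, map_zero]
    | h1 b q =>
      obtain ⟨e, rfl⟩ := quotMk_surjective (jK K) q
      rw [stepE_tmk, F.next_f_tmk, add_tmk, zsmul_tmk, map_add, map_zsmul, D.iA_mul_el,
        splitBar_tmk, splitBar_tmk]
    | h2 t t' h h' => rw [F.next.f_add, add_tmk, h, h', add_tmk, map_add, map_add]
  · rw [pow_succ, pow_succ]; simp

/-- Over A the factor a may move across the tensor sign, so b a ⊗ γ(v) and b ⊗ a γ(v) agree. -/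
lemma canE_splitAug (hK : D.IsStable K) (B : Bimodule.{w} D.E A)
    (y : tens B ((RingHom.id D.E).comp D.iA) (Bimodule.self D.E)) :
    (D.canE B).1 ((D.splitAug hK B).1 y) = y := by
  refine D.tensE_hom_ext (f := ((D.canE B).1 ∘ₗ (D.splitAug hK B).1).toAddMonoidHom)
    (g := AddMonoidHom.id _) (fun b a v => ?_) y
  refine (congrArg (D.canE B).1 (D.splitAug_tmk hK B b a v)).trans ?_
  rw [canE_tmk, op_smul_tmk_el, D.iA_mul_el, mul_one]
  rfl

lemma canE_stepE_base (B : Bimodule.{w} D.E A)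
    (y : tens (tens (B.resR (jK K)) (RingHom.id K) (Bimodule.quot (jK K))) (D.rho K)
      (Bimodule.self D.E)) :
    (D.canE B).1 ((D.stepE (PartialFace.base (jK K) B)).1 y) = 0 := by
  refine tens_hom_ext (f := ((D.canE B).1 ∘ₗ
    (D.stepE (PartialFace.base (jK K) B)).1).toAddMonoidHom) (g := 0) (fun t x => ?_) y
  change (D.canE B).1 ((D.stepE (PartialFace.base (jK K) B)).1 (tmk _ t x)) = 0
  induction t using tens_induction with
  | h0 => rw [zero_tmk, map_zero, map_zero]
  | h1 b q =>
    obtain ⟨e, rfl⟩ := quotMk_surjective (jK K) q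
    rw [stepE_tmk, map_add, map_zsmul, zero_add, pow_one, neg_one_smul]
    exact add_neg_eq_zero.2 (D.op_smul_tmk_el B ((toR (jK K)).symm b) e x)
  | h2 t t' ht ht' => rw [add_tmk, map_add, map_add, ht, ht', add_zero]

lemma stepE_stepE {B : Bimodule.{w} D.E K} {n : ℕ} {F : PartialFace (jK K) B n} (h : F.IsAssoc)
    (y) : (D.stepE F).1 ((D.stepE F.next).1 y) = 0 :=
  h.step_step D.iA y

end CrossedSystem

/-! ### Evaluation of bimodule maps and extensionality on direct sums -/

section apply
variable {S R C : Type*} [Ring S] [Ring R] [Ring C]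

namespace BHom
variable {M N P : Bimodule S R}

lemma zsmul_apply (l : ℤ) (f : BHom M N) (x : M) : (l • f).1 x = l • f.1 x := by
  rw [AddSubgroup.coe_zsmul, LinearMap.smul_apply]

lemma sub_apply (f g : BHom M N) (x : M) : (f - g).1 x = f.1 x - g.1 x := rfl

lemma neg_apply (f : BHom M N) (x : M) : (-f).1 x = -f.1 x := rfl

lemma zero_apply (x : M) : (0 : BHom M N).1 x = 0 := rfl

lemma sum_apply {ι : Type*} (s : Finset ι) (f : ι → BHom M N) (x : M) :
    (∑ i ∈ s, f i).1 x = ∑ i ∈ s, (f i).1 x := by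
  rw [AddSubgroup.val_finsetSum, LinearMap.sum_apply]

lemma comp_apply (g : BHom N P) (f : BHom M N) (x : M) : (g ∘ₑ f).1 x = g.1 (f.1 x) := rfl

lemma ext {f g : BHom M N} (h : ∀ x, f.1 x = g.1 x) : f = g :=
  Subtype.ext (LinearMap.ext h)

end BHom

namespace BHomOver
variable {φ : R →+* C} {M N P : Bimodule S C}

lemma zsmul_apply (l : ℤ) (f : BHomOver φ M N) (x : M) : (l • f).1 x = l • f.1 x := by
  rw [AddSubgroup.coe_zsmul, LinearMap.smul_apply]

lemma add_apply (f g : BHomOver φ M N) (x : M) : (f + g).1 x = f.1 x + g.1 x := rfl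

lemma sub_apply (f g : BHomOver φ M N) (x : M) : (f - g).1 x = f.1 x - g.1 x := rfl

lemma neg_apply (f : BHomOver φ M N) (x : M) : (-f).1 x = -f.1 x := rfl

lemma sum_apply {ι : Type*} (s : Finset ι) (f : ι → BHomOver φ M N) (x : M) :
    (∑ i ∈ s, f i).1 x = ∑ i ∈ s, (f i).1 x := by
  rw [AddSubgroup.val_finsetSum, LinearMap.sum_apply]

end BHomOver

section dsum
variable {ι : Type} [DecidableEq ι]

lemma dsumLift_dincl {M : ι → Bimodule.{w} S R} {N : Bimodule S R} (f : ∀ i, BHom (M i) N)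
    (i : ι) (x : M i) : (dsumLift f).1 ((dincl M i).1 x) = (f i).1 x :=
  DirectSum.toModule_lof S (M := fun i => M i) (φ := fun i => (f i).1) i x

lemma dsumLiftOver_dincl {φ : R →+* C} {M : ι → Bimodule.{w} S C} {N : Bimodule S C}
    (f : ∀ i, BHomOver φ (M i) N) (i : ι) (x : M i) :
    (dsumLiftOver φ f).1 ((dincl M i).1 x) = (f i).1 x :=
  DirectSum.toModule_lof S (M := fun i => M i) (φ := fun i => (f i).1) i x

lemma dsum_hom_ext {M : ι → Bimodule.{w} S R} {P : Type*} [AddCommGroup P]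
    {f g : dsum M →+ P} (h : ∀ i (x : M i), f ((dincl M i).1 x) = g ((dincl M i).1 x))
    (x : dsum M) : f x = g x := by
  refine DFunLike.congr_fun (DirectSum.addHom_ext (f := f) (g := g) fun i y => ?_) x
  exact h i y

end dsum

/-- The elements b ⊗ 1 generate B ⊗_R G as a right G-module. This matters because the d^l are
prescribed only on such elements. -/
lemma extendRight_ext {S R : Type*} [Ring S] [Ring R] {G : Type w} [Ring G] {φ : R →+* G}
    {B : Bimodule.{w} S R} {N : Bimodule S G} {f g : BHom (tens B φ (Bimodule.self G)) N}
    (h : ∀ b, f.1 (tmk φ (N := Bimodule.self G) b (1 : G)) =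
      g.1 (tmk φ (N := Bimodule.self G) b (1 : G))) (x : tens B φ (Bimodule.self G)) :
    f.1 x = g.1 x := by
  refine tens_hom_ext (f := f.1.toAddMonoidHom) (g := g.1.toAddMonoidHom) (fun b (y : G) => ?_) x
  have e : tmk φ (N := Bimodule.self G) b y =
      op y • tmk φ (N := Bimodule.self G) b (1 : G) :=
    congrArg (fun z : G => tmk φ (N := Bimodule.self G) b z) (one_mul y).symm
  change f.1 _ = g.1 _
  rw [e, f.2, g.2, h]

end apply

/-! ### Signed identities for the rows and for the complex Y -/

namespace CrossedSystem
variable {k : Type u} {A V : Type w} [Field k] [Ring A] [Algebra k A] [AddCommGroup V] [Module k V]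
  (D : CrossedSystem k A V) {K : Subalgebra k A} (hK : D.IsStable K)

lemma neg_one_pow_smul_smul {M : Type*} [AddCommGroup M] (n : ℕ) (x : M) :
    (-1 : ℤ) ^ n • (-1 : ℤ) ^ n • x = x := by
  rcases neg_one_pow_eq_or ℤ n with h | h <;> simp [h]

lemma signed_stepE_stepE {B : Bimodule.{w} D.E K} {n : ℕ} {F : PartialFace (jK K) B n}
    (h : F.IsAssoc) (l : ℤ) (y) : (l • D.stepE F).1 ((l • D.stepE F.next).1 y) = 0 := by
  rw [BHom.zsmul_apply, BHom.zsmul_apply, map_zsmul, D.stepE_stepE h, smul_zero, smul_zero]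

lemma canE_signed_stepE (B : Bimodule.{w} D.E A) (l : ℤ) (y) :
    (D.canE B).1 ((l • D.stepE (PartialFace.base (jK K) B)).1 y) = 0 := by
  rw [BHom.zsmul_apply, map_zsmul, D.canE_stepE_base B, smul_zero]

lemma signed_homotopy_base (B : Bimodule.{w} D.E A) (s : ℕ)
    (y : tens (B.resR (jK K)) (D.rho K) (Bimodule.self D.E)) :
    ((-1 : ℤ) ^ s • D.stepE (PartialFace.base (jK K) B)).1
        (((-1 : ℤ) ^ (0 + s + 1) • D.splitBar hK (B.resR (jK K))).1 y) +
      (D.splitAug hK B).1 ((D.canE B).1 y) = y := by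
  rw [BHom.zsmul_apply, BHomOver.zsmul_apply, map_zsmul, stepE_splitBar_base, zero_add, pow_succ,
    smul_comm, mul_smul, neg_one_smul, smul_neg, neg_one_pow_smul_smul, neg_sub,
    sub_add_cancel]

/-- The signs (-1)^s of d⁰ and (-1)^(r+s+1) of σ⁰ are those that turn the alternating commutation
rule of the unsigned maps into d⁰σ⁰ + σ⁰d⁰ = 1. -/
lemma signed_homotopy_next {B : Bimodule.{w} D.E K} {r : ℕ} (F : PartialFace (jK K) B r) (s : ℕ)
    (y : tens (tens B (RingHom.id K) (Bimodule.quot (jK K))) (D.rho K) (Bimodule.self D.E)) :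
    ((-1 : ℤ) ^ s • D.stepE F.next).1 (((-1 : ℤ) ^ (r + 1 + s + 1) • D.splitBar hK _).1 y) +
      ((-1 : ℤ) ^ (r + s + 1) • D.splitBar hK B).1 (((-1 : ℤ) ^ s • D.stepE F).1 y) = y := by
  rw [BHom.zsmul_apply, BHomOver.zsmul_apply, map_zsmul, stepE_splitBar_next,
    BHomOver.zsmul_apply, BHom.zsmul_apply, map_zsmul]
  generalize (D.splitBar hK B).1 ((D.stepE F).1 y) = z
  rcases neg_one_pow_eq_or ℤ r with hr | hr <;> rcases neg_one_pow_eq_or ℤ s with hs | hs <;>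
    simp only [pow_add, pow_one, hr, hs] <;> simp

variable (K) in
lemma d0_d0 (r s : ℕ) (x : D.X K (r + 2) s) : (D.d0 K r s).1 ((D.d0 K (r + 1) s).1 x) = 0 :=
  D.signed_stepE_stepE (barFace_isAssoc (jK K) (D.M s) r) ((-1) ^ s) x

variable (K) in
lemma nu_d0 (s : ℕ) (x : D.X K 1 s) : (D.nu K s).1 ((D.d0 K 0 s).1 x) = 0 :=
  D.canE_signed_stepE (D.M s) ((-1) ^ s) x

lemma nu_sig0Aug (s : ℕ) (y : D.Y s) : (D.nu K s).1 ((D.sig0Aug hK s).1 y) = y :=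
  D.canE_splitAug hK (D.M s) y

lemma d0_sig0_zero (s : ℕ) (x : D.X K 0 s) : (D.d0 K 0 s).1 ((D.sig0 hK 0 s).1 x) +
    (D.sig0Aug hK s).1 ((D.nu K s).1 x) = x :=
  D.signed_homotopy_base hK (D.M s) s x

lemma d0_sig0_succ (r s : ℕ) (x : D.X K (r + 1) s) :
    (D.d0 K (r + 1) s).1 ((D.sig0 hK (r + 1) s).1 x) +
      (D.sig0 hK r s).1 ((D.d0 K r s).1 x) = x :=
  D.signed_homotopy_next hK (barFace (jK K) (D.M s) r) s x

lemma bd_bd (s : ℕ) (y : D.Y (s + 2)) : (D.bd s).1 ((D.bd (s + 1)).1 y) = 0 :=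
  barD_barD D.iA (RingHom.id D.E) (Bimodule.self D.E) s y

/-- The signs of σ⁻¹ are such that -σ⁻¹, and not σ⁻¹, contracts Y. This is why σ⁻¹ enters σ̄ with a
minus sign and why the augmentation of the resolution is -μ. -/
lemma bd_sigm1_succ (s : ℕ) (y : D.Y (s + 1)) :
    (D.bd (s + 1)).1 ((D.sigm1 K (s + 1)).1 y) + (D.sigm1 K s).1 ((D.bd s).1 y) = -y := by
  have h := barD_barH_succ D.iA (Bimodule.self D.E) s y
  have e : ∀ s (y : D.Y s), (D.sigm1 K s).1 y =
      (-1 : ℤ) ^ s • (barH D.iA (Bimodule.self D.E) s).1 y := fun s y =>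
    BHomOver.zsmul_apply ((-1 : ℤ) ^ s) (BHomOver.res (jK K) (barH D.iA (Bimodule.self D.E) s)) y
  rw [e, e, map_zsmul]
  change (-1 : ℤ) ^ (s + 1) • (barD D.iA (RingHom.id D.E) (Bimodule.self D.E) (s + 1)).1
    ((barH D.iA (Bimodule.self D.E) (s + 1)).1 y) + (-1 : ℤ) ^ s •
      (barH D.iA (Bimodule.self D.E) s).1
        ((barD D.iA (RingHom.id D.E) (Bimodule.self D.E) s).1 y) = -y
  rw [h]
  generalize (barH D.iA (Bimodule.self D.E) s).1 _ = z
  rcases neg_one_pow_eq_or ℤ s with hs | hs <;> simp only [pow_succ, hs] <;> simp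

/-- The multiplication map `E ⊗_A E → E`. -/
noncomputable def mulY : BHom (D.Y 0) (Bimodule.self D.E) :=
  mulMap D.iA (RingHom.id D.E)

/-- The simple tensor `y ⊗_A x` of `E ⊗_A E`. -/
noncomputable def tmulY (y x : D.E) : D.Y 0 := tmk ((RingHom.id D.E).comp D.iA)
    (N := Bimodule.self D.E) (toR D.iA (M := Bimodule.self D.E) y) x

lemma mulY_tmulY (y x : D.E) : D.mulY.1 (D.tmulY y x) = y * x := rfl

lemma sigm1Zero_apply (x : D.E) : (D.sigm1Zero K).1 x = -D.tmulY x 1 := rfl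

lemma Y_zero_ext {P : Type*} [AddCommGroup P] {f g : D.Y 0 →+ P}
    (h : ∀ y x, f (D.tmulY y x) = g (D.tmulY y x)) (z : D.Y 0) : f z = g z :=
  tens_hom_ext h z

lemma mulY_sigm1Zero (x : D.E) : D.mulY.1 ((D.sigm1Zero K).1 x) = -x := by
  rw [sigm1Zero_apply, map_neg, mulY_tmulY, mul_one]

variable (K) in
lemma bd_sigm1_tmulY (y x : D.E) :
    (D.bd 0).1 ((D.sigm1 K 0).1 (D.tmulY y x)) = D.tmulY (y * x) 1 - D.tmulY y x := by
  refine Eq.trans ?_ (barD_barH_zero D.iA (Bimodule.self D.E) y x)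
  refine congrArg (D.bd 0).1 ((BHomOver.zsmul_apply ((-1 : ℤ) ^ 0)
    (BHomOver.res (jK K) (barH D.iA (Bimodule.self D.E) 0)) (D.tmulY y x)).trans ?_)
  rw [pow_zero, one_smul]
  rfl

lemma bd_sigm1_zero (z : D.Y 0) :
    (D.bd 0).1 ((D.sigm1 K 0).1 z) + (D.sigm1Zero K).1 (D.mulY.1 z) = -z := by
  refine D.Y_zero_ext (f := ((D.bd 0).1 ∘ₗ (D.sigm1 K 0).1 + (D.sigm1Zero K).1 ∘ₗ
    D.mulY.1).toAddMonoidHom) (g := -AddMonoidHom.id _) (fun y x => ?_) z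
  change (D.bd 0).1 ((D.sigm1 K 0).1 (D.tmulY y x)) +
    (D.sigm1Zero K).1 (D.mulY.1 (D.tmulY y x)) = -D.tmulY y x
  rw [bd_sigm1_tmulY, mulY_tmulY, sigm1Zero_apply]
  abel

lemma mulY_step (t : tens ((Bimodule.self D.E).resR D.iA) (RingHom.id A) (Bimodule.quot D.iA))
    (x : D.E) : D.mulY.1 (((PartialFace.base D.iA (Bimodule.self D.E)).step (RingHom.id D.E)).1
      (tmk ((RingHom.id D.E).comp D.iA) (N := Bimodule.self D.E) t x)) = 0 := by
  induction t using tens_induction with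
  | h0 => rw [zero_tmk, map_zero]; exact map_zero _
  | h1 m q =>
    obtain ⟨c, rfl⟩ := quotMk_surjective D.iA q
    change D.E at m
    refine (congrArg D.mulY.1 ((PartialFace.base D.iA (Bimodule.self D.E)).step_tmk
      (RingHom.id D.E) m c x)).trans ?_
    refine (congrArg D.mulY.1 (congrArg₂ (· + ·) rfl ?_)).trans
      (b := D.mulY.1 (D.tmulY (m * c) x + -D.tmulY m (c * x))) ?_
    · rw [zero_add, pow_one, neg_one_smul]; rfl
    · rw [map_add, map_neg, mulY_tmulY, mulY_tmulY, mul_assoc, add_neg_cancel]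
  | h2 t t' ht ht' =>
    rw [add_tmk, map_add]
    exact (map_add D.mulY.1 _ _).trans ((congrArg₂ (· + ·) ht ht').trans (add_zero 0))

lemma mulY_bd (y : D.Y 1) : D.mulY.1 ((D.bd 0).1 y) = 0 :=
  have e : D.bd 0 = (PartialFace.base D.iA (Bimodule.self D.E)).step (RingHom.id D.E) := rfl
  e ▸ tens_hom_ext (f := (D.mulY.1 ∘ₗ ((PartialFace.base D.iA (Bimodule.self D.E)).step
    (RingHom.id D.E)).1).toAddMonoidHom) (g := 0) D.mulY_step y

variable (K) in
lemma mulMap_tmk_toR (y x : D.E) : (mulMap (jK K) D.iA).1 (tmk (D.rho K)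
    (N := Bimodule.self D.E) (toR (jK K) (toR D.iA (M := Bimodule.self D.E) y)) x) = y * x := rfl

variable (K) in
lemma mulY_nu_tmk (y x : D.E) : D.mulY.1 ((D.nu K 0).1 (tmk (D.rho K)
    (N := Bimodule.self D.E) (toR (jK K) (toR D.iA (M := Bimodule.self D.E) y)) x)) = y * x := rfl

variable (K) in
lemma mulMap_eq_mulY_nu (x : D.X K 0 0) : (mulMap (jK K) D.iA).1 x =
    D.mulY.1 ((D.nu K 0).1 x) :=
  tens_hom_ext (f := (mulMap (jK K) D.iA).1.toAddMonoidHom)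
    (g := (D.mulY.1 ∘ₗ (D.nu K 0).1).toAddMonoidHom)
    (fun y x => (D.mulMap_tmk_toR K y x).trans (D.mulY_nu_tmk K y x).symm) x

/-! ### Total operators on the direct sums -/

/-- The direct sum of all the `Y_s`. -/
noncomputable def YY : Bimodule.{w} D.E D.E := dsum D.Y

/-- The inclusion of `Y_s` in the direct sum. -/
noncomputable def incY (s : ℕ) : BHom (D.Y s) D.YY := dincl D.Y s

variable (K) in
/-- The maps `ν_s` together, zero on `X_{rs}` for `r > 0`. -/
noncomputable def nuT : BHom (D.XX K) D.YY :=
  D.glue K fun r s => match r with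
    | 0 => D.incY s ∘ₑ D.nu K s
    | _ + 1 => 0

/-- The maps `∂` together, zero on `Y_0`. -/
noncomputable def bdT : BHom D.YY D.YY :=
  dsumLift fun s => match s with
    | 0 => 0
    | s + 1 => D.incY s ∘ₑ D.bd s

/-- The maps `σ⁰ : Y_s → X_{0s}` together. -/
noncomputable def augT : BHomOver (D.rho K) D.YY (D.XX K) :=
  dsumLiftOver (D.rho K) fun s => BHom.over _ (D.inc K 0 s) ∘ₖ D.sig0Aug hK s

variable (K) in
/-- The maps `σ⁻¹ : Y_s → Y_{s+1}` together. -/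
noncomputable def sigm1T : BHomOver (D.rho K) D.YY D.YY :=
  dsumLiftOver (D.rho K) fun s => BHom.over _ (D.incY (s + 1)) ∘ₖ D.sigm1 K s

variable {D} in
lemma XX_hom_ext {P : Type*} [AddCommGroup P] {f g : D.XX K →+ P}
    (h : ∀ r s (x : D.X K r s), f ((D.inc K r s).1 x) = g ((D.inc K r s).1 x)) (x : D.XX K) :
    f x = g x :=
  dsum_hom_ext (M := fun p : ℕ × ℕ => D.X K p.1 p.2) (fun p x => h p.1 p.2 x) x

variable {D} in
lemma YY_hom_ext {P : Type*} [AddCommGroup P] {f g : D.YY →+ P}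
    (h : ∀ s (y : D.Y s), f ((D.incY s).1 y) = g ((D.incY s).1 y)) (y : D.YY) : f y = g y :=
  dsum_hom_ext (M := D.Y) h y

variable (K) in
lemma glue_inc {N : Bimodule.{w} D.E D.E} (f : ∀ r s, BHom (D.X K r s) N) (r s : ℕ)
    (x : D.X K r s) : (D.glue K f).1 ((D.inc K r s).1 x) = (f r s).1 x :=
  dsumLift_dincl (M := fun p : ℕ × ℕ => D.X K p.1 p.2) (fun p => f p.1 p.2) (r, s) x

variable (K) in
lemma glueOver_inc {N : Bimodule.{w} D.E D.E} (f : ∀ r s, BHomOver (D.rho K) (D.X K r s) N)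
    (r s : ℕ) (x : D.X K r s) : (D.glueOver K f).1 ((D.inc K r s).1 x) = (f r s).1 x :=
  dsumLiftOver_dincl (M := fun p : ℕ × ℕ => D.X K p.1 p.2) (fun p => f p.1 p.2) (r, s) x

lemma sig0Tot_inc (r s : ℕ) (x : D.X K r s) : (D.sig0Tot hK).1 ((D.inc K r s).1 x) =
    (D.inc K (r + 1) s).1 ((D.sig0 hK r s).1 x) :=
  D.glueOver_inc K _ r s x

lemma dTot_inc (l r s : ℕ) (x : D.X K r s) : (D.dTot hK l).1 ((D.inc K r s).1 x) =
    (D.d hK l r s).1 x :=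
  D.glue_inc K _ r s x

lemma dSum_inc (r s : ℕ) (x : D.X K r s) : (D.dSum hK).1 ((D.inc K r s).1 x) =
    ∑ l ∈ Finset.range (s + 1), (D.d hK l r s).1 x :=
  (D.glue_inc K _ r s x).trans (BHom.sum_apply _ _ x)

variable (K) in
lemma nuT_inc_zero (s : ℕ) (x : D.X K 0 s) : (D.nuT K).1 ((D.inc K 0 s).1 x) =
    (D.incY s).1 ((D.nu K s).1 x) :=
  D.glue_inc K _ 0 s x

variable (K) in
lemma nuT_inc_succ (r s : ℕ) (x : D.X K (r + 1) s) :
    (D.nuT K).1 ((D.inc K (r + 1) s).1 x) = 0 :=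
  D.glue_inc K _ (r + 1) s x

lemma bdT_incY_zero (y : D.Y 0) : D.bdT.1 ((D.incY 0).1 y) = 0 :=
  dsumLift_dincl (M := D.Y) _ 0 y

lemma bdT_incY_succ (s : ℕ) (y : D.Y (s + 1)) :
    D.bdT.1 ((D.incY (s + 1)).1 y) = (D.incY s).1 ((D.bd s).1 y) :=
  dsumLift_dincl (M := D.Y) _ (s + 1) y

lemma augT_incY (s : ℕ) (y : D.Y s) : (D.augT hK).1 ((D.incY s).1 y) =
    (D.inc K 0 s).1 ((D.sig0Aug hK s).1 y) :=
  dsumLiftOver_dincl (M := D.Y) _ s y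

variable (K) in
lemma sigm1T_incY (s : ℕ) (y : D.Y s) : (D.sigm1T K).1 ((D.incY s).1 y) =
    (D.incY (s + 1)).1 ((D.sigm1 K s).1 y) :=
  dsumLiftOver_dincl (M := D.Y) _ s y

lemma d_zero_zero (s : ℕ) : D.d hK 0 0 s = 0 := by
  rw [d]

lemma d_zero_succ (r s : ℕ) : D.d hK 0 (r + 1) s = D.inc K r s ∘ₑ D.d0 K r s := by
  rw [d]

/-- The bimodule map on `X_{rs}` that coincides with `f` on the elements `b ⊗ 1`. -/
noncomputable def extX {r s : ℕ} {N : Bimodule.{w} D.E D.E}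
    (f : BHomOver (D.rho K) (D.X K r s) N) : BHom (D.X K r s) N :=
  extendRight (φ := D.rho K) (B := barL (jK K) (D.M s) r) f

lemma d_succ_succ (l r s : ℕ) : D.d hK (l + 1) (r + 1) s =
    if l + 1 ≤ s then D.extX (-(D.sig0Tot hK ∘ₖ BHom.over _ (D.d hK (l + 1) r s ∘ₑ D.d0 K r s)) -
        ∑ j : Fin l, D.sig0Tot hK ∘ₖ
          BHom.over _ (D.dTot hK (l - j) ∘ₑ D.d hK (j + 1) (r + 1) s))
    else 0 := by
  rw [d]; rfl

lemma d_one_zero_succ (s : ℕ) : D.d hK 1 0 (s + 1) = D.extX (BHom.over _ (D.inc K 0 s) ∘ₖ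
      D.sig0Aug hK s ∘ₖ BHom.over _ (D.bd s ∘ₑ D.nu K (s + 1))) := by
  rw [d]; rfl

lemma d_add_two_zero (l s : ℕ) : D.d hK (l + 2) 0 s =
    if l + 2 ≤ s then D.extX (-∑ j : Fin (l + 1), D.sig0Tot hK ∘ₖ
      BHom.over _ (D.dTot hK (l + 1 - j) ∘ₑ D.d hK (j + 1) 0 s))
    else 0 := by
  rw [d]; rfl

/-- With this vanishing, sums of d^l over l ≤ s may be taken over any longer range, the same for
elements from different rows. -/
lemma d_eq_zero {l s : ℕ} (h : s < l + 1) (r : ℕ) : D.d hK (l + 1) r s = 0 := by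
  match l, r, s with
  | l, r + 1, s => rw [d_succ_succ, if_neg (by omega)]
  | 0, 0, 0 => rw [d]
  | 0, 0, s + 1 => omega
  | l + 1, 0, s => rw [d_add_two_zero, if_neg (by omega)]

lemma dTot_zero_inc_zero (s : ℕ) (x : D.X K 0 s) : (D.dTot hK 0).1 ((D.inc K 0 s).1 x) = 0 := by
  rw [dTot_inc, d_zero_zero]; rfl

lemma dTot_zero_inc_succ (r s : ℕ) (x : D.X K (r + 1) s) :
    (D.dTot hK 0).1 ((D.inc K (r + 1) s).1 x) = (D.inc K r s).1 ((D.d0 K r s).1 x) := by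
  rw [dTot_inc, d_zero_succ]; rfl

/-- The element `b ⊗ 1` of `X_{rs}`. -/
noncomputable def gen {r s : ℕ} (b : barL (jK K) (D.M s) r) : D.X K r s :=
  tmk (D.rho K) (N := Bimodule.self D.E) b (1 : D.E)

variable {D} in
lemma X_ext {r s : ℕ} {N : Bimodule D.E D.E} {f g : BHom (D.X K r s) N}
    (h : ∀ b, f.1 (D.gen b) = g.1 (D.gen b)) (x : D.X K r s) : f.1 x = g.1 x :=
  extendRight_ext h x

lemma extX_gen {r s : ℕ} {N : Bimodule.{w} D.E D.E}
    (f : BHomOver (D.rho K) (D.X K r s) N) (b : barL (jK K) (D.M s) r) :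
    (D.extX f).1 (D.gen b) = f.1 (D.gen b) :=
  (extendRight_tmk (φ := D.rho K) (B := barL (jK K) (D.M s) r) f b 1).trans
    (by rw [op_one, one_smul]; rfl)

/-- The separate term with d⁰ in the recursion is the term j = 0 of the sum, so a single sum over 0
≤ j ≤ l describes the case r > 0. -/
lemma d_succ_succ_gen {l s : ℕ} (h : l + 1 ≤ s) (r : ℕ) (b : barL (jK K) (D.M s) (r + 1)) :
    (D.d hK (l + 1) (r + 1) s).1 (D.gen b) = -∑ j ∈ Finset.range (l + 1),
      (D.sig0Tot hK).1 ((D.dTot hK (l + 1 - j)).1 ((D.d hK j (r + 1) s).1 (D.gen b))) := by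
  rw [d_succ_succ, if_pos h, extX_gen, Finset.sum_range_succ', Finset.sum_range, d_zero_succ,
    BHomOver.sub_apply, BHomOver.neg_apply, BHomOver.sum_apply, neg_add, sub_eq_add_neg,
    add_comm]
  refine congrArg₂ (· + ·) (congrArg Neg.neg (Finset.sum_congr rfl fun j _ => ?_)) ?_
  · rw [Nat.add_sub_add_right]; rfl
  · rw [Nat.sub_zero, BHom.comp_apply, dTot_inc]; rfl

/-- Here the term j = 0 is zero because d⁰ vanishes on X_{0s}. Keeping it gives the same sum as for
r > 0, and the term through Y enters only d¹. -/
lemma d_succ_zero_gen {l s : ℕ} (h : l + 1 ≤ s) (b : barL (jK K) (D.M s) 0) :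
    (D.d hK (l + 1) 0 s).1 (D.gen b) =
      (if l = 0 then (D.augT hK).1 (D.bdT.1 ((D.nuT K).1 ((D.inc K 0 s).1 (D.gen b)))) else 0) -
      ∑ j ∈ Finset.range (l + 1),
        (D.sig0Tot hK).1 ((D.dTot hK (l + 1 - j)).1 ((D.d hK j 0 s).1 (D.gen b))) := by
  rw [Finset.sum_range_succ', d_zero_zero, BHom.zero_apply, map_zero, map_zero, add_zero]
  match l, s with
  | 0, s + 1 =>
    rw [d_one_zero_succ, extX_gen, if_pos rfl, Finset.sum_range_zero, sub_zero, nuT_inc_zero,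
      bdT_incY_succ, augT_incY]
    rfl
  | l + 1, s =>
    rw [d_add_two_zero, if_pos h, extX_gen, if_neg (Nat.succ_ne_zero l), zero_sub, Finset.sum_range]
    refine congrArg Neg.neg ((BHomOver.sum_apply _ _ _).trans (Finset.sum_congr rfl fun j _ => ?_))
    rw [Nat.add_sub_add_right]; rfl

/-! ### Bidegrees of the maps d^l -/

variable (K) in
/-- The image of `X_{rs}` in the direct sum. -/
noncomputable def gr (r s : ℕ) : Submodule D.E (D.XX K) := LinearMap.range (D.inc K r s).1

variable {D} in
lemma inc_mem_gr {r s : ℕ} (x : D.X K r s) : (D.inc K r s).1 x ∈ D.gr K r s := ⟨x, rfl⟩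

/-- Reduction to generators: membership need only be tested on b ⊗ 1 when the submodule is also
stable on the right. -/
lemma mem_of_gen {r s : ℕ} {N : Bimodule D.E D.E} {p : Submodule D.E N}
    (hp : ∀ (e : D.E), ∀ y ∈ p, op e • y ∈ p) (f : BHom (D.X K r s) N)
    (h : ∀ b, f.1 (D.gen b) ∈ p) (x : D.X K r s) : f.1 x ∈ p := by
  induction x using tens_induction with
  | h0 => rw [map_zero]; exact p.zero_mem
  | h1 b y =>
    change D.E at y
    have e : f.1 (op y • D.gen b) = f.1 (tmk (D.rho K) (N := Bimodule.self D.E) b y) :=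
      congrArg (fun z : D.E => f.1 (tmk (D.rho K) (N := Bimodule.self D.E) b z)) (one_mul y)
    refine Eq.mp (congrArg (· ∈ p) e) ?_
    rw [f.2]
    exact hp y _ (h b)
  | h2 x y hx hy => rw [map_add]; exact p.add_mem hx hy

lemma op_smul_mem_gr {r s : ℕ} (e : D.E) (y : D.XX K) (hy : y ∈ D.gr K r s) :
    op e • y ∈ D.gr K r s := by
  obtain ⟨x, rfl⟩ := hy
  exact ⟨op e • x, (D.inc K r s).2 e x⟩

lemma sig0Tot_mem_gr {r s : ℕ} {y : D.XX K} (hy : y ∈ D.gr K r s) :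
    (D.sig0Tot hK).1 y ∈ D.gr K (r + 1) s := by
  obtain ⟨x, rfl⟩ := hy
  rw [sig0Tot_inc]
  exact inc_mem_gr _

lemma augT_mem_gr {s : ℕ} (y : D.Y s) : (D.augT hK).1 ((D.incY s).1 y) ∈ D.gr K 0 s := by
  rw [augT_incY]
  exact inc_mem_gr _

/-- Strong induction on l covers the terms σ⁰ d^(l+1-j) d^j with 1 ≤ j ≤ l. The term j = 0 involves
the same superscript l + 1, but after d⁰ has lowered r; hence the inner induction on r. -/
lemma d_mem_gr (l : ℕ) : ∀ (r : ℕ) {s : ℕ}, l + 1 ≤ s → ∀ x : D.X K r s,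
    (D.d hK (l + 1) r s).1 x ∈ D.gr K (r + l) (s - (l + 1)) := by
  induction l using Nat.strong_induction_on with
  | _ l ihl =>
    have key : ∀ (r j s : ℕ) (b : barL (jK K) (D.M s) r), l + 1 ≤ s → j < l →
        (D.sig0Tot hK).1 ((D.dTot hK (l + 1 - (j + 1))).1 ((D.d hK (j + 1) r s).1 (D.gen b)))
          ∈ D.gr K (r + l) (s - (l + 1)) := by
      intro r j s b hs hj
      -- Both factors have superscripts j + 1 and i + 1 below l + 1, so the induction hypothesis
      -- applies to each; σ⁰ then raises r by one.
      obtain ⟨i, rfl⟩ : ∃ i, l = j + i + 1 := ⟨l - j - 1, by omega⟩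
      obtain ⟨y, hy⟩ := ihl j hj r (s := s) (by omega) (D.gen b)
      have h := D.sig0Tot_mem_gr hK (ihl i (by omega) (r + j) (s := s - (j + 1)) (by omega) y)
      rw [← hy, dTot_inc, show j + i + 1 + 1 - (j + 1) = i + 1 by omega,
        show r + (j + i + 1) = r + j + i + 1 by omega,
        show s - (j + i + 1 + 1) = s - (j + 1) - (i + 1) by omega]
      exact h
    intro r
    induction r with
    | zero =>
      intro s hs x
      refine D.mem_of_gen D.op_smul_mem_gr _ (fun b => ?_) x
      rw [d_succ_zero_gen D hK hs, Finset.sum_range_succ', d_zero_zero, BHom.zero_apply, map_zero,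
        map_zero, add_zero]
      refine Submodule.sub_mem _ ?_ (Submodule.sum_mem _ fun j hj => ?_)
      · split_ifs with h
        · obtain rfl := h
          obtain ⟨s, rfl⟩ : ∃ s', s = s' + 1 := ⟨s - 1, by omega⟩
          rw [nuT_inc_zero, bdT_incY_succ]
          exact D.augT_mem_gr hK _
        · exact Submodule.zero_mem _
      · exact key 0 j s b hs (Finset.mem_range.1 hj)
    | succ r ihr =>
      intro s hs x
      refine D.mem_of_gen D.op_smul_mem_gr _ (fun b => ?_) x
      rw [d_succ_succ_gen D hK hs, Finset.sum_range_succ', d_zero_succ]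
      refine Submodule.neg_mem _ (Submodule.add_mem _
        (Submodule.sum_mem _ fun j hj => key (r + 1) j s b hs (Finset.mem_range.1 hj)) ?_)
      have h := D.sig0Tot_mem_gr hK (ihr hs ((D.d0 K r s).1 (D.gen b)))
      rw [Nat.sub_zero, BHom.comp_apply, dTot_inc]
      convert h using 2
      omega

lemma dTot_mem_gr {l r s : ℕ} (h : l + 1 ≤ s) {y : D.XX K} (hy : y ∈ D.gr K r s) :
    (D.dTot hK (l + 1)).1 y ∈ D.gr K (r + l) (s - (l + 1)) := by
  obtain ⟨x, rfl⟩ := hy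
  rw [dTot_inc]
  exact D.d_mem_gr hK l r h x

/-! ### The filtration by s and the injectivity of 1 + σ⁰ d⁺ -/

/-- The sum of the `d^l` with `l ≥ 1`. -/
noncomputable def dPos : BHom (D.XX K) (D.XX K) := D.dSum hK - D.dTot hK 0

lemma dSum_eq (x : D.XX K) : (D.dSum hK).1 x = (D.dTot hK 0).1 x + (D.dPos hK).1 x := by
  rw [dPos, BHom.sub_apply, add_sub_cancel]

lemma dPos_inc (r s : ℕ) (x : D.X K r s) : (D.dPos hK).1 ((D.inc K r s).1 x) =
    ∑ l ∈ Finset.range s, (D.d hK (l + 1) r s).1 x := by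
  rw [dPos, BHom.sub_apply, dSum_inc, dTot_inc, Finset.sum_range_succ', add_sub_cancel_right]

variable (K) in
/-- The sum of the `X_{rs}` with `s < m`. -/
noncomputable def fil (m : ℕ) : Submodule D.E (D.XX K) :=
  ⨆ (p : ℕ × ℕ) (_ : p.2 < m), D.gr K p.1 p.2

variable {D} in
lemma gr_le_fil {r s m : ℕ} (h : s < m) : D.gr K r s ≤ D.fil K m :=
  le_iSup₂_of_le (r, s) h le_rfl

variable {D} in
lemma fil_le {m : ℕ} {p : Submodule D.E (D.XX K)}
    (h : ∀ r s, s < m → ∀ x : D.X K r s, (D.inc K r s).1 x ∈ p) : D.fil K m ≤ p := by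
  refine iSup₂_le fun q hq => ?_
  rintro _ ⟨x, rfl⟩
  exact h q.1 q.2 hq x

lemma sig0Tot_mem_fil {m : ℕ} {y : D.XX K} (hy : y ∈ D.fil K m) :
    (D.sig0Tot hK).1 y ∈ D.fil K m := by
  refine fil_le (p := (D.fil K m).comap (D.sig0Tot hK).1) (fun r s h x => ?_) hy
  exact gr_le_fil h (D.sig0Tot_mem_gr hK (inc_mem_gr x))

/-- Every d^l with l ≥ 1 lowers s by l, so d⁺ drops the filtration by at least one step; this is the
source of all the nilpotency below. -/
lemma dPos_mem_fil {m : ℕ} {y : D.XX K} (hy : y ∈ D.fil K (m + 1)) :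
    (D.dPos hK).1 y ∈ D.fil K m := by
  refine fil_le (p := (D.fil K m).comap (D.dPos hK).1) (fun r s h x => ?_) hy
  rw [Submodule.mem_comap, dPos_inc]
  refine Submodule.sum_mem _ fun l hl => ?_
  have hl := Finset.mem_range.1 hl
  exact gr_le_fil (by omega) (D.d_mem_gr hK l r (s := s) (by omega) x)

variable {D} in
lemma fil_mono {m n : ℕ} (h : m ≤ n) : D.fil K m ≤ D.fil K n :=
  fil_le fun _ _ hs x => gr_le_fil (by omega) (inc_mem_gr x)

variable {D} in
lemma exists_mem_fil (y : D.XX K) : ∃ m, y ∈ D.fil K m := by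
  have h : y ∈ ⨆ m, D.fil K m := by
    -- The quotient by the union of the filtration kills every summand X_{rs}, hence everything.
    have := XX_hom_ext (f := (⨆ m, D.fil K m).mkQ.toAddMonoidHom) (g := 0) (fun r s x => ?_) y
    · exact (Submodule.Quotient.mk_eq_zero _).1 this
    · exact (Submodule.Quotient.mk_eq_zero _).2
        (Submodule.mem_iSup_of_mem (s + 1) (gr_le_fil s.lt_succ_self (inc_mem_gr x)))
  exact (Submodule.mem_iSup_of_directed _ (Monotone.directed_le fun _ _ => fil_mono)).1 h

/-- From x = -σ⁰ d⁺ x, membership in one filtration step forces membership in the next lower one.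
The filtration is exhaustive and starts at 0. -/
lemma eq_zero_of_add_sig0Tot_dPos {x : D.XX K}
    (h : x + (D.sig0Tot hK).1 ((D.dPos hK).1 x) = 0) : x = 0 := by
  obtain ⟨m, hm⟩ := exists_mem_fil x
  induction m with
  | zero =>
    exact (Submodule.mem_bot D.E).1 (fil_le (p := ⊥) (fun r s h => absurd h s.not_lt_zero) hm)
  | succ m ih =>
    refine ih ?_
    rw [eq_neg_of_add_eq_zero_left h]
    exact Submodule.neg_mem _ (D.sig0Tot_mem_fil hK (D.dPos_mem_fil hK hm))

lemma eq_of_add_sig0Tot_dPos {x y : D.XX K} (h : x + (D.sig0Tot hK).1 ((D.dPos hK).1 x) =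
    y + (D.sig0Tot hK).1 ((D.dPos hK).1 y)) : x = y := by
  refine sub_eq_zero.1 (D.eq_zero_of_add_sig0Tot_dPos hK ?_)
  rw [map_sub, map_sub, sub_add_sub_comm, h, sub_self]

lemma dPos_of_mem_fil {m : ℕ} {y : D.XX K} (hy : y ∈ D.fil K (m + 1)) :
    (D.dPos hK).1 y = ∑ j ∈ Finset.range m, (D.dTot hK (j + 1)).1 y := by
  have h := fil_le (p := LinearMap.eqLocus (D.dPos hK).1
    (∑ j ∈ Finset.range m, (D.dTot hK (j + 1)).1)) (fun r s h x => ?_) hy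
  · exact h.trans (LinearMap.sum_apply _ _ _)
  · refine (D.dPos_inc hK r s x).trans ((Finset.sum_subset
      (Finset.range_subset_range.2 (by omega)) fun j _ hj => ?_).trans
      ((Finset.sum_congr rfl fun j _ => ?_).trans (LinearMap.sum_apply _ _ _).symm))
    · rw [d_eq_zero D hK (by simpa [Nat.lt_succ_iff] using hj), BHom.zero_apply]
    · rw [dTot_inc]

/-- Reorganizes a double sum by total superscript. It turns the recursions for d^l and σ^l, which
are indexed by l, into identities for the single operator d⁺. -/
lemma sum_dPos {s : ℕ} {y : ℕ → D.XX K} (hy : ∀ i ≤ s, y i ∈ D.fil K (s - i + 1)) :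
    ∑ i ∈ Finset.range (s + 1), (D.dPos hK).1 (y i) =
      ∑ l ∈ Finset.range s, ∑ i ∈ Finset.range (l + 1), (D.dTot hK (l + 1 - i)).1 (y i) := by
  rw [Finset.sum_congr rfl fun i hi =>
    D.dPos_of_mem_fil hK (hy i (Nat.lt_succ_iff.1 (Finset.mem_range.1 hi))),
    Finset.sum_sigma', Finset.sum_sigma']
  -- The term d^(j+1) y_i is placed at l = i + j.
  refine Finset.sum_nbij' (fun p => ⟨p.1 + p.2, p.1⟩) (fun p => ⟨p.2, p.1 - p.2⟩) ?_ ?_ ?_ ?_ ?_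
  · rintro ⟨i, j⟩ h
    simp only [Finset.mem_sigma, Finset.mem_range] at h ⊢
    omega
  · rintro ⟨i, j⟩ h
    simp only [Finset.mem_sigma, Finset.mem_range] at h ⊢
    omega
  · rintro ⟨i, j⟩ h
    simp
  · rintro ⟨i, j⟩ h
    simp only [Finset.mem_sigma, Finset.mem_range] at h
    simp only [Sigma.mk.injEq, heq_eq_eq, and_true]
    omega
  · rintro ⟨i, j⟩ h
    simp only [Nat.add_assoc, Nat.add_sub_cancel_left]

/-- The whole recursive definition of the d^l in one formula. Summing over l collects the terms σ⁰
d^(l-j) d^j into σ⁰ d⁺ D. For r > 0 the term through Y vanishes because ν does. -/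
lemma dPos_gen (r s : ℕ) (b : barL (jK K) (D.M s) r) :
    (D.dPos hK).1 ((D.inc K r s).1 (D.gen b)) =
      (D.augT hK).1 (D.bdT.1 ((D.nuT K).1 ((D.inc K r s).1 (D.gen b)))) -
      (D.sig0Tot hK).1 ((D.dPos hK).1 ((D.dSum hK).1 ((D.inc K r s).1 (D.gen b)))) := by
  have h := D.sum_dPos hK (s := s) (y := fun j => (D.d hK j r s).1 (D.gen b)) (by
    -- The element d^i z lies in row s - i; d⁰ keeps the row.
    intro i hi
    match i, r with
    | 0, 0 => rw [d_zero_zero]; exact Submodule.zero_mem _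
    | 0, r + 1 =>
      rw [d_zero_succ]
      exact gr_le_fil (by omega) (inc_mem_gr _)
    | i + 1, r => exact gr_le_fil (by omega) (D.d_mem_gr hK i r hi _))
  rw [dSum_inc, map_sum, h, map_sum, dPos_inc]
  match r with
  | 0 =>
    rw [Finset.sum_congr rfl fun l hl => D.d_succ_zero_gen hK (Finset.mem_range.1 hl) b,
      Finset.sum_sub_distrib, Finset.sum_ite_eq']
    congr 1
    · split_ifs with hs
      · rfl
      -- For s = 0 there is no d¹, in agreement with the convention ∂ = 0 on Y_0.
      · obtain rfl : s = 0 := by simpa using hs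
        rw [nuT_inc_zero, bdT_incY_zero, map_zero]
    · exact Finset.sum_congr rfl fun l _ => (map_sum _ _ _).symm
  | r + 1 =>
    rw [nuT_inc_succ, map_zero, map_zero, zero_sub,
      Finset.sum_congr rfl fun l hl => D.d_succ_succ_gen hK (Finset.mem_range.1 hl) r b,
      Finset.sum_neg_distrib]
    exact congrArg Neg.neg (Finset.sum_congr rfl fun l _ => (map_sum _ _ _).symm)

/-! ### Row identities on the direct sum, and the square of the total differential -/

lemma dTot_zero_dTot_zero (x : D.XX K) : (D.dTot hK 0).1 ((D.dTot hK 0).1 x) = 0 := by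
  refine XX_hom_ext (f := ((D.dTot hK 0).1 ∘ₗ (D.dTot hK 0).1).toAddMonoidHom) (g := 0)
    (fun r s x => ?_) x
  change (D.dTot hK 0).1 ((D.dTot hK 0).1 ((D.inc K r s).1 x)) = 0
  match r with
  | 0 => rw [dTot_zero_inc_zero, map_zero]
  | 1 => rw [dTot_zero_inc_succ, dTot_zero_inc_zero]
  | r + 2 => rw [dTot_zero_inc_succ, dTot_zero_inc_succ, d0_d0, map_zero]

lemma nuT_dTot_zero (x : D.XX K) : (D.nuT K).1 ((D.dTot hK 0).1 x) = 0 := by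
  refine XX_hom_ext (f := ((D.nuT K).1 ∘ₗ (D.dTot hK 0).1).toAddMonoidHom) (g := 0)
    (fun r s x => ?_) x
  change (D.nuT K).1 ((D.dTot hK 0).1 ((D.inc K r s).1 x)) = 0
  match r with
  | 0 => rw [dTot_zero_inc_zero, map_zero]
  | 1 => rw [dTot_zero_inc_succ, nuT_inc_zero, nu_d0, map_zero]
  | r + 2 => rw [dTot_zero_inc_succ, nuT_inc_succ]

lemma nuT_sig0Tot (x : D.XX K) : (D.nuT K).1 ((D.sig0Tot hK).1 x) = 0 := by
  refine XX_hom_ext (f := ((D.nuT K).1 ∘ₗ (D.sig0Tot hK).1).toAddMonoidHom) (g := 0)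
    (fun r s x => ?_) x
  change (D.nuT K).1 ((D.sig0Tot hK).1 ((D.inc K r s).1 x)) = 0
  rw [sig0Tot_inc, nuT_inc_succ]

lemma nuT_augT (y : D.YY) : (D.nuT K).1 ((D.augT hK).1 y) = y := by
  refine YY_hom_ext (f := ((D.nuT K).1 ∘ₗ (D.augT hK).1).toAddMonoidHom)
    (g := AddMonoidHom.id _) (fun s y => ?_) y
  change (D.nuT K).1 ((D.augT hK).1 ((D.incY s).1 y)) = ((D.incY s).1 y)
  rw [augT_incY, nuT_inc_zero, nu_sig0Aug]

lemma dTot_zero_augT (y : D.YY) : (D.dTot hK 0).1 ((D.augT hK).1 y) = 0 := by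
  refine YY_hom_ext (f := ((D.dTot hK 0).1 ∘ₗ (D.augT hK).1).toAddMonoidHom) (g := 0)
    (fun s y => ?_) y
  change (D.dTot hK 0).1 ((D.augT hK).1 ((D.incY s).1 y)) = 0
  rw [augT_incY, dTot_zero_inc_zero]

lemma bdT_bdT (y : D.YY) : D.bdT.1 (D.bdT.1 y) = 0 := by
  refine YY_hom_ext (f := (D.bdT.1 ∘ₗ D.bdT.1).toAddMonoidHom) (g := 0) (fun s y => ?_) y
  change D.bdT.1 (D.bdT.1 _) = 0
  match s with
  | 0 => rw [bdT_incY_zero, map_zero]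
  | 1 => rw [bdT_incY_succ, bdT_incY_zero]
  | s + 2 => rw [bdT_incY_succ, bdT_incY_succ, bd_bd, map_zero]

/-- The contraction of all rows at once; the term through Y is the correction at r = 0. -/
lemma dTot_zero_sig0Tot (x : D.XX K) : (D.dTot hK 0).1 ((D.sig0Tot hK).1 x) =
    x - (D.augT hK).1 ((D.nuT K).1 x) - (D.sig0Tot hK).1 ((D.dTot hK 0).1 x) := by
  refine XX_hom_ext (f := ((D.dTot hK 0).1 ∘ₗ (D.sig0Tot hK).1).toAddMonoidHom)
    (g := AddMonoidHom.id _ - ((D.augT hK).1 ∘ₗ (D.nuT K).1).toAddMonoidHom -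
      ((D.sig0Tot hK).1 ∘ₗ (D.dTot hK 0).1).toAddMonoidHom) (fun r s x => ?_) x
  change (D.dTot hK 0).1 ((D.sig0Tot hK).1 ((D.inc K r s).1 x)) =
    _ - (D.augT hK).1 ((D.nuT K).1 _) - (D.sig0Tot hK).1 ((D.dTot hK 0).1 _)
  rw [sig0Tot_inc, dTot_zero_inc_succ]
  match r with
  | 0 =>
    rw [nuT_inc_zero, augT_incY, dTot_zero_inc_zero, map_zero, sub_zero, AddMonoidHom.id_apply,
      ← map_sub]
    exact congrArg _ (eq_sub_of_add_eq (D.d0_sig0_zero hK s x))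
  | r + 1 =>
    rw [nuT_inc_succ, map_zero, sub_zero, dTot_zero_inc_succ, sig0Tot_inc, AddMonoidHom.id_apply,
      ← map_sub]
    exact congrArg _ (eq_sub_of_add_eq (D.d0_sig0_succ hK r s x))

lemma XX_ext {N : Bimodule D.E D.E} {f g : BHom (D.XX K) N}
    (h : ∀ r s b, f.1 ((D.inc K r s).1 (D.gen b)) = g.1 ((D.inc K r s).1 (D.gen b)))
    (x : D.XX K) : f.1 x = g.1 x :=
  XX_hom_ext (f := f.1.toAddMonoidHom) (g := g.1.toAddMonoidHom) (fun r s x =>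
    X_ext (f := f ∘ₑ D.inc K r s) (g := g ∘ₑ D.inc K r s) (fun b => h r s b) x) x

/-- Of the formula for d⁺ on generators, only the part through Y survives ν: both d⁰ and σ⁰ have
image in its kernel, and ν splits the section from Y. -/
lemma nuT_dSum (x : D.XX K) : (D.nuT K).1 ((D.dSum hK).1 x) = D.bdT.1 ((D.nuT K).1 x) := by
  refine D.XX_ext (f := D.nuT K ∘ₑ D.dSum hK) (g := D.bdT ∘ₑ D.nuT K) (fun r s b => ?_) x
  rw [BHom.comp_apply, BHom.comp_apply, dSum_eq, map_add, nuT_dTot_zero, dPos_gen, map_sub,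
    nuT_augT, nuT_sig0Tot, zero_add, sub_zero]

lemma dTot_zero_dSum (x : D.XX K) : (D.dTot hK 0).1 ((D.dSum hK).1 x) =
    (D.dTot hK 0).1 ((D.dPos hK).1 x) := by
  rw [dSum_eq, map_add, dTot_zero_dTot_zero, zero_add]

lemma nuT_dPos (x : D.XX K) : (D.nuT K).1 ((D.dPos hK).1 x) = D.bdT.1 ((D.nuT K).1 x) := by
  rw [← nuT_dSum D hK, dSum_eq, map_add, nuT_dTot_zero, zero_add]

/-- Apply d⁰ to the formula for d⁺z and use the row contraction on d⁰σ⁰. The term d⁺Dz cancels, and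
the term through Y is ∂∂νz = 0. -/
lemma dSum_dSum_gen (r s : ℕ) (b : barL (jK K) (D.M s) r) :
    (D.dSum hK).1 ((D.dSum hK).1 ((D.inc K r s).1 (D.gen b))) =
      (D.sig0Tot hK).1 ((D.dTot hK 0).1
        ((D.dSum hK).1 ((D.dSum hK).1 ((D.inc K r s).1 (D.gen b))))) := by
  have h := D.dPos_gen hK r s b
  generalize (D.inc K r s).1 (D.gen b) = z at h ⊢
  rw [dTot_zero_dSum, dSum_eq D hK ((D.dSum hK).1 z), dTot_zero_dSum, h, map_sub, dTot_zero_augT,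
    dTot_zero_sig0Tot, nuT_dPos, nuT_dSum, bdT_bdT, map_zero]
  abel

/-- Induction on the filtration, and on r inside it: for a generator z, d⁺z has smaller s and d⁰z
has smaller r. The previous formula transports the vanishing of D² from these two elements to z. -/
lemma dSum_dSum (x : D.XX K) : (D.dSum hK).1 ((D.dSum hK).1 x) = 0 := by
  have key : ∀ m, D.fil K m ≤ LinearMap.ker ((D.dSum hK).1 ∘ₗ (D.dSum hK).1) := by
    intro m
    induction m with
    | zero => exact fil_le fun r s h => absurd h s.not_lt_zero
    | succ m ih =>
      refine fil_le fun r => ?_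
      have step : ∀ r s, s < m + 1 → (∀ b : barL (jK K) (D.M s) r,
          (D.dSum hK).1 ((D.dSum hK).1
            ((D.dTot hK 0).1 ((D.inc K r s).1 (D.gen b)))) = 0) → ∀ x : D.X K r s,
          (D.dSum hK).1 ((D.dSum hK).1 ((D.inc K r s).1 x)) = 0 := by
        intro r s hs h0 x
        refine X_ext (f := D.dSum hK ∘ₑ D.dSum hK ∘ₑ D.inc K r s) (g := 0) (fun b => ?_) x
        change (D.dSum hK).1 ((D.dSum hK).1 ((D.inc K r s).1 (D.gen b))) = 0
        have h1 : (D.dSum hK).1 ((D.dSum hK).1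
            ((D.dPos hK).1 ((D.inc K r s).1 (D.gen b)))) = 0 :=
          ih (D.dPos_mem_fil hK (gr_le_fil hs (inc_mem_gr _)))
        have h2 := D.dSum_dSum_gen hK r s b
        specialize h0 b
        generalize (D.inc K r s).1 (D.gen b) = z at h0 h1 h2 ⊢
        -- For w = D²z, replacing only the first w by σ⁰d⁰w gives w + σ⁰d⁺w = σ⁰Dw = σ⁰D²(d⁰z + d⁺z)
        -- = 0.
        refine D.eq_zero_of_add_sig0Tot_dPos hK ?_
        refine (congrArg (· + _) h2).trans ?_
        rw [← map_add (D.sig0Tot hK).1, ← dSum_eq, D.dSum_eq hK z, map_add, map_add, map_add, h0,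
          h1, map_zero, add_zero]
      induction r with
      | zero =>
        intro s hs x
        refine step 0 s hs (fun b => ?_) x
        rw [dTot_zero_inc_zero, map_zero, map_zero]
      | succ r ihr =>
        intro s hs x
        refine step (r + 1) s hs (fun b => ?_) x
        rw [dTot_zero_inc_succ]
        exact ihr s hs _
  obtain ⟨m, hm⟩ := exists_mem_fil x
  exact key m hm

/-! ### The maps σ^l and their sums -/

section sig
variable {Z : Bimodule.{w} D.E D.E} (f : BHomOver (D.rho K) Z (D.XX K))

lemma sig_zero : D.sig hK f 0 = f := by
  rw [sig]

lemma sig_succ_apply (l : ℕ) (z : Z) : (D.sig hK f (l + 1)).1 z =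
    -∑ i ∈ Finset.range (l + 1),
      (D.sig0Tot hK).1 ((D.dTot hK (l + 1 - i)).1 ((D.sig hK f i).1 z)) := by
  rw [sig, BHomOver.neg_apply, BHomOver.sum_apply, Finset.sum_range]
  rfl

variable {f} {z : Z} {r s : ℕ} (h : f.1 z ∈ D.gr K r s)
include h

lemma sig_mem_gr (l : ℕ) (hl : l ≤ s) : (D.sig hK f l).1 z ∈ D.gr K (r + l) (s - l) := by
  induction l using Nat.strong_induction_on with
  | _ l ih =>
    match l with
    | 0 => rwa [sig_zero]
    | l + 1 =>
      rw [sig_succ_apply]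
      refine Submodule.neg_mem _ (Submodule.sum_mem _ fun i hi => ?_)
      obtain ⟨j, rfl⟩ : ∃ j, l = i + j :=
        ⟨l - i, by have := Finset.mem_range.1 hi; omega⟩
      have h' := D.sig0Tot_mem_gr hK (D.dTot_mem_gr hK (l := j) (by omega)
        (ih i (by omega) (by omega)))
      rw [show i + j + 1 - i = j + 1 by omega, show r + (i + j + 1) = r + i + j + 1 by omega,
        show s - (i + j + 1) = s - i - (j + 1) by omega]
      exact h'

/-- Summing the recursion over l, the terms σ^l with l > 0 add up to -σ⁰ d⁺ ∑ σ^l and only f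
remains. The sum of the σ^l is thus the solution of (1 + σ⁰ d⁺) x = f(z). -/
lemma sum_sig : ∑ l ∈ Finset.range (s + 1), (D.sig hK f l).1 z + (D.sig0Tot hK).1
    ((D.dPos hK).1 (∑ l ∈ Finset.range (s + 1), (D.sig hK f l).1 z)) = f.1 z := by
  rw [map_sum, D.sum_dPos hK fun i hi => gr_le_fil (by omega) (D.sig_mem_gr hK h i hi), map_sum,
    Finset.sum_range_succ', sig_zero,
    Finset.sum_congr rfl fun l _ => D.sig_succ_apply hK f l z, Finset.sum_neg_distrib,
    Finset.sum_congr rfl fun l _ => map_sum (D.sig0Tot hK).1 _ _]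
  abel

end sig

/-- The sums of the maps `σ^l` on the `X_{rs}`. -/
noncomputable def sigXT : BHomOver (D.rho K) (D.XX K) (D.XX K) :=
  D.glueOver K fun r s => ∑ l ∈ Finset.range (s + 1), D.sigX hK l r s

/-- The sums of the maps `σ^l` on the `Y_s`. -/
noncomputable def sigYT : BHomOver (D.rho K) D.YY (D.XX K) :=
  dsumLiftOver (D.rho K) fun s => ∑ l ∈ Finset.range (s + 1), D.sigY hK l s

lemma sigXT_inc (r s : ℕ) (x : D.X K r s) : (D.sigXT hK).1 ((D.inc K r s).1 x) =
    ∑ l ∈ Finset.range (s + 1), (D.sigX hK l r s).1 x :=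
  (D.glueOver_inc K _ r s x).trans (BHomOver.sum_apply _ _ x)

lemma sigYT_incY (s : ℕ) (y : D.Y s) : (D.sigYT hK).1 ((D.incY s).1 y) =
    ∑ l ∈ Finset.range (s + 1), (D.sigY hK l s).1 y :=
  (dsumLiftOver_dincl (M := D.Y) _ s y).trans (BHomOver.sum_apply _ _ y)

lemma sigXT_eq (x : D.XX K) : (D.sigXT hK).1 x +
    (D.sig0Tot hK).1 ((D.dPos hK).1 ((D.sigXT hK).1 x)) = (D.sig0Tot hK).1 x := by
  refine XX_hom_ext (f := ((D.sigXT hK).1 + (D.sig0Tot hK).1 ∘ₗ (D.dPos hK).1 ∘ₗ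
    (D.sigXT hK).1).toAddMonoidHom) (g := (D.sig0Tot hK).1.toAddMonoidHom) (fun r s x => ?_) x
  change (D.sigXT hK).1 ((D.inc K r s).1 x) + (D.sig0Tot hK).1 ((D.dPos hK).1 ((D.sigXT hK).1 ((D.inc K r s).1 x))) =
    (D.sig0Tot hK).1 ((D.inc K r s).1 x)
  rw [sigXT_inc, sig0Tot_inc]
  exact D.sum_sig hK (f := BHom.over _ (D.inc K (r + 1) s) ∘ₖ D.sig0 hK r s) (z := x)
    (inc_mem_gr _)

lemma sigYT_eq (y : D.YY) : (D.sigYT hK).1 y +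
    (D.sig0Tot hK).1 ((D.dPos hK).1 ((D.sigYT hK).1 y)) = (D.augT hK).1 y := by
  refine YY_hom_ext (f := ((D.sigYT hK).1 + (D.sig0Tot hK).1 ∘ₗ (D.dPos hK).1 ∘ₗ
    (D.sigYT hK).1).toAddMonoidHom) (g := (D.augT hK).1.toAddMonoidHom) (fun s y => ?_) y
  change (D.sigYT hK).1 ((D.incY s).1 y) + (D.sig0Tot hK).1 ((D.dPos hK).1 ((D.sigYT hK).1 ((D.incY s).1 y))) =
    (D.augT hK).1 ((D.incY s).1 y)
  rw [sigYT_incY, augT_incY]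
  exact D.sum_sig hK (f := BHom.over _ (D.inc K 0 s) ∘ₖ D.sig0Aug hK s) (z := y) (inc_mem_gr _)

/-! ### The homotopy formula after applying 1 + σ⁰ d⁺ -/

lemma dTot_zero_dPos (x : D.XX K) : (D.dTot hK 0).1 ((D.dPos hK).1 x) =
    -(D.dPos hK).1 ((D.dSum hK).1 x) := by
  have h := D.dSum_dSum hK x
  rw [dSum_eq, dTot_zero_dSum] at h
  exact eq_neg_of_add_eq_zero_left h

/-- The operator 1 + σ⁰ d⁺ intertwines the total differential with the unperturbed d⁰ + α∂ν, where α
is `augT`. This uses d⁰d⁺ = -d⁺D, a form of D² = 0, and the row contraction. The image y is named so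
that the lemma applies when y is known and x is not explicit. -/
lemma add_sig0Tot_dPos_dSum_of_eq {x y : D.XX K}
    (h : x + (D.sig0Tot hK).1 ((D.dPos hK).1 x) = y) :
    (D.dSum hK).1 x + (D.sig0Tot hK).1 ((D.dPos hK).1 ((D.dSum hK).1 x)) =
      (D.dTot hK 0).1 y + (D.augT hK).1 (D.bdT.1 ((D.nuT K).1 y)) := by
  have hn : (D.nuT K).1 y = (D.nuT K).1 x := by
    rw [← h, map_add, nuT_sig0Tot, add_zero]
  rw [hn, ← h, map_add, dTot_zero_sig0Tot, nuT_dPos, dTot_zero_dPos, map_neg, dSum_eq]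
  abel

lemma dSum_sigXT (x : D.XX K) : (D.dSum hK).1 ((D.sigXT hK).1 x) +
    (D.sig0Tot hK).1 ((D.dPos hK).1 ((D.dSum hK).1 ((D.sigXT hK).1 x))) =
      (D.dTot hK 0).1 ((D.sig0Tot hK).1 x) := by
  rw [D.add_sig0Tot_dPos_dSum_of_eq hK (D.sigXT_eq hK x), nuT_sig0Tot, map_zero, map_zero,
    add_zero]

lemma dSum_sigYT (y : D.YY) : (D.dSum hK).1 ((D.sigYT hK).1 y) +
    (D.sig0Tot hK).1 ((D.dPos hK).1 ((D.dSum hK).1 ((D.sigYT hK).1 y))) =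
      (D.augT hK).1 (D.bdT.1 y) := by
  rw [D.add_sig0Tot_dPos_dSum_of_eq hK (D.sigYT_eq hK y), dTot_zero_augT, nuT_augT, zero_add]

lemma sigBarSum_eq (x : D.XX K) : (D.sigBarSum hK).1 x =
    (D.sigXT hK).1 x - (D.sigYT hK).1 ((D.sigm1T K).1 ((D.nuT K).1 x)) := by
  refine XX_hom_ext (f := (D.sigBarSum hK).1.toAddMonoidHom) (g := ((D.sigXT hK).1 -
    (D.sigYT hK).1 ∘ₗ (D.sigm1T K).1 ∘ₗ (D.nuT K).1).toAddMonoidHom) (fun r s x => ?_) x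
  change (D.sigBarSum hK).1 ((D.inc K r s).1 x) =
    (D.sigXT hK).1 ((D.inc K r s).1 x) - (D.sigYT hK).1 ((D.sigm1T K).1 ((D.nuT K).1 ((D.inc K r s).1 x)))
  refine (D.glueOver_inc K _ r s x).trans ?_
  match r with
  | 0 =>
    rw [nuT_inc_zero, sigm1T_incY, sigYT_incY, sigXT_inc, BHomOver.add_apply, BHomOver.neg_apply,
      BHomOver.sum_apply, BHomOver.sum_apply, sub_eq_neg_add]
    rfl
  | r + 1 =>
    rw [nuT_inc_succ, map_zero, map_zero, sub_zero, sigXT_inc]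
    exact BHomOver.sum_apply _ _ x

/-- The homotopy formula, up to the invertible operator `1 + σ⁰ ∑_{l≥1} d^l`. -/
lemma homotopy_aux (x : D.XX K) :
    (D.dSum hK).1 ((D.sigBarSum hK).1 x) + (D.sigBarSum hK).1 ((D.dSum hK).1 x) +
      (D.sig0Tot hK).1 ((D.dPos hK).1 ((D.dSum hK).1 ((D.sigBarSum hK).1 x) +
        (D.sigBarSum hK).1 ((D.dSum hK).1 x))) =
    x + (D.sig0Tot hK).1 ((D.dPos hK).1 x) - (D.augT hK).1 ((D.nuT K).1 x +
      D.bdT.1 ((D.sigm1T K).1 ((D.nuT K).1 x)) + (D.sigm1T K).1 (D.bdT.1 ((D.nuT K).1 x))) := by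
  have h1 := D.dSum_sigXT hK x
  have h2 := D.dSum_sigYT hK ((D.sigm1T K).1 ((D.nuT K).1 x))
  have h3 := D.sigXT_eq hK ((D.dSum hK).1 x)
  have h4 := D.sigYT_eq hK ((D.sigm1T K).1 ((D.nuT K).1 ((D.dSum hK).1 x)))
  rw [dTot_zero_sig0Tot] at h1
  rw [nuT_dSum] at h4
  -- Only the right side is to be split, into σ⁰d⁰x + σ⁰d⁺x: the first term cancels against the row
  -- contraction in `h1`, the second completes x to (1 + σ⁰ d⁺) x.
  rw [D.dSum_eq hK x, map_add (D.sig0Tot hK).1, ← D.dSum_eq hK x] at h3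
  rw [sigBarSum_eq, sigBarSum_eq, nuT_dSum]
  simp only [map_add, map_sub]
  rw [show ∀ a b c d a' b' c' d' : D.XX K, a - b + (c - d) + (a' - b' + (c' - d')) =
    (a + a') - (b + b') + (c + c') - (d + d') from fun _ _ _ _ _ _ _ _ => by abel,
    h1, h2, h3, h4]
  abel

end CrossedSystem

/-! ### Relative projectivity, and resolutions from contracting homotopies -/

section relative
variable {S R C : Type*} [Ring S] [Ring R] [Ring C]

lemma IsUpsilon.of_section {φ : R →+* C} {M N : Bimodule S C} {f : BHom M N}
    (g : BHomOver φ N M) (h : ∀ x, f.1 (g.1 x) = x) : IsUpsilon φ f :=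
  ⟨fun x => ⟨g.1 x, h x⟩, g, h⟩

/-- The inclusion of the kernel of a bimodule map. -/
def BHom.kerIncl {M N : Bimodule S C} (f : BHom M N) : BHom (BHom.ker f) M :=
  ⟨(LinearMap.ker f.1).subtype, fun _ _ => rfl⟩

lemma BHom.apply_kerIncl {M N : Bimodule S C} (f : BHom M N) (x : BHom.ker f) :
    f.1 ((BHom.kerIncl f).1 x) = 0 :=
  LinearMap.mem_ker.1 (Subtype.property (p := fun y => y ∈ LinearMap.ker f.1) x)

/-- The homotopy restricted to the kernel is a splitting of the corestriction. -/
lemma IsUpsilon.toKer {φ : R →+* C} {L M N : Bimodule S C} {f : BHom M N} {g : BHom L M}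
    (h : f ∘ₑ g = 0) (σ : BHomOver φ M L) (hσ : ∀ x, f.1 x = 0 → g.1 (σ.1 x) = x) :
    IsUpsilon φ (BHom.toKer f g h) :=
  IsUpsilon.of_section (σ ∘ₖ BHom.over φ (BHom.kerIncl f)) fun x =>
    Subtype.ext (hσ ((BHom.kerIncl f).1 x) (BHom.apply_kerIncl f x))

/-- A complex of relatively projective bimodules with a contracting homotopy is a relatively
projective resolution. -/
lemma IsContractingHomotopy.isUpsilonProjectiveResolution {φ : R →+* C} {P : ℕ → Bimodule S C}
    {Q : Bimodule S C} {d : ∀ n, BHom (P (n + 1)) (P n)} {ε : BHom (P 0) Q}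
    {h₀ : BHomOver φ Q (P 0)} {h : ∀ n, BHomOver φ (P n) (P (n + 1))}
    (H : IsContractingHomotopy φ P d ε h₀ h) (hP : ∀ n, IsUpsilonProjective.{v} φ (P n))
    (hε : ε ∘ₑ d 0 = 0) (hd : ∀ n, d n ∘ₑ d (n + 1) = 0) :
    IsUpsilonProjectiveResolution.{v} φ P d ε where
  projective := hP
  augmentation := IsUpsilon.of_section h₀ H.aug
  exact_zero := ⟨hε, IsUpsilon.toKer hε (h 0) fun x hx => by
    have := H.zero x
    rwa [hx, map_zero, add_zero] at this⟩
  exact_succ := fun n => ⟨hd n, IsUpsilon.toKer (hd n) (h (n + 1)) fun x hx => by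
    have := H.succ n x
    rwa [hx, map_zero, add_zero] at this⟩

/-- The construction of `extendRight` with a target in an arbitrary universe, since the lifting
property is tested against bimodules of any universe. -/
lemma exists_extend_right {G : Type w} [Ring G] {φ : R →+* G} {B : Bimodule.{w} S R}
    {N : Bimodule.{v} S G} (f : BHomOver φ (tens B φ (Bimodule.self G)) N) :
    ∃ g : BHom (tens B φ (Bimodule.self G)) N, ∀ b,
      g.1 (tmk φ (N := Bimodule.self G) b (1 : G)) =
        f.1 (tmk φ (N := Bimodule.self G) b (1 : G)) := by
  let g : tens B φ (Bimodule.self G) →ₗ[S] N := tensLift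
    (AddMonoidHom.mk' (fun b => AddMonoidHom.mk'
        (fun x : G => op x • f.1 (tmk φ (N := Bimodule.self G) b (1 : G)))
        fun x y => by rw [op_add, add_smul]) fun b b' => by
      ext x
      change op x • f.1 (tmk φ _ _) = op x • f.1 _ + op x • f.1 _
      rw [add_tmk, map_add, smul_add])
    (fun b r (x : G) => by
      change op x • f.1 (tmk φ _ _) = op (φ r * x) • f.1 (tmk φ _ _)
      have h : tmk φ (N := Bimodule.self G) (op r • b) (1 : G) =
          op (φ r) • tmk φ (N := Bimodule.self G) b (1 : G) :=
        (tmk_bal b r _).trans (congrArg (fun z : G => tmk φ (N := Bimodule.self G) b z)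
          ((mul_one (φ r)).trans (one_mul (φ r)).symm))
      rw [h, f.2, op_mul, mul_smul])
    (fun s b (x : G) => by
      change op x • f.1 (s • tmk φ _ _) = s • op x • f.1 (tmk φ _ _)
      rw [map_smul]
      exact (smul_comm s (op x) _).symm)
  have hg : ∀ (b : B) (x : G), g (tmk φ (N := Bimodule.self G) b x) =
      op x • f.1 (tmk φ (N := Bimodule.self G) b (1 : G)) := fun _ _ => rfl
  refine ⟨⟨g, fun r y => ?_⟩, fun b => (hg b 1).trans (one_smul Gᵐᵒᵖ _)⟩
  induction y using tens_induction with
  | h0 => rw [smul_zero, map_zero, smul_zero]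
  | h1 b x =>
    rw [op_smul_tmk, hg]
    refine (hg b _).trans ?_
    exact mul_smul (op r) (op x) (f.1 (tmk φ (N := Bimodule.self G) b (1 : G)))
  | h2 y y' h h' => rw [smul_add, map_add, h, h', map_add, smul_add]

/-- Induced bimodules are relatively projective. -/
lemma isUpsilonProjective_tens {G : Type w} [Ring G] (φ : R →+* G) (B : Bimodule.{w} S R) :
    IsUpsilonProjective.{v} φ (tens B φ (Bimodule.self G)) := by
  rintro M N f ⟨-, s, hs⟩ g
  -- The splitting s is only right R-linear, so s ∘ g is kept on the elements b ⊗ 1 and extended by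
  -- right G-linearity.
  obtain ⟨h, hh⟩ := exists_extend_right (s ∘ₖ BHom.over φ g)
  refine ⟨h, BHom.ext fun x => ?_⟩
  refine extendRight_ext (f := f ∘ₑ h) (fun b => ?_) x
  rw [BHom.comp_apply, hh]
  exact hs _

/-- Direct sums of relatively projective bimodules are relatively projective. -/
lemma isUpsilonProjective_dsum {φ : R →+* C} {ι : Type} [DecidableEq ι]
    {P : ι → Bimodule.{w} S C} (hP : ∀ i, IsUpsilonProjective.{v} φ (P i)) :
    IsUpsilonProjective.{v} φ (dsum P) := by
  intro M N f hf g
  choose h hh using fun i => hP i M N f hf (g ∘ₑ dincl P i)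
  refine ⟨dsumLift h, BHom.ext fun x => ?_⟩
  refine dsum_hom_ext (f := (f ∘ₑ dsumLift h).1.toAddMonoidHom) (g := g.1.toAddMonoidHom)
    (fun i x => ?_) x
  refine (congrArg f.1 (dsumLift_dincl h i x)).trans ?_
  exact LinearMap.congr_fun (congrArg Subtype.val (hh i)) x

end relative

/-! ### Restriction to the total degrees n -/

namespace CrossedSystem
variable {k : Type u} {A V : Type w} [Field k] [Ring A] [Algebra k A] [AddCommGroup V] [Module k V]
  (D : CrossedSystem k A V) {K : Subalgebra k A} (hK : D.IsStable K)

variable (K) in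
lemma isUpsilonProjective_Xn (n : ℕ) : IsUpsilonProjective.{v} (D.rho K) (D.Xn K n) :=
  isUpsilonProjective_dsum fun p : {p : ℕ × ℕ // p.1 + p.2 = n} =>
    isUpsilonProjective_tens (D.rho K) (barL (jK K) (D.M p.1.2) p.1.1)

variable (K) in
/-- The inclusion of `X_{rs}` in `X_n`. -/
noncomputable def incn {n r s : ℕ} (h : r + s = n) : BHom (D.X K r s) (D.Xn K n) :=
  dincl (fun p : {p : ℕ × ℕ // p.1 + p.2 = n} => D.X K p.1.1 p.1.2) ⟨(r, s), h⟩

variable {D} in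
lemma Xn_hom_ext {n : ℕ} {P : Type*} [AddCommGroup P] {f g : D.Xn K n →+ P}
    (h : ∀ r s (e : r + s = n) (x : D.X K r s), f ((D.incn K e).1 x) = g ((D.incn K e).1 x))
    (x : D.Xn K n) : f x = g x :=
  dsum_hom_ext (M := fun p : {p : ℕ × ℕ // p.1 + p.2 = n} => D.X K p.1.1 p.1.2)
    (fun p x => h p.1.1 p.1.2 p.2 x) x

variable (K) in
lemma incl_incn {n r s : ℕ} (h : r + s = n) (x : D.X K r s) :
    (D.incl K n).1 ((D.incn K h).1 x) = (D.inc K r s).1 x :=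
  dsumLift_dincl (M := fun p : {p : ℕ × ℕ // p.1 + p.2 = n} => D.X K p.1.1 p.1.2)
    (fun p => D.inc K p.1.1 p.1.2) ⟨(r, s), h⟩ x

variable (K) in
lemma proj_inc {n r s : ℕ} (h : r + s = n) (x : D.X K r s) :
    (D.proj K n).1 ((D.inc K r s).1 x) = (D.incn K h).1 x :=
  (D.glue_inc K _ r s x).trans
    (congrArg (fun f : BHom (D.X K r s) (D.Xn K n) => f.1 x) (dif_pos h))

variable (K) in
lemma proj_incl (n : ℕ) (x : D.Xn K n) : (D.proj K n).1 ((D.incl K n).1 x) = x :=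
  Xn_hom_ext (f := (D.proj K n ∘ₑ D.incl K n).1.toAddMonoidHom) (g := AddMonoidHom.id _)
    (fun r s e x => by
      change (D.proj K n).1 ((D.incl K n).1 ((D.incn K e).1 x)) = (D.incn K e).1 x
      rw [incl_incn, proj_inc D K e]) x

variable {D} in
lemma incl_injective {n : ℕ} {x y : D.Xn K n} (h : (D.incl K n).1 x = (D.incl K n).1 y) :
    x = y := by
  rw [← D.proj_incl K n x, h, proj_incl]

variable (K) in
/-- The image of `X_n` in the direct sum of the `X_{rs}`. -/
noncomputable def deg (n : ℕ) : Submodule D.E (D.XX K) := LinearMap.range (D.incl K n).1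

lemma gr_le_deg {n r s : ℕ} (h : r + s = n) : D.gr K r s ≤ D.deg K n := by
  rintro _ ⟨x, rfl⟩
  exact ⟨(D.incn K h).1 x, D.incl_incn K h x⟩

lemma incl_proj {n : ℕ} {y : D.XX K} (h : y ∈ D.deg K n) :
    (D.incl K n).1 ((D.proj K n).1 y) = y := by
  obtain ⟨x, rfl⟩ := h
  rw [proj_incl]

variable {D} in
lemma deg_le {n : ℕ} {p : Submodule D.E (D.XX K)}
    (h : ∀ r s, r + s = n → ∀ x : D.X K r s, (D.inc K r s).1 x ∈ p) : D.deg K n ≤ p := by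
  rintro _ ⟨x, rfl⟩
  have := Xn_hom_ext (f := p.mkQ.toAddMonoidHom.comp (D.incl K n).1.toAddMonoidHom) (g := 0)
    (fun r s e x => (Submodule.Quotient.mk_eq_zero p).2 (by
      change (D.incl K n).1 ((D.incn K e).1 x) ∈ p
      rw [incl_incn]
      exact h r s e x)) x
  exact (Submodule.Quotient.mk_eq_zero p).1 this

lemma sigX_mem_gr {l r s : ℕ} (h : l ≤ s) (x : D.X K r s) :
    (D.sigX hK l r s).1 x ∈ D.gr K (r + l + 1) (s - l) := by
  rw [Nat.add_right_comm]
  exact D.sig_mem_gr hK (f := BHom.over _ (D.inc K (r + 1) s) ∘ₖ D.sig0 hK r s) (z := x)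
    (inc_mem_gr _) l h

lemma sigY_mem_gr {l s : ℕ} (h : l ≤ s) (y : D.Y s) :
    (D.sigY hK l s).1 y ∈ D.gr K l (s - l) := by
  have := D.sig_mem_gr hK (f := BHom.over _ (D.inc K 0 s) ∘ₖ D.sig0Aug hK s) (z := y)
    (inc_mem_gr _) l h
  rwa [zero_add] at this

/-- Passing from (r, s) to (r + l - 1, s - l) lowers the total degree by one for every l. -/
lemma dSum_mem_deg {n : ℕ} {y : D.XX K} (h : y ∈ D.deg K (n + 1)) :
    (D.dSum hK).1 y ∈ D.deg K n := by
  refine deg_le (p := (D.deg K n).comap (D.dSum hK).1) (fun r s e x => ?_) h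
  rw [Submodule.mem_comap, dSum_inc]
  refine Submodule.sum_mem _ fun l hl => ?_
  have hl := Finset.mem_range.1 hl
  match l, r with
  | 0, 0 => rw [d_zero_zero]; exact Submodule.zero_mem _
  | 0, r + 1 =>
    rw [d_zero_succ]
    exact D.gr_le_deg (by omega) (inc_mem_gr _)
  | l + 1, r => exact D.gr_le_deg (by omega) (D.d_mem_gr hK l r (s := s) (by omega) x)

/-- The maps σ^l keep total degree on Y_s and raise it by one on X_{rs}, while σ⁻¹ raises s by one.
-/
lemma sigBarSum_mem_deg {n : ℕ} {y : D.XX K} (h : y ∈ D.deg K n) :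
    (D.sigBarSum hK).1 y ∈ D.deg K (n + 1) := by
  refine deg_le (p := (D.deg K (n + 1)).comap (D.sigBarSum hK).1) (fun r s e x => ?_) h
  rw [Submodule.mem_comap, sigBarSum_eq, sigXT_inc]
  refine Submodule.sub_mem _ (Submodule.sum_mem _ fun l hl => ?_) ?_
  · have hl := Finset.mem_range.1 hl
    exact D.gr_le_deg (by omega) (D.sigX_mem_gr hK (s := s) (by omega) x)
  · match r with
    | 0 =>
      rw [nuT_inc_zero, sigm1T_incY, sigYT_incY]
      refine Submodule.sum_mem _ fun l hl => ?_
      have hl := Finset.mem_range.1 hl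
      exact D.gr_le_deg (by omega) (D.sigY_mem_gr hK (s := s + 1) (by omega) _)
    | r + 1 => rw [nuT_inc_succ, map_zero, map_zero]; exact Submodule.zero_mem _

/-- By the degree count, the projection in the definition of the differential discards nothing, so
identities on the X_n can be verified on the big direct sum. -/
lemma incl_diff (n : ℕ) (x : D.Xn K (n + 1)) : (D.incl K n).1 ((D.diff hK n).1 x) =
    (D.dSum hK).1 ((D.incl K (n + 1)).1 x) :=
  D.incl_proj (D.dSum_mem_deg hK ⟨x, rfl⟩)

lemma incl_sigBar (n : ℕ) (x : D.Xn K n) : (D.incl K (n + 1)).1 ((D.sigBar hK n).1 x) =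
    (D.sigBarSum hK).1 ((D.incl K n).1 x) :=
  D.incl_proj (D.sigBarSum_mem_deg hK ⟨x, rfl⟩)

lemma diff_diff (n : ℕ) : D.diff hK n ∘ₑ D.diff hK (n + 1) = 0 := by
  refine BHom.ext fun x => incl_injective ?_
  rw [BHom.comp_apply, incl_diff, incl_diff, dSum_dSum, BHom.zero_apply, map_zero]

/-! ### The augmentation and the contracting homotopy -/

/-- The multiplication map on `Y_0`, zero on the other `Y_s`. -/
noncomputable def mulYT : BHom D.YY (Bimodule.self D.E) :=
  dsumLift fun s => match s with
    | 0 => D.mulY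
    | _ + 1 => 0

lemma mulYT_incY_zero (y : D.Y 0) : D.mulYT.1 ((D.incY 0).1 y) = D.mulY.1 y :=
  dsumLift_dincl (M := D.Y) _ 0 y

lemma mulYT_incY_succ (s : ℕ) (y : D.Y (s + 1)) : D.mulYT.1 ((D.incY (s + 1)).1 y) = 0 :=
  dsumLift_dincl (M := D.Y) _ (s + 1) y

lemma mulYT_bdT (y : D.YY) : D.mulYT.1 (D.bdT.1 y) = 0 := by
  refine YY_hom_ext (f := (D.mulYT ∘ₑ D.bdT).1.toAddMonoidHom) (g := 0) (fun s y => ?_) y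
  change D.mulYT.1 (D.bdT.1 ((D.incY s).1 y)) = 0
  match s with
  | 0 => rw [bdT_incY_zero, map_zero]
  | 1 => rw [bdT_incY_succ, mulYT_incY_zero, mulY_bd]
  | s + 2 => rw [bdT_incY_succ, mulYT_incY_succ]

variable (K) in
-- Factoring μ through Y reduces its compatibility with the differential to that of the bar
-- resolution of E over A, because ν intertwines D and ∂.
lemma mu_eq (x : D.Xn K 0) : (D.mu K).1 x = D.mulYT.1 ((D.nuT K).1 ((D.incl K 0).1 x)) := by
  refine Xn_hom_ext (f := (D.mu K).1.toAddMonoidHom)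
    (g := (D.mulYT ∘ₑ D.nuT K ∘ₑ D.incl K 0).1.toAddMonoidHom) (fun r s e x => ?_) x
  obtain ⟨rfl, rfl⟩ : r = 0 ∧ s = 0 := by omega
  change (D.mu K).1 ((D.incn K e).1 x) =
    D.mulYT.1 ((D.nuT K).1 ((D.incl K 0).1 ((D.incn K e).1 x)))
  rw [incl_incn, nuT_inc_zero, mulYT_incY_zero, ← mulMap_eq_mulY_nu]
  rw [mu, BHom.comp_apply, incl_incn]
  exact D.glue_inc K _ 0 0 x

lemma mu_diff : (-D.mu K) ∘ₑ D.diff hK 0 = 0 := by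
  refine BHom.ext fun x => ?_
  rw [BHom.comp_apply, BHom.neg_apply, mu_eq, incl_diff, nuT_dSum, mulYT_bdT, neg_zero]
  rfl

lemma incl_sigBarZero (x : D.E) : (D.incl K 0).1 ((D.sigBarZero hK).1 x) =
    (D.augT hK).1 ((D.incY 0).1 ((D.sigm1Zero K).1 x)) := by
  rw [augT_incY]
  exact D.incl_proj (n := 0) (D.gr_le_deg (r := 0) (s := 0) rfl (inc_mem_gr _))

/-- In positive degree the defect of the homotopy formula is zero: ν vanishes for r > 0, and for r =
0 one has s ≥ 1, where -σ⁻¹ contracts Y. Injectivity of 1 + σ⁰ d⁺ then removes that operator. -/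
lemma homotopy_pos {n : ℕ} {y : D.XX K} (h : y ∈ D.deg K (n + 1)) :
    (D.dSum hK).1 ((D.sigBarSum hK).1 y) + (D.sigBarSum hK).1 ((D.dSum hK).1 y) = y := by
  have h0 : (D.nuT K).1 y + D.bdT.1 ((D.sigm1T K).1 ((D.nuT K).1 y)) +
      (D.sigm1T K).1 (D.bdT.1 ((D.nuT K).1 y)) = 0 := by
    refine deg_le (p := LinearMap.ker ((D.nuT K).1 + D.bdT.1 ∘ₗ (D.sigm1T K).1 ∘ₗ (D.nuT K).1 +
      (D.sigm1T K).1 ∘ₗ D.bdT.1 ∘ₗ (D.nuT K).1)) (fun r s e x => ?_) h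
    change (D.nuT K).1 ((D.inc K r s).1 x) +
      D.bdT.1 ((D.sigm1T K).1 ((D.nuT K).1 ((D.inc K r s).1 x))) +
        (D.sigm1T K).1 (D.bdT.1 ((D.nuT K).1 ((D.inc K r s).1 x))) = 0
    match r, s with
    | 0, 0 => omega
    | 0, s + 1 =>
      rw [nuT_inc_zero, sigm1T_incY, bdT_incY_succ, bdT_incY_succ, sigm1T_incY, add_assoc,
        ← map_add, bd_sigm1_succ, map_neg, add_neg_cancel]
    | r + 1, s => rw [nuT_inc_succ]; simp only [map_zero, add_zero]
  refine D.eq_of_add_sig0Tot_dPos hK ?_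
  rw [homotopy_aux, h0, map_zero, sub_zero]

/-- The operator ∂ is zero on Y_0, so the defect no longer vanishes. By the contraction of the
augmented complex Y it equals the contribution of σ̄_0 composed with -μ. -/
lemma homotopy_zero (x : D.X K 0 0) : (D.dSum hK).1 ((D.sigBarSum hK).1 ((D.inc K 0 0).1 x)) +
    (D.augT hK).1 ((D.incY 0).1 ((D.sigm1Zero K).1 (-D.mulY.1 ((D.nu K 0).1 x)))) =
      (D.inc K 0 0).1 x := by
  have h1 := D.homotopy_aux hK ((D.inc K 0 0).1 x)
  have h2 : (D.dSum hK).1 ((D.inc K 0 0).1 x) = 0 := by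
    rw [dSum_inc, Finset.sum_range_one, d_zero_zero, BHom.zero_apply]
  have h3 := D.bd_sigm1_zero (K := K) ((D.nu K 0).1 x)
  have h4 : (D.dPos hK).1 ((D.inc K 0 0).1 x) = 0 := by
    rw [dPos_inc, Finset.sum_range_zero]
  -- This element lies in X_{00}, where there is no d^l with l ≥ 1, so 1 + σ⁰ d⁺ leaves it
  -- unchanged.
  have h5 : (D.dPos hK).1 ((D.augT hK).1 ((D.incY 0).1
      ((D.sigm1Zero K).1 (-D.mulY.1 ((D.nu K 0).1 x))))) = 0 := by
    rw [augT_incY, dPos_inc, Finset.sum_range_zero]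
  have h6 : (D.nu K 0).1 x + (D.bd 0).1 ((D.sigm1 K 0).1 ((D.nu K 0).1 x)) =
      (D.sigm1Zero K).1 (-D.mulY.1 ((D.nu K 0).1 x)) := by
    rw [map_neg, eq_neg_iff_add_eq_zero, add_assoc, h3, add_neg_cancel]
  rw [h2, map_zero, add_zero, h4, map_zero, add_zero, nuT_inc_zero, sigm1T_incY, bdT_incY_succ,
    bdT_incY_zero, map_zero, add_zero, ← map_add, h6] at h1
  refine D.eq_of_add_sig0Tot_dPos hK ?_
  rw [map_add, map_add, h5, h4, map_zero, add_zero, add_zero, add_right_comm, h1, sub_add_cancel]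

lemma isContractingHomotopy : IsContractingHomotopy (D.rho K) (D.Xn K) (D.diff hK) (-D.mu K)
    (D.sigBarZero hK) (D.sigBar hK) where
  aug x := by
    rw [BHom.neg_apply, mu_eq, incl_sigBarZero, nuT_augT, mulYT_incY_zero, mulY_sigm1Zero, neg_neg]
  zero x := by
    refine incl_injective ?_
    rw [map_add, incl_diff, incl_sigBar, incl_sigBarZero, BHom.neg_apply, mu_eq]
    refine Xn_hom_ext (f := ((D.dSum hK).1 ∘ₗ (D.sigBarSum hK).1 ∘ₗ (D.incl K 0).1 +
      (D.augT hK).1 ∘ₗ (D.incY 0).1 ∘ₗ (D.sigm1Zero K).1 ∘ₗ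
        (-(D.mulYT ∘ₑ D.nuT K ∘ₑ D.incl K 0).1)).toAddMonoidHom)
      (g := (D.incl K 0).1.toAddMonoidHom) (fun r s e x => ?_) x
    -- The only summand of X_0 is X_{00}.
    obtain ⟨rfl, rfl⟩ : r = 0 ∧ s = 0 := by omega
    change (D.dSum hK).1 ((D.sigBarSum hK).1 ((D.incl K 0).1 ((D.incn K e).1 x))) +
      (D.augT hK).1 ((D.incY 0).1 ((D.sigm1Zero K).1
        (-D.mulYT.1 ((D.nuT K).1 ((D.incl K 0).1 ((D.incn K e).1 x)))))) =
          (D.incl K 0).1 ((D.incn K e).1 x)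
    rw [incl_incn, nuT_inc_zero, mulYT_incY_zero, homotopy_zero]
  succ n x := by
    refine incl_injective ?_
    rw [map_add, incl_diff, incl_sigBar, incl_sigBar, incl_diff]
    exact D.homotopy_pos hK ⟨x, rfl⟩

end CrossedSystem

end BrzCross

/-! ### The theorem, with the bidegrees of the recursively defined maps -/

theorem mainTheorem3 {k : Type u} {A V : Type w} [Field k] [Ring A] [Algebra k A]
    [AddCommGroup V] [Module k V] (D : BrzCross.CrossedSystem k A V)
    (K : Subalgebra k A) (hK : D.IsStable K) :
    (∀ l r s : ℕ, 1 ≤ l → l ≤ s → ∀ z : D.X K r s,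
      ∃ y : D.X K (r + l - 1) (s - l), (D.d hK l r s).1 z = (D.inc K (r + l - 1) (s - l)).1 y) ∧
    (∀ l r s : ℕ, l ≤ s → ∀ z : D.X K r s,
      ∃ y : D.X K (r + l + 1) (s - l),
        (D.sigX hK l r s).1 z = (D.inc K (r + l + 1) (s - l)).1 y) ∧
    (∀ l s : ℕ, l ≤ s → ∀ z : D.Y s,
      ∃ y : D.X K l (s - l), (D.sigY hK l s).1 z = (D.inc K l (s - l)).1 y) ∧
    (∀ (n : ℕ) (x : D.Xn K (n + 1)),
      (D.incl K n).1 ((D.diff hK n).1 x) = (D.dSum hK).1 ((D.incl K (n + 1)).1 x)) ∧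
    (∀ (n : ℕ) (x : D.Xn K n),
      (D.incl K (n + 1)).1 ((D.sigBar hK n).1 x) = (D.sigBarSum hK).1 ((D.incl K n).1 x)) ∧
    BrzCross.IsUpsilonProjectiveResolution.{v} (D.rho K) (D.Xn K) (D.diff hK) (-D.mu K) ∧
    BrzCross.IsContractingHomotopy (D.rho K) (D.Xn K) (D.diff hK) (-D.mu K)
      (D.sigBarZero hK) (D.sigBar hK) := by
  refine ⟨fun l r s h hl z => ?_, fun l r s hl z => ?_, fun l s hl z => ?_, D.incl_diff hK,
    D.incl_sigBar hK, (D.isContractingHomotopy hK).isUpsilonProjectiveResolution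
      (D.isUpsilonProjective_Xn K) (D.mu_diff hK) (D.diff_diff hK), D.isContractingHomotopy hK⟩
  -- Writing l = l' + 1 turns the target index r + l - 1 into r + l', with no truncated subtraction.
  · obtain ⟨l, rfl⟩ : ∃ l', l = l' + 1 := ⟨l - 1, by omega⟩
    obtain ⟨y, hy⟩ := D.d_mem_gr hK l r hl z
    exact ⟨y, hy.symm⟩
  · obtain ⟨y, hy⟩ := D.sigX_mem_gr hK hl z
    exact ⟨y, hy.symm⟩
  · obtain ⟨y, hy⟩ := D.sigY_mem_gr hK hl z
    exact ⟨y, hy.symm⟩
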